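/- Let $d\ge 1$ and let $\Omega\subset\mathbb R^d$ be a bounded domain (non-empty, open, connected) with Lipschitz boundary $\Gamma=\partial\Omega$ and surface measure $\mathrm dS$. All function spaces are complex, $\langle f,g\rangle_\Omega=\int_\Omega f\overline g\,\mathrm dx$, $\langle f,g\rangle_\Gamma=\int_\Gamma f\overline g\,\mathrm dS$. Let $\alpha\in L^\infty(\Omega,\mathbb R)$, $\beta,\gamma\in L^\infty(\Gamma,\mathbb R)$ and $\eta>0$ with $\alpha\ge\eta$ a.e. on $\Omega$ and $\beta\ge\eta$ a.e. on $\Gamma$. Let $\mathcal H=L^2(\Omega)\times L^2(\Gamma,\beta^{-1}\mathrm dS)$ with its canonical inner product, and $\langle f,g\rangle_{\Gamma,\beta}=\int_\Gamma\beta^{-1}f\overline g\,\mathrm dS$. *Forms.* A sesquilinear form $\mathfrak b$ with domain $D(\mathfrak b)$ in a Hilbert space $H$ is called *generating* if it is densely defined, semi-bounded ($\operatorname{Re}\mathfrak b(u,u)\ge\lambda\|u\|^2$ for some $\lambda\in\mathbb R$), and, for the form norm $\|u\|_{\mathfrak b}^2=\operatorname{Re}\mathfrak b(u,u)+(1-\lambda_{\mathfrak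 b})\|u\|^2$ with $\lambda_{\mathfrak b}$ the maximal such $\lambda$, it is continuous and closed, i.e. $(D(\mathfrak b),\|\cdot\|_{\mathfrak b})$ is complete. Its associated operator $A$ is given by: $u\in D(A)$, $Au=f$ iff $u\in D(\mathfrak b)$, $f\in H$ and $\mathfrak b(u,v)=\langle f,v\rangle$ for all $v\in D(\mathfrak b)$. *Subsidiary form.* Let $\rho\in(0,1)$ and let $\mathfrak b$ be a generating, symmetric form on $L^2(\Omega)$ which is admissible: $C_c^\infty(\Omega)\subseteq (D(\mathfrak b),\|\cdot\|_{\mathfrak b})\subseteq H^{1/2+\rho}(\Omega)$, the second embedding being continuous and dense. Let $\operatorname{tr}:H^{1/2+\rho}(\Omega)\to L^2(\Gamma)$ be the Dirichlet trace, i.e. the continuous extension of $\varphi\mapsto\varphi|_\Gamma$, $\varphi\in C^\infty(\overline\Omega)$. Let $B_N$ be the operator associated to $\mathfrak b$, and $B_D$ the one associated to the restriction of $\mathfrak b$ to $\{u\in D(\mathfrak b):\operatorname{tr}u=0\}$. Assume that $D(B_D)\cap D(B_N)$ is dense in $L^2(\Omega)$ and let $B_0=B_N|_{D(B_D)\cap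 D(B_N)}$, with adjoint $B_0^*$. Define operators $N^{\mathfrak b},\mathscr N^{\mathfrak b}$ from subspaces of $L^2(\Omega)$ to $L^2(\Gamma)$ by: - $u\in D(N^{\mathfrak b})$, $N^{\mathfrak b}u=g$ iff $u\in D(\mathfrak b)\cap D(B_0^*)$, $g\in L^2(\Gamma)$ and $\langle B_0^*u,v\rangle_\Omega-\mathfrak b(u,v)=\langle g,\operatorname{tr}v\rangle_\Gamma$ for all $v\in D(\mathfrak b)$; - $u\in D(\mathscr N^{\mathfrak b})$, $\mathscr N^{\mathfrak b}u=g$ iff $u\in D(B_0^*)$, $g\in L^2(\Gamma)$ and $\langle B_0^*u,v\rangle_\Omega-\langle u,B_Nv\rangle_\Omega=\langle g,\operatorname{tr}v\rangle_\Gamma$ for all $v\in D(B_N)$. *Primary form.* Let $\mathfrak a(u,v)=\langle\alpha B_Nu_1,B_Nv_1\rangle_\Omega+\langle\gamma u_2,v_2\rangle_{\Gamma,\beta}$ on $D(\mathfrak a)=\{u=(u_1,u_2)\in\mathcal H: u_1\in D(B_N),\ u_2=\operatorname{tr}u_1\}$, and let $\mathcal A$ be its associated operator on $\mathcal H$. **Theorem.**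 The operators $\operatorname{tr}$ (with domain $H^{1/2+\rho}(\Omega)$), $N^{\mathfrak b}$ and $\mathscr N^{\mathfrak b}$ are well defined, and: (i) $\mathfrak a$ is a generating, symmetric form, $\mathcal A$ is self-adjoint, and $-\mathcal A$ generates an analytic semigroup $(\mathcal T(t))_{t\ge0}$ on $\mathcal H$. (ii) $D(\mathcal A)=\{u\in\mathcal H: u_1\in D(B_N),\ \alpha B_Nu_1\in D(\mathscr N^{\mathfrak b}),\ u_2=\operatorname{tr}u_1\}$ and, for $u\in D(\mathcal A)$, $$\mathcal Au=\begin{pmatrix}B_0^*(\alpha B_N)&0\\-\beta\mathscr N^{\mathfrak b}(\alpha B_N)&\gamma\end{pmatrix}\begin{pmatrix}u_1\\u_2\end{pmatrix}=\begin{pmatrix}B_0^*(\alpha B_Nu_1)\\-\beta\mathscr N^{\mathfrak b}(\alpha B_Nu_1)+\gamma u_2\end{pmatrix}.$$ (iii) For every $u_0=(u_{1,0},u_{2,0})\in\mathcal H$ the problem $$\partial_tu_1+B_0^*(\alpha B_Nu_1)=0,\quad \partial_tu_2-\beta\mathscr N^{\mathfrak b}(\alpha B_Nu_1)+\gamma u_2=0,\quad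 \mathscr N^{\mathfrak b}u_1=0,\quad u_2=\operatorname{tr}u_1\quad(t>0),\qquad u(0)=u_0,$$ has a unique classical solution (that is, $u\in C([0,\infty),\mathcal H)\cap C^1((0,\infty),\mathcal H)$, and for every $t>0$ one has $u_1(t)\in D(B_N)$, $\alpha B_Nu_1(t)\in D(\mathscr N^{\mathfrak b})$ and the equations), and it is $u(t)=\mathcal T(t)u_0$. If $N^{\mathfrak b}$ is surjective onto $L^2(\Gamma)$, then (ii) and (iii) also hold with $\mathscr N^{\mathfrak b}$ replaced by $N^{\mathfrak b}$ throughout. -/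

import Mathlib

open MeasureTheory Filter Topology Set
open scoped NNReal ContDiff SchwartzMap

noncomputable section

namespace Wentzell

/-! ### Sesquilinear forms on a complex Hilbert space and their associated operators

Mathlib's `inner ℂ x y` is conjugate-linear in `x` and linear in `y`, so that the inner product
`⟨f, g⟩ = ∫ f * conj g`, linear in the first entry, is `inner ℂ g f`. -/

section Forms

variable {H : Type*} [NormedAddCommGroup H] [InnerProductSpace ℂ H]

variable (H) in
/-- A sesquilinear form `a : D(a) × D(a) → ℂ`, linear in the first and conjugate-linear in the
second entry, on a linear subspace `D(a)` of `H`. -/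
structure SesqForm where
  /-- the form domain `D(a)` -/
  domain : Submodule ℂ H
  /-- the values `a(u, v)` -/
  form : domain →ₗ[ℂ] domain →ₗ⋆[ℂ] ℂ

namespace SesqForm

variable (a : SesqForm H)

/-- The form is symmetric. -/
def IsSymmetric : Prop := ∀ u v : a.domain, a.form u v = star (a.form v u)

/-- `c` is a lower semi-bound: `Re a(u, u) ≥ c ‖u‖²` on `D(a)`. -/
def IsSemiBound (c : ℝ) : Prop := ∀ u : a.domain, c * ‖(u : H)‖ ^ 2 ≤ (a.form u u).re

/-- The maximal semi-bound. -/
def maxSemiBound : ℝ := sSup {c : ℝ | a.IsSemiBound c}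

/-- The form norm, `‖u‖_a² = Re a(u, u) + (1 - c) ‖u‖²` with the maximal semi-bound `c`. -/
def formNorm (u : a.domain) : ℝ :=
  Real.sqrt ((a.form u u).re + (1 - a.maxSemiBound) * ‖(u : H)‖ ^ 2)

/-- The form is continuous with respect to its form norm. -/
def IsContinuous : Prop :=
  ∃ M : ℝ, ∀ u v : a.domain, ‖a.form u v‖ ≤ M * a.formNorm u * a.formNorm v

/-- The form is closed: its domain is complete with respect to the form norm. -/
def IsClosed : Prop :=
  ∀ x : ℕ → a.domain,
    (∀ ε > 0, ∃ N : ℕ, ∀ m ≥ N, ∀ n ≥ N, a.formNorm (x m - x n) < ε) →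
    ∃ y : a.domain, Tendsto (fun n => a.formNorm (x n - y)) atTop (𝓝 0)

/-- A generating form: densely defined, semi-bounded, continuous and closed. -/
structure IsGenerating : Prop where
  dense : Dense (a.domain : Set H)
  semibounded : ∃ c : ℝ, a.IsSemiBound c
  continuous : a.IsContinuous
  closed : a.IsClosed

/-- The graph of the associated operator: the pairs `(u, f)` with `u ∈ D(a)` and
`a(u, v) = ⟨f, v⟩` for all `v ∈ D(a)`. -/
def opGraph : Submodule ℂ (H × H) where
  carrier := {p | ∃ hu : p.1 ∈ a.domain, ∀ v : a.domain, a.form ⟨p.1, hu⟩ v = inner ℂ (v : H) p.2}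
  zero_mem' := ⟨a.domain.zero_mem, fun v => by
    have : (⟨(0 : H × H).1, a.domain.zero_mem⟩ : a.domain) = 0 := rfl
    rw [this]; simp⟩
  add_mem' := by
    rintro p q ⟨hp, hp'⟩ ⟨hq, hq'⟩
    refine ⟨a.domain.add_mem hp hq, fun v => ?_⟩
    have : (⟨(p + q).1, a.domain.add_mem hp hq⟩ : a.domain) = ⟨p.1, hp⟩ + ⟨q.1, hq⟩ := rfl
    rw [this, map_add, LinearMap.add_apply, hp' v, hq' v, Prod.snd_add, inner_add_right]
  smul_mem' := by
    rintro c p ⟨hp, hp'⟩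
    refine ⟨a.domain.smul_mem c hp, fun v => ?_⟩
    have : (⟨(c • p).1, a.domain.smul_mem c hp⟩ : a.domain) = c • ⟨p.1, hp⟩ := rfl
    rw [this, map_smul, LinearMap.smul_apply, hp' v, Prod.smul_snd, inner_smul_right, smul_eq_mul]

/-- The operator associated to the form. -/
def op : H →ₗ.[ℂ] H := a.opGraph.toLinearPMap

/-- The restriction of a form to a smaller domain. -/
def restrict (S : Submodule ℂ H) : SesqForm H where
  domain := a.domain ⊓ S
  form := LinearMap.mk₂'ₛₗ (RingHom.id ℂ) (starRingEnd ℂ)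
    (fun u v => a.form (Submodule.inclusion inf_le_left u) (Submodule.inclusion inf_le_left v))
    (fun _ _ _ => by simp) (fun _ _ _ => by simp) (fun _ _ _ => by simp) (fun _ _ _ => by simp)

end SesqForm

/-! ### Semigroups of operators -/

/-- A strongly continuous one-parameter semigroup (only the values at `t ≥ 0` matter). -/
structure IsC0Semigroup (T : ℝ → H →L[ℂ] H) : Prop where
  zero : T 0 = 1
  add : ∀ s ≥ 0, ∀ t ≥ 0, T (s + t) = T s * T t
  strong_cont : ∀ x : H, Tendsto (fun t => T t x) (𝓝[>] 0) (𝓝 x)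

/-- The open sector of half-angle `θ` around the positive real axis. -/
def sector (θ : ℝ) : Set ℂ := {z | z ≠ 0 ∧ |z.arg| < θ}

/-- An analytic semigroup: a strongly continuous semigroup which extends to a sector around the
positive real axis as an analytic (in operator norm) semigroup which is strongly continuous at the
origin on every smaller sector. -/
structure IsAnalyticSemigroup (T : ℝ → H →L[ℂ] H) : Prop where
  c0 : IsC0Semigroup T
  extends_to_sector : ∃ θ : ℝ, 0 < θ ∧ θ ≤ Real.pi / 2 ∧ ∃ S : ℂ → H →L[ℂ] H,
    (∀ t : ℝ, 0 < t → S (t : ℂ) = T t) ∧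
    DifferentiableOn ℂ S (sector θ) ∧
    (∀ z ∈ sector θ, ∀ w ∈ sector θ, S (z + w) = S z * S w) ∧
    ∀ θ' : ℝ, 0 < θ' → θ' < θ → ∀ x : H, Tendsto (fun z => S z x) (𝓝[sector θ'] 0) (𝓝 x)

/-- `G` is the infinitesimal generator of `T`: `x ∈ D(G)` and `G x = y` if and only if
`(T(t) x - x) / t → y` as `t → 0+`. -/
def IsGeneratorOf (G : H →ₗ.[ℂ] H) (T : ℝ → H →L[ℂ] H) : Prop :=
  ∀ x y : H, (x, y) ∈ G.graph ↔
    Tendsto (fun t : ℝ => ((t⁻¹ : ℝ) : ℂ) • (T t x - x)) (𝓝[>] 0) (𝓝 y)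

end Forms

/-! ### Lipschitz domains, surface measure, Sobolev spaces and the Dirichlet trace -/

/-- Euclidean space `ℝ^d`. -/
abbrev Space (d : ℕ) : Type := EuclideanSpace ℝ (Fin d)

variable {d : ℕ}

/-- The boundary of `Ω` is Lipschitz: near each boundary point there are a direction `e` and a
Lipschitz function `φ` of the components orthogonal to `e` such that `Ω` is locally the region
above the graph of `φ`. -/
def HasLipschitzBoundary (Ω : Set (Space d)) : Prop :=
  ∀ x ∈ frontier Ω, ∃ e : Space d, ‖e‖ = 1 ∧ ∃ (K : ℝ≥0) (φ : Space d → ℝ), LipschitzWith K φ ∧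
    ∃ r > 0, ∀ y ∈ Metric.ball x r,
      (y ∈ Ω ↔ φ (y - (inner ℝ e y : ℝ) • e) < (inner ℝ e y : ℝ))

/-- A bounded domain (non-empty, open, connected) with Lipschitz boundary. -/
structure IsBoundedLipschitzDomain (Ω : Set (Space d)) : Prop where
  isOpen : IsOpen Ω
  isConnected : IsConnected Ω
  isBounded : Bornology.IsBounded Ω
  lipschitz : HasLipschitzBoundary Ω

/-- The surface measure `dS` on `Γ = ∂Ω`: the `(d-1)`-dimensional Hausdorff measure, normalised to
agree with Lebesgue measure on hyperplanes. -/
def surfaceMeasure (Ω : Set (Space d)) : Measure (Space d) :=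
  (μHE[d - 1]).restrict (frontier Ω)

/-- `L²(Ω)`, complex-valued. -/
abbrev L2 (Ω : Set (Space d)) : Type := Lp ℂ 2 ((volume : Measure (Space d)).restrict Ω)

/-- `L²(Γ)`, complex-valued, with the surface measure. -/
abbrev L2Bdry (Ω : Set (Space d)) : Type := Lp ℂ 2 (surfaceMeasure Ω)

/-- Restriction `L²(ℝ^d) → L²(Ω)`. -/
def restrictL2 (Ω : Set (Space d)) : Lp ℂ 2 (volume : Measure (Space d)) →L[ℂ] L2 Ω :=
  LpToLpRestrictCLM (Space d) ℂ ℂ volume 2 Ω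

/-- `U ∈ H^s(ℝ^d)` with Bessel potential `G ∈ L²(ℝ^d)`, so that `‖U‖_{H^s(ℝ^d)} = ‖G‖_{L²}`. -/
def IsSobolevLift (s : ℝ) (U G : Lp ℂ 2 (volume : Measure (Space d))) : Prop :=
  TemperedDistribution.besselPotential (Space d) ℂ s (U : 𝓢'(Space d, ℂ)) = (G : 𝓢'(Space d, ℂ))

/-- The norm of `H^s(Ω)`, `s ≥ 0`, defined by restriction: the infimum of `‖U‖_{H^s(ℝ^d)}` over
all extensions `U ∈ H^s(ℝ^d)` of `u`. It is `⊤` exactly when `u ∉ H^s(Ω)`. -/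
def sobolevENorm (Ω : Set (Space d)) (s : ℝ) (u : L2 Ω) : ENNReal :=
  ⨅ p : {p : Lp ℂ 2 (volume : Measure (Space d)) × Lp ℂ 2 (volume : Measure (Space d)) //
    restrictL2 Ω p.1 = u ∧ IsSobolevLift s p.1 p.2}, ‖p.1.2‖ₑ

/-- `u ∈ H^s(Ω)`. -/
def MemSobolev (Ω : Set (Space d)) (s : ℝ) (u : L2 Ω) : Prop := sobolevENorm Ω s u < ⊤

theorem IsSobolevLift.add {s : ℝ} {U G U' G' : Lp ℂ 2 (volume : Measure (Space d))}
    (h : IsSobolevLift s U G) (h' : IsSobolevLift s U' G') : IsSobolevLift s (U + U') (G + G') := by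
  have e : ∀ A B : Lp ℂ 2 (volume : Measure (Space d)),
      ((A + B : Lp ℂ 2 (volume : Measure (Space d))) : 𝓢'(Space d, ℂ)) = A + B :=
    fun A B => map_add (Lp.toTemperedDistributionCLM ℂ volume 2) A B
  unfold IsSobolevLift at *
  rw [e, e, map_add, h, h']

theorem IsSobolevLift.smul {s : ℝ} {U G : Lp ℂ 2 (volume : Measure (Space d))} (c : ℂ)
    (h : IsSobolevLift s U G) : IsSobolevLift s (c • U) (c • G) := by
  have e : ∀ A : Lp ℂ 2 (volume : Measure (Space d)),
      ((c • A : Lp ℂ 2 (volume : Measure (Space d))) : 𝓢'(Space d, ℂ)) = c • A :=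
    fun A => map_smul (Lp.toTemperedDistributionCLM ℂ volume 2) c A
  unfold IsSobolevLift at *
  rw [e, e, map_smul, h]

theorem sobolevENorm_le {Ω : Set (Space d)} {s : ℝ} {u : L2 Ω}
    {U G : Lp ℂ 2 (volume : Measure (Space d))} (h : restrictL2 Ω U = u)
    (h' : IsSobolevLift s U G) : sobolevENorm Ω s u ≤ ‖G‖ₑ :=
  iInf_le (fun p : {p : Lp ℂ 2 (volume : Measure (Space d)) × Lp ℂ 2 (volume : Measure (Space d)) //
    restrictL2 Ω p.1 = u ∧ IsSobolevLift s p.1 p.2} => ‖p.1.2‖ₑ) ⟨(U, G), h, h'⟩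

theorem sobolevENorm_add_le (Ω : Set (Space d)) (s : ℝ) (u v : L2 Ω) :
    sobolevENorm Ω s (u + v) ≤ sobolevENorm Ω s u + sobolevENorm Ω s v := by
  conv_rhs => unfold sobolevENorm
  refine ENNReal.le_iInf_add_iInf ?_
  rintro ⟨⟨U, G⟩, h1, h2⟩ ⟨⟨U', G'⟩, h3, h4⟩
  exact (sobolevENorm_le (by rw [map_add, h1, h3]) (h2.add h4)).trans (enorm_add_le G G')

theorem sobolevENorm_zero (Ω : Set (Space d)) (s : ℝ) : sobolevENorm Ω s 0 = 0 := by
  have e : ((0 : Lp ℂ 2 (volume : Measure (Space d))) : 𝓢'(Space d, ℂ)) = 0 :=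
    map_zero (Lp.toTemperedDistributionCLM ℂ volume 2)
  have h : IsSobolevLift s (0 : Lp ℂ 2 (volume : Measure (Space d))) 0 := by
    rw [IsSobolevLift, e, map_zero]
  exact le_antisymm ((sobolevENorm_le (map_zero _) h).trans (le_of_eq enorm_zero)) bot_le

theorem sobolevENorm_smul_le (Ω : Set (Space d)) (s : ℝ) (c : ℂ) (u : L2 Ω) :
    sobolevENorm Ω s (c • u) ≤ ‖c‖ₑ * sobolevENorm Ω s u := by
  by_cases hc : c = 0
  · simp [hc, sobolevENorm_zero]
  conv_rhs => unfold sobolevENorm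
  rw [ENNReal.mul_iInf_of_ne (by simpa using hc) enorm_ne_top]
  refine le_iInf ?_
  rintro ⟨⟨U, G⟩, h1, h2⟩
  exact (sobolevENorm_le (by rw [map_smul, h1]) (h2.smul c)).trans (le_of_eq (enorm_smul c G))

/-- The class in `L²(Ω)` of the restriction of a smooth function to `Ω`. For bounded `Ω` the
restrictions of Schwartz functions to the closure of `Ω` are exactly the elements of
`C^∞(closure Ω)`. -/
def smoothL2 (Ω : Set (Space d)) (φ : 𝓢(Space d, ℂ)) : L2 Ω := restrictL2 Ω (φ.toLp 2 volume)

/-- The graph of the Dirichlet trace on `H^s(Ω)`: the closure in `H^s(Ω) × L²(Γ)` of the pairs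
`(φ|_Ω, φ|_Γ)` with `φ` smooth up to the boundary. -/
def traceGraph (Ω : Set (Space d)) (s : ℝ) : Submodule ℂ (L2 Ω × L2Bdry Ω) where
  carrier := {p | ∃ φ : ℕ → 𝓢(Space d, ℂ),
    Tendsto (fun n => sobolevENorm Ω s (smoothL2 Ω (φ n) - p.1)) atTop (𝓝 0) ∧
    Tendsto (fun n => eLpNorm (fun x => φ n x - p.2 x) 2 (surfaceMeasure Ω)) atTop (𝓝 0)}
  zero_mem' := by
    refine ⟨fun _ => 0, ?_, ?_⟩
    · have e : smoothL2 Ω 0 - (0 : L2 Ω × L2Bdry Ω).1 = 0 := by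
        rw [smoothL2, show (0 : 𝓢(Space d, ℂ)).toLp 2 volume = 0 from
          map_zero (SchwartzMap.toLpCLM ℂ ℂ 2 volume), map_zero]
        exact sub_zero _
      simp only [e, sobolevENorm_zero]
      exact tendsto_const_nhds
    · have : eLpNorm (fun x => (0 : 𝓢(Space d, ℂ)) x - (0 : L2 Ω × L2Bdry Ω).2 x) 2
          (surfaceMeasure Ω) = 0 := by
        rw [eLpNorm_congr_ae (g := fun _ => 0)]
        · simp
        · filter_upwards [Lp.coeFn_zero ℂ 2 (surfaceMeasure Ω)] with x hx
          rw [Prod.snd_zero, hx]; simp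
      simp only [this]
      exact tendsto_const_nhds
  add_mem' := by
    rintro p q ⟨φ, h1, h2⟩ ⟨ψ, h3, h4⟩
    refine ⟨fun n => φ n + ψ n, ?_, ?_⟩
    · refine tendsto_of_tendsto_of_tendsto_of_le_of_le tendsto_const_nhds
        (by simpa using h1.add h3) (fun _ => bot_le) fun n => ?_
      refine le_trans (le_of_eq ?_) (sobolevENorm_add_le _ _ _ _)
      congr 1
      have : smoothL2 Ω (φ n + ψ n) = smoothL2 Ω (φ n) + smoothL2 Ω (ψ n) := by
        rw [smoothL2, show (φ n + ψ n).toLp 2 volume = (φ n).toLp 2 volume + (ψ n).toLp 2 volume from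
          map_add (SchwartzMap.toLpCLM ℂ ℂ 2 volume) _ _, map_add]
        rfl
      rw [this, Prod.fst_add]; abel
    · refine tendsto_of_tendsto_of_tendsto_of_le_of_le tendsto_const_nhds
        (by simpa using h2.add h4) (fun _ => bot_le) fun n => ?_
      refine le_trans (le_of_eq ?_) (eLpNorm_add_le
        ((φ n).continuous.aestronglyMeasurable.sub (Lp.aestronglyMeasurable p.2))
        ((ψ n).continuous.aestronglyMeasurable.sub (Lp.aestronglyMeasurable q.2)) (by norm_num))
      refine eLpNorm_congr_ae ?_
      filter_upwards [Lp.coeFn_add p.2 q.2] with x hx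
      simp only [Prod.snd_add, hx, Pi.add_apply, add_apply]
      ring
  smul_mem' := by
    rintro c p ⟨φ, h1, h2⟩
    refine ⟨fun n => c • φ n, ?_, ?_⟩
    · refine tendsto_of_tendsto_of_tendsto_of_le_of_le tendsto_const_nhds
        (by simpa using ENNReal.Tendsto.const_mul h1 (Or.inr (enorm_ne_top (x := c))))
        (fun _ => bot_le) fun n => ?_
      refine le_trans (le_of_eq ?_) (sobolevENorm_smul_le _ _ _ _)
      congr 1
      have : smoothL2 Ω (c • φ n) = c • smoothL2 Ω (φ n) := by
        rw [smoothL2, show (c • φ n).toLp 2 volume = c • (φ n).toLp 2 volume from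
          map_smul (SchwartzMap.toLpCLM ℂ ℂ 2 volume) _ _, map_smul]
        rfl
      rw [this, Prod.smul_fst, smul_sub]
    · refine tendsto_of_tendsto_of_tendsto_of_le_of_le tendsto_const_nhds
        (by simpa using ENNReal.Tendsto.const_mul h2 (Or.inr (enorm_ne_top (x := c))))
        (fun _ => bot_le) fun n => ?_
      rw [← eLpNorm_const_smul]
      refine le_of_eq (eLpNorm_congr_ae ?_)
      filter_upwards [Lp.coeFn_smul c p.2] with x hx
      simp [Prod.smul_snd, hx, mul_sub]

/-- The Dirichlet trace `tr : H^s(Ω) → L²(Γ)` for `s > 1/2`, the continuous extension of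
`φ ↦ φ|_Γ`, as a partially defined operator on `L²(Ω)`. -/
def trace (Ω : Set (Space d)) (s : ℝ) : L2 Ω →ₗ.[ℂ] L2Bdry Ω := (traceGraph Ω s).toLinearPMap

/-! ### The subsidiary form, its operators and the Neumann traces -/

/-- An admissible subsidiary form `b` with exponent `ρ`: a generating symmetric form on `L²(Ω)` with
`C_c^∞(Ω) ⊆ D(b) ⊆ H^{1/2+ρ}(Ω)`, the latter embedding being continuous with respect to the form
norm, and dense. -/
structure IsAdmissible (Ω : Set (Space d)) (ρ : ℝ) (b : SesqForm (L2 Ω)) : Prop where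
  generating : b.IsGenerating
  symmetric : b.IsSymmetric
  testFunctions : ∀ φ : Space d → ℂ, ContDiff ℝ ∞ φ → HasCompactSupport φ → tsupport φ ⊆ Ω →
    ∀ f : L2 Ω, f =ᵐ[volume.restrict Ω] φ → f ∈ b.domain
  embedding : ∃ C : ℝ≥0, ∀ u : b.domain,
    sobolevENorm Ω (1 / 2 + ρ) (u : L2 Ω) ≤ C * ENNReal.ofReal (b.formNorm u)
  dense : ∀ w : L2 Ω, MemSobolev Ω (1 / 2 + ρ) w → ∀ ε > 0,
    ∃ u : b.domain, sobolevENorm Ω (1 / 2 + ρ) ((u : L2 Ω) - w) < ε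

section Operators

variable (Ω : Set (Space d)) (ρ : ℝ) (b : SesqForm (L2 Ω))

/-- The Dirichlet trace on `H^{1/2+ρ}(Ω)`. -/
abbrev tr : L2 Ω →ₗ.[ℂ] L2Bdry Ω := trace Ω (1 / 2 + ρ)

/-- The Neumann realisation `B_N`, the operator associated to `b`. -/
def opN : L2 Ω →ₗ.[ℂ] L2 Ω := b.op

/-- The Dirichlet realisation `B_D`, the operator associated to the restriction of `b` to
`{u ∈ D(b) | tr u = 0}`. -/
def opD : L2 Ω →ₗ.[ℂ] L2 Ω :=
  (b.restrict ((tr Ω ρ).graph.comap (LinearMap.inl ℂ (L2 Ω) (L2Bdry Ω)))).op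

/-- `B_0`, the restriction of `B_N` to `D(B_D) ∩ D(B_N)`. -/
def op0 : L2 Ω →ₗ.[ℂ] L2 Ω := (opN Ω b).domRestrict (opD Ω ρ b).domain

/-- The Hilbert space adjoint `B_0^*`. -/
def op0Adj : L2 Ω →ₗ.[ℂ] L2 Ω := LinearPMap.adjoint (op0 Ω ρ b)

/-- The graph of `N^b`: the pairs `(u, g)` with `u ∈ D(b) ∩ D(B_0^*)` and
`⟨B_0^* u, v⟩ - b(u, v) = ⟨g, tr v⟩` for all `v ∈ D(b)`. -/
def weakNeumannGraph : Submodule ℂ (L2 Ω × L2Bdry Ω) where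
  carrier := {p | ∃ (hb : p.1 ∈ b.domain) (h0 : p.1 ∈ (op0Adj Ω ρ b).domain),
    ∀ (v : b.domain) (hv : (v : L2 Ω) ∈ (tr Ω ρ).domain),
      inner ℂ (v : L2 Ω) (op0Adj Ω ρ b ⟨p.1, h0⟩) - b.form ⟨p.1, hb⟩ v
        = inner ℂ (tr Ω ρ ⟨v, hv⟩) p.2}
  zero_mem' := by
    refine ⟨b.domain.zero_mem, Submodule.zero_mem _, fun v hv => ?_⟩
    have e1 : (⟨(0 : L2 Ω × L2Bdry Ω).1, b.domain.zero_mem⟩ : b.domain) = 0 := rfl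
    have e2 : (⟨(0 : L2 Ω × L2Bdry Ω).1, Submodule.zero_mem _⟩ : (op0Adj Ω ρ b).domain) = 0 := rfl
    rw [e1, e2, LinearPMap.map_zero]; simp
  add_mem' := by
    rintro p q ⟨hp, hp0, hp'⟩ ⟨hq, hq0, hq'⟩
    refine ⟨b.domain.add_mem hp hq, Submodule.add_mem _ hp0 hq0, fun v hv => ?_⟩
    have e1 : (⟨(p + q).1, b.domain.add_mem hp hq⟩ : b.domain) = ⟨p.1, hp⟩ + ⟨q.1, hq⟩ := rfl
    have e2 : (⟨(p + q).1, Submodule.add_mem _ hp0 hq0⟩ : (op0Adj Ω ρ b).domain)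
      = ⟨p.1, hp0⟩ + ⟨q.1, hq0⟩ := rfl
    rw [e1, e2, LinearPMap.map_add, map_add, LinearMap.add_apply, Prod.snd_add, inner_add_right,
      inner_add_right, ← hp' v hv, ← hq' v hv]
    ring
  smul_mem' := by
    rintro c p ⟨hp, hp0, hp'⟩
    refine ⟨b.domain.smul_mem c hp, Submodule.smul_mem _ c hp0, fun v hv => ?_⟩
    have e1 : (⟨(c • p).1, b.domain.smul_mem c hp⟩ : b.domain) = c • ⟨p.1, hp⟩ := rfl
    have e2 : (⟨(c • p).1, Submodule.smul_mem _ c hp0⟩ : (op0Adj Ω ρ b).domain)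
      = c • ⟨p.1, hp0⟩ := rfl
    rw [e1, e2, LinearPMap.map_smul, map_smul, LinearMap.smul_apply, Prod.smul_snd,
      inner_smul_right, inner_smul_right, ← hp' v hv, smul_eq_mul]
    ring

/-- The weak Neumann trace `N^b`. -/
def weakNeumann : L2 Ω →ₗ.[ℂ] L2Bdry Ω := (weakNeumannGraph Ω ρ b).toLinearPMap

/-- The graph of `𝒩^b`: the pairs `(u, g)` with `u ∈ D(B_0^*)` and
`⟨B_0^* u, v⟩ - ⟨u, B_N v⟩ = ⟨g, tr v⟩` for all `v ∈ D(B_N)`. -/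
def veryWeakNeumannGraph : Submodule ℂ (L2 Ω × L2Bdry Ω) where
  carrier := {p | ∃ h0 : p.1 ∈ (op0Adj Ω ρ b).domain,
    ∀ (v : (opN Ω b).domain) (hv : (v : L2 Ω) ∈ (tr Ω ρ).domain),
      inner ℂ (v : L2 Ω) (op0Adj Ω ρ b ⟨p.1, h0⟩) - inner ℂ (opN Ω b v) p.1
        = inner ℂ (tr Ω ρ ⟨v, hv⟩) p.2}
  zero_mem' := by
    refine ⟨Submodule.zero_mem _, fun v hv => ?_⟩
    have e2 : (⟨(0 : L2 Ω × L2Bdry Ω).1, Submodule.zero_mem _⟩ : (op0Adj Ω ρ b).domain) = 0 := rfl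
    rw [e2, LinearPMap.map_zero]; simp
  add_mem' := by
    rintro p q ⟨hp0, hp'⟩ ⟨hq0, hq'⟩
    refine ⟨Submodule.add_mem _ hp0 hq0, fun v hv => ?_⟩
    have e2 : (⟨(p + q).1, Submodule.add_mem _ hp0 hq0⟩ : (op0Adj Ω ρ b).domain)
      = ⟨p.1, hp0⟩ + ⟨q.1, hq0⟩ := rfl
    rw [e2, LinearPMap.map_add, Prod.snd_add, Prod.fst_add, inner_add_right, inner_add_right,
      inner_add_right, ← hp' v hv, ← hq' v hv]
    ring
  smul_mem' := by
    rintro c p ⟨hp0, hp'⟩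
    refine ⟨Submodule.smul_mem _ c hp0, fun v hv => ?_⟩
    have e2 : (⟨(c • p).1, Submodule.smul_mem _ c hp0⟩ : (op0Adj Ω ρ b).domain)
      = c • ⟨p.1, hp0⟩ := rfl
    rw [e2, LinearPMap.map_smul, Prod.smul_snd, Prod.smul_fst, inner_smul_right, inner_smul_right,
      inner_smul_right, ← hp' v hv]
    ring

/-- The Neumann trace `𝒩^b`. -/
def veryWeakNeumann : L2 Ω →ₗ.[ℂ] L2Bdry Ω := (veryWeakNeumannGraph Ω ρ b).toLinearPMap

end Operators

/-! ### The system on the product space -/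

/-- Multiplication of `L²` by a real-valued `L^∞` function. -/
def mulLinfty {X : Type*} [MeasurableSpace X] {μ : Measure X} (m : Lp ℝ ⊤ μ) :
    Lp ℂ 2 μ →ₗ[ℂ] Lp ℂ 2 μ where
  toFun f := m • f
  map_add' f g := Lp.add_smul m f g
  map_smul' c f := by
    refine Lp.ext ?_
    filter_upwards [Lp.coeFn_lpSMul (r := 2) m (c • f), Lp.coeFn_smul c f,
      Lp.coeFn_smul c (m • f : Lp ℂ 2 μ), Lp.coeFn_lpSMul (r := 2) m f] with x h1 h2 h3 h4
    simp only [RingHom.id_apply, h1, h3, Pi.smul_apply', Pi.smul_apply, h2, h4]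
    exact smul_comm _ _ _

/-- An `L^∞` function regarded as an `L^∞` function for an absolutely continuous measure. -/
def linftyOfAC {X : Type*} [MeasurableSpace X] {μ ν : Measure X} (h : ν ≪ μ) (m : Lp ℝ ⊤ μ) :
    Lp ℝ ⊤ ν :=
  MemLp.toLp m ⟨(Lp.aestronglyMeasurable m).mono_ac h, by
    have := (Lp.memLp m).2
    rw [eLpNorm_exponent_top] at this ⊢
    exact (eLpNormEssSup_mono_measure _ h).trans_lt this⟩

/-- The measure `β⁻¹ dS` on `Γ`. -/
def weightedMeasure (Ω : Set (Space d)) (β : Lp ℝ ⊤ (surfaceMeasure Ω)) : Measure (Space d) :=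
  (surfaceMeasure Ω).withDensity (fun x => ENNReal.ofReal (β x)⁻¹)

theorem weightedMeasure_ac (Ω : Set (Space d)) (β : Lp ℝ ⊤ (surfaceMeasure Ω)) :
    weightedMeasure Ω β ≪ surfaceMeasure Ω := withDensity_absolutelyContinuous _ _

/-- The Hilbert space `ℋ = L²(Ω) × L²(Γ, β⁻¹ dS)`. -/
abbrev ProdSpace (Ω : Set (Space d)) (β : Lp ℝ ⊤ (surfaceMeasure Ω)) : Type :=
  WithLp 2 (L2 Ω × Lp ℂ 2 (weightedMeasure Ω β))

section System

variable (Ω : Set (Space d)) (ρ : ℝ) (b : SesqForm (L2 Ω))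
  (α : Lp ℝ ⊤ ((volume : Measure (Space d)).restrict Ω)) (β γ : Lp ℝ ⊤ (surfaceMeasure Ω))

/-- The form domain `D(a) = {(u₁, u₂) ∈ ℋ | u₁ ∈ D(B_N), u₂ = tr u₁}`. -/
def primaryDomain : Submodule ℂ (ProdSpace Ω β) where
  carrier := {u | u.fst ∈ (opN Ω b).domain ∧ ∃ h : u.fst ∈ (tr Ω ρ).domain,
    u.snd =ᵐ[weightedMeasure Ω β] tr Ω ρ ⟨u.fst, h⟩}
  zero_mem' := by
    refine ⟨Submodule.zero_mem _, Submodule.zero_mem _, ?_⟩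
    have e : (⟨(0 : ProdSpace Ω β).fst, Submodule.zero_mem _⟩ : (tr Ω ρ).domain) = 0 := rfl
    rw [e, LinearPMap.map_zero]
    filter_upwards [(weightedMeasure_ac Ω β).ae_le (Lp.coeFn_zero ℂ 2 (surfaceMeasure Ω)),
      Lp.coeFn_zero ℂ 2 (weightedMeasure Ω β)] with x h1 h2
    rw [h1, ← h2]; rfl
  add_mem' := by
    rintro u v ⟨hu, hu0, hu'⟩ ⟨hv, hv0, hv'⟩
    refine ⟨Submodule.add_mem _ hu hv, Submodule.add_mem _ hu0 hv0, ?_⟩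
    have e : (⟨(u + v).fst, Submodule.add_mem _ hu0 hv0⟩ : (tr Ω ρ).domain)
      = ⟨u.fst, hu0⟩ + ⟨v.fst, hv0⟩ := rfl
    rw [e, LinearPMap.map_add]
    filter_upwards [(weightedMeasure_ac Ω β).ae_le
      (Lp.coeFn_add (tr Ω ρ ⟨u.fst, hu0⟩) (tr Ω ρ ⟨v.fst, hv0⟩)),
      Lp.coeFn_add u.snd v.snd, hu', hv'] with x h1 h2 h3 h4
    rw [h1, Pi.add_apply, ← h3, ← h4, ← Pi.add_apply, ← h2]; rfl
  smul_mem' := by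
    rintro c u ⟨hu, hu0, hu'⟩
    refine ⟨Submodule.smul_mem _ c hu, Submodule.smul_mem _ c hu0, ?_⟩
    have e : (⟨(c • u).fst, Submodule.smul_mem _ c hu0⟩ : (tr Ω ρ).domain)
      = c • ⟨u.fst, hu0⟩ := rfl
    rw [e, LinearPMap.map_smul]
    filter_upwards [(weightedMeasure_ac Ω β).ae_le (Lp.coeFn_smul c (tr Ω ρ ⟨u.fst, hu0⟩)),
      Lp.coeFn_smul c u.snd, hu'] with x h1 h2 h3
    rw [h1, Pi.smul_apply, ← h3, ← Pi.smul_apply, ← h2]; rfl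

/-- `B_N u₁` for `u ∈ D(a)`, as a linear map. -/
def primaryOpN : primaryDomain Ω ρ b β →ₗ[ℂ] L2 Ω where
  toFun u := opN Ω b ⟨(u : ProdSpace Ω β).fst, u.2.1⟩
  map_add' u v := (opN Ω b).map_add ⟨(u : ProdSpace Ω β).fst, u.2.1⟩ ⟨(v : ProdSpace Ω β).fst, v.2.1⟩
  map_smul' c u := (opN Ω b).map_smul c ⟨(u : ProdSpace Ω β).fst, u.2.1⟩

/-- Multiplication by `γ` on `L²(Γ, β⁻¹ dS)`. -/
def mulGamma : Lp ℂ 2 (weightedMeasure Ω β) →ₗ[ℂ] Lp ℂ 2 (weightedMeasure Ω β) :=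
  mulLinfty (linftyOfAC (weightedMeasure_ac Ω β) γ)

/-- The primary form `a(u, v) = ⟨α B_N u₁, B_N v₁⟩_Ω + ⟨γ u₂, v₂⟩_{Γ,β}` on `D(a)`. -/
def primaryForm : SesqForm (ProdSpace Ω β) where
  domain := primaryDomain Ω ρ b β
  form := LinearMap.mk₂'ₛₗ (RingHom.id ℂ) (starRingEnd ℂ)
    (fun u v => inner ℂ (primaryOpN Ω ρ b β v) (mulLinfty α (primaryOpN Ω ρ b β u)) +
      inner ℂ (v : ProdSpace Ω β).snd (mulGamma Ω β γ (u : ProdSpace Ω β).snd))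
    (fun u u' v => by
      simp only [map_add, Submodule.coe_add, WithLp.add_snd, inner_add_right]; ring)
    (fun c u v => by
      simp only [map_smul, Submodule.coe_smul, WithLp.smul_snd, inner_smul_right, RingHom.id_apply,
        smul_eq_mul]; ring)
    (fun u v v' => by
      simp only [map_add, Submodule.coe_add, WithLp.add_snd, inner_add_left]; ring)
    (fun c u v => by
      simp only [map_smul, Submodule.coe_smul, WithLp.smul_snd, inner_smul_left, smul_eq_mul]; ring)

/-- The operator `𝒜` on `ℋ` associated to the primary form. -/
def primaryOp : ProdSpace Ω β →ₗ.[ℂ] ProdSpace Ω β := (primaryForm Ω ρ b α β γ).op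

variable (N : L2 Ω →ₗ.[ℂ] L2Bdry Ω)

/-- The set `{u ∈ ℋ | u₁ ∈ D(B_N), α B_N u₁ ∈ D(N), u₂ = tr u₁}`, for a Neumann trace `N`. -/
def wentzellDomain : Set (ProdSpace Ω β) :=
  {u | (∃ hN : u.fst ∈ (opN Ω b).domain, mulLinfty α (opN Ω b ⟨u.fst, hN⟩) ∈ N.domain) ∧
    ∃ h : u.fst ∈ (tr Ω ρ).domain, u.snd =ᵐ[weightedMeasure Ω β] tr Ω ρ ⟨u.fst, h⟩}

/-- `f` is the value at `u` of the operator matrix `(B_0^*(α B_N), 0; -β N(α B_N), γ)`: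
`f₁ = B_0^*(α B_N u₁)` and `f₂ = -β N(α B_N u₁) + γ u₂`, all terms being defined. -/
def IsWentzellValue (u f : ProdSpace Ω β) : Prop :=
  ∃ (hN : u.fst ∈ (opN Ω b).domain)
    (h0 : mulLinfty α (opN Ω b ⟨u.fst, hN⟩) ∈ (op0Adj Ω ρ b).domain)
    (hT : mulLinfty α (opN Ω b ⟨u.fst, hN⟩) ∈ N.domain),
    f.fst = op0Adj Ω ρ b ⟨mulLinfty α (opN Ω b ⟨u.fst, hN⟩), h0⟩ ∧
    ∀ᵐ x ∂(weightedMeasure Ω β),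
      f.snd x = -(β x : ℂ) * N ⟨mulLinfty α (opN Ω b ⟨u.fst, hN⟩), hT⟩ x + (γ x : ℂ) * u.snd x

/-- `u = (u₁, u₂)` is a (classical) solution, with initial value `u₀`, of the decoupled system
`∂ₜ u₁ + B_0^*(α B_N) u₁ = 0` in `Ω`, `∂ₜ u₂ - β N(α B_N) u₁ + γ u₂ = 0` and `N u₁ = 0` on `Γ`, with
the coupling `u₂ = tr u₁`, for `t > 0`. Only the values `u(t)`, `t ≥ 0`, matter. -/
structure IsWentzellSolution (u₀ : ProdSpace Ω β) (u : ℝ → ProdSpace Ω β) : Prop where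
  continuous : ContinuousOn u (Ici 0)
  initial : u 0 = u₀
  contDiff : ContDiffOn ℝ 1 u (Ioi 0)
  mem_domain : ∀ t > 0, u t ∈ wentzellDomain Ω ρ b α β N
  neumann : ∀ t > 0, ∃ h : (u t).fst ∈ N.domain, N ⟨(u t).fst, h⟩ = 0
  evolution : ∀ t > 0, IsWentzellValue Ω ρ b α β γ N (u t) (-deriv u t)

end System

end Wentzell

end

/-!
The operator `𝒜` is the operator of a closed symmetric form, and everything follows once this form
is understood: its resolvent comes from Riesz representation, the semigroup from the resolvent, and
the operator matrix from an integration by parts on `D(B_N)`.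

**Forms and semigroups.** For a generating symmetric form with maximal semi-bound `c` put
`μ = 1 - c`. Riesz representation in the form space yields a self-adjoint injective `R` with
`0 ≤ R ≤ 1` and `R = (A + μ)⁻¹` (`SesqForm.exists_isShiftedInverse`); self-adjointness of `A` follows
by passing to `R`. Since `R` is bounded, the continuous functional calculus replaces the spectral
theorem for `A`: the semigroup is `e^{μz} exp (-z R⁻¹)`, where `x ↦ exp (-z / x)` extends
continuously by `0` to the spectrum of `R`, and its derivative maps into the domain because
`x⁻¹ exp (-z / x)` is continuous too (`IsShiftedInverse.exists_analyticSemigroup`). Solutions are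
unique by the energy estimate (`IsShiftedInverse.eq_of_deriv_mem_graph`).

**The Dirichlet trace.** Near a boundary point `Ω` lies above a Lipschitz graph, so moving a piece
of `Γ` in the direction `e` sweeps out a part of `Ω`, with the product of surface measure and `dt`
bounded by Lebesgue measure. A function `f` is on `Γ` the sum of its average over segments of length
`h` in the direction `e` and the telescoping series of the differences of such averages over lengths
`h / 2 ^ k`. The first is bounded by `‖f‖_{L²(Ω)}`, and the second by translation differences, which
in `H^s(ℝ^d)` are Hölder continuous of order `σ > 1/2`, so that the series converges like
`h ^ (σ - 1/2)` (`IsTransversal.lintegral_sq_le`). As the `H^s(ℝ^d)`-norm has a factor that tends to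
`0` with `h`, the trace of a function depends only on its restriction to `Ω`. This gives the trace
inequality for the quotient norm of `H^s(Ω)` (`IsBoundedLipschitzDomain.exists_norm_trace_le`).

**The Neumann traces.** `D(B_N)` is a core of `b`, `D(b)` is dense in `H^{1/2+ρ}(Ω)`, and traces of
smooth functions are dense in `L²(Γ)`; so `tr D(B_N)` is dense in `L²(Γ)`, and both Neumann traces are
single-valued (`IsAdmissible.isTraceSetting`). If `N^b` is onto, it equals `𝒩^b`, since
`ker 𝒩^b ⊆ D(B_N^*) = D(B_N)` (`IsTraceSetting.weakNeumann_eq`).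

**The primary form.** It is closed because `tr` is bounded with respect to the graph norm of the
closed operator `B_N`, and densely defined because `tr` vanishes on the dense subspace `D(B_0)` while
`tr D(B_N)` is dense (`IsTraceSetting.primaryForm_isGenerating`). If `𝒜 u = f`, then testing with
`v₁ ∈ D(B_0)`, `v₂ = 0` gives `B_0^*(α B_N u₁) = f₁`, and the remaining test functions give the
boundary equation by the definition of `𝒩^b` (`IsTraceSetting.mem_primaryOp_graph`). The condition
`𝒩^b u₁ = 0` in the Cauchy problem is automatic, as `𝒩^b` vanishes on `D(B_N)`.
-/

/-! ### Generating symmetric forms and their resolvents -/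

namespace Wentzell

section FormTheory

variable {H : Type*} [NormedAddCommGroup H] [InnerProductSpace ℂ H]

namespace SesqForm

variable {a : SesqForm H}

theorem isSemiBound_maxSemiBound (h : ∃ c, a.IsSemiBound c) : a.IsSemiBound a.maxSemiBound := by
  obtain ⟨c₀, h₀⟩ := h
  intro u
  by_cases hu : (u : H) = 0
  · have : u = 0 := Subtype.ext hu
    subst this; simp
  · have hp : 0 < ‖(u : H)‖ ^ 2 := by positivity
    rw [← le_div_iff₀ hp]
    exact csSup_le ⟨c₀, h₀⟩ fun c hc => (le_div_iff₀ hp).2 (hc u)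

theorem norm_sq_le_formNorm_sq (h : ∃ c, a.IsSemiBound c) (u : a.domain) :
    ‖(u : H)‖ ^ 2 ≤ (a.form u u).re + (1 - a.maxSemiBound) * ‖(u : H)‖ ^ 2 := by
  have := isSemiBound_maxSemiBound h u
  linarith

theorem formNorm_sq (h : ∃ c, a.IsSemiBound c) (u : a.domain) :
    a.formNorm u ^ 2 = (a.form u u).re + (1 - a.maxSemiBound) * ‖(u : H)‖ ^ 2 :=
  Real.sq_sqrt ((sq_nonneg _).trans (norm_sq_le_formNorm_sq h u))

theorem formNorm_nonneg (u : a.domain) : 0 ≤ a.formNorm u := Real.sqrt_nonneg _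

theorem norm_le_formNorm (h : ∃ c, a.IsSemiBound c) (u : a.domain) :
    ‖(u : H)‖ ≤ a.formNorm u :=
  Real.le_sqrt_of_sq_le (norm_sq_le_formNorm_sq h u)

theorem op_graph (h : Dense (a.domain : Set H)) : a.op.graph = a.opGraph := by
  refine Submodule.toLinearPMap_graph_eq _ ?_
  rintro ⟨u, f⟩ ⟨hu, hf⟩ (rfl : u = 0)
  refine h.eq_zero_of_inner_left (𝕜 := ℂ) fun v hv => ?_
  have e : (⟨0, hu⟩ : a.domain) = 0 := rfl
  have := hf ⟨v, hv⟩
  rw [e] at this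
  rw [← inner_conj_symm, ← this]
  simp

variable (a) in
/-- The form domain, as a type of its own, so that the form norm does not clash with the norm it
inherits from the ambient space. -/
def FormSpace : Type _ := a.domain

instance : AddCommGroup a.FormSpace := inferInstanceAs (AddCommGroup a.domain)

instance : Module ℂ a.FormSpace := inferInstanceAs (Module ℂ a.domain)

variable (a) in
/-- The identity from the form space to the form domain. -/
def FormSpace.toDomain : a.FormSpace ≃ₗ[ℂ] a.domain := LinearEquiv.refl ℂ a.domain

open FormSpace

/-- The inner product `a(u, v) + (1 - c) ⟨u, v⟩` on the domain of a semi-bounded symmetric form,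
where `c` is the maximal semi-bound. Its norm is the form norm. -/
noncomputable abbrev formCore (hg : ∃ c, a.IsSemiBound c) (hs : a.IsSymmetric) :
    InnerProductSpace.Core ℂ a.FormSpace where
  inner u v := a.form (toDomain a v) (toDomain a u) + ((1 - a.maxSemiBound : ℝ) : ℂ) *
    inner ℂ (toDomain a u : H) (toDomain a v : H)
  conj_inner_symm u v := by
    simp only [map_add, map_mul, Complex.conj_ofReal, inner_conj_symm]
    rw [hs (toDomain a v)]; rfl
  re_inner_nonneg u := by
    have := norm_sq_le_formNorm_sq hg (toDomain a u)
    simp only [inner_self_eq_norm_sq_to_K]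
    refine (sq_nonneg ‖(toDomain a u : H)‖).trans (this.trans (le_of_eq ?_))
    simp [← Complex.ofReal_pow]
  add_left u v w := by
    rw [map_add, map_add, Submodule.coe_add, inner_add_left]; ring
  smul_left u v c := by
    rw [map_smul, LinearMap.map_smulₛₗ, Submodule.coe_smul, inner_smul_left, smul_eq_mul]; ring
  definite u hu := by
    have := norm_sq_le_formNorm_sq hg (toDomain a u)
    have h0 : (a.form (toDomain a u) (toDomain a u)).re
        + (1 - a.maxSemiBound) * ‖(toDomain a u : H)‖ ^ 2 = 0 := by
      have := congrArg Complex.re hu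
      simp only [inner_self_eq_norm_sq_to_K] at this
      simpa [← Complex.ofReal_pow] using this
    rw [h0] at this
    have : (toDomain a u : H) = 0 := by
      rw [← norm_eq_zero]; exact pow_eq_zero_iff two_ne_zero |>.1 (le_antisymm this (sq_nonneg _))
    exact (toDomain a).map_eq_zero_iff.1 (Subtype.ext this)

theorem formSpace_norm (hg : ∃ c, a.IsSemiBound c) (hs : a.IsSymmetric) (u : a.FormSpace) :
    letI := (formCore hg hs).toNormedAddCommGroup
    ‖u‖ = a.formNorm (toDomain a u) := by
  change Real.sqrt (RCLike.re (a.form (toDomain a u) (toDomain a u) +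
    ((1 - a.maxSemiBound : ℝ) : ℂ) * inner ℂ (toDomain a u : H) (toDomain a u : H))) = _
  rw [formNorm, inner_self_eq_norm_sq_to_K]
  simp [← Complex.ofReal_pow]

section Complete

variable (hg : a.IsGenerating) (hs : a.IsSymmetric)

include hg hs in
theorem formSpace_complete :
    letI := (formCore hg.semibounded hs).toNormedAddCommGroup
    CompleteSpace a.FormSpace := by
  let := (formCore hg.semibounded hs).toNormedAddCommGroup
  have hn := formSpace_norm hg.semibounded hs
  refine Metric.complete_of_cauchySeq_tendsto fun x hx => ?_
  obtain ⟨y, hy⟩ := hg.closed (fun n => toDomain a (x n)) fun ε hε => by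
    obtain ⟨N, hN⟩ := Metric.cauchySeq_iff.1 hx ε hε
    refine ⟨N, fun m hm n hn' => ?_⟩
    have := hN m hm n hn'
    rwa [dist_eq_norm, hn, map_sub] at this
  refine ⟨(toDomain a).symm y, tendsto_iff_norm_sub_tendsto_zero.2 ?_⟩
  simp_rw [hn, map_sub, LinearEquiv.apply_symm_apply]
  exact hy

include hg hs in
/-- The Lax–Milgram lemma, which for a symmetric form is the Riesz representation theorem. -/
theorem exists_form_add_eq (f : H) : ∃ u : a.domain, ∀ v : a.domain,
    a.form u v + ((1 - a.maxSemiBound : ℝ) : ℂ) * inner ℂ (v : H) (u : H) = inner ℂ (v : H) f := by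
  let := (formCore hg.semibounded hs).toNormedAddCommGroup
  let : InnerProductSpace ℂ a.FormSpace := InnerProductSpace.ofCore (formCore hg.semibounded hs).toCore
  have : CompleteSpace a.FormSpace := formSpace_complete hg hs
  have hn := formSpace_norm hg.semibounded hs
  let ℓ₀ : a.FormSpace →ₗ[ℂ] ℂ :=
    ((innerₛₗ ℂ f).comp a.domain.subtype).comp (toDomain a : a.FormSpace →ₗ[ℂ] a.domain)
  let ℓ : a.FormSpace →L[ℂ] ℂ := ℓ₀.mkContinuous ‖f‖ fun u => by
    rw [hn]
    exact (norm_inner_le_norm (𝕜 := ℂ) f _).trans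
      (mul_le_mul_of_nonneg_left (norm_le_formNorm hg.semibounded _) (norm_nonneg _))
  refine ⟨toDomain a ((InnerProductSpace.toDual ℂ a.FormSpace).symm ℓ), fun v => ?_⟩
  have h1 : inner ℂ ((InnerProductSpace.toDual ℂ a.FormSpace).symm ℓ) ((toDomain a).symm v) =
      inner ℂ f (v : H) := InnerProductSpace.toDual_symm_apply
  have h2 := congrArg (starRingEnd ℂ) h1
  rw [inner_conj_symm, inner_conj_symm] at h2
  exact h2

include hg hs in
/-- The domain of the associated operator is a core of the form. -/
theorem exists_mem_op_domain_formNorm_sub_lt (u : a.domain) {ε : ℝ} (hε : 0 < ε) :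
    ∃ w : a.domain, (w : H) ∈ a.op.domain ∧ a.formNorm (u - w) < ε := by
  let := (formCore hg.semibounded hs).toNormedAddCommGroup
  let : InnerProductSpace ℂ a.FormSpace := InnerProductSpace.ofCore (formCore hg.semibounded hs).toCore
  have : CompleteSpace a.FormSpace := formSpace_complete hg hs
  have hn := formSpace_norm hg.semibounded hs
  let K : Submodule ℂ a.FormSpace :=
    (a.op.domain.comap a.domain.subtype).comap (toDomain a : a.FormSpace →ₗ[ℂ] a.domain)
  have hK : K.topologicalClosure = ⊤ := by
    rw [Submodule.topologicalClosure_eq_top_iff, Submodule.eq_bot_iff]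
    intro w hw
    -- test the orthogonality with the solution of `(A + 1 - c) v = w`
    obtain ⟨v, hv⟩ := exists_form_add_eq hg hs (toDomain a w : H)
    have hvK : (toDomain a).symm v ∈ K := by
      refine ⟨((v : H), (toDomain a w : H) - ((1 - a.maxSemiBound : ℝ) : ℂ) • (v : H)),
        ⟨v.2, fun z => ?_⟩, rfl⟩
      rw [inner_sub_right, inner_smul_right, ← hv z]
      exact (add_sub_cancel_right _ _).symm
    have h0 : inner ℂ w ((toDomain a).symm v) = 0 :=
      (Submodule.mem_orthogonal' _ _).1 hw _ hvK
    have h1 : inner ℂ w ((toDomain a).symm v) = a.form v (toDomain a w) +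
      ((1 - a.maxSemiBound : ℝ) : ℂ) * inner ℂ (toDomain a w : H) (v : H) := rfl
    rw [h1, hv] at h0
    exact (toDomain a).map_eq_zero_iff.1 (Subtype.ext (inner_self_eq_zero.1 h0))
  have hu : (toDomain a).symm u ∈ closure (K : Set a.FormSpace) := by
    rw [← Submodule.topologicalClosure_coe, hK]; trivial
  obtain ⟨w, hw, hd⟩ := Metric.mem_closure_iff.1 hu ε hε
  refine ⟨toDomain a w, hw, ?_⟩
  rwa [dist_eq_norm, hn, map_sub, LinearEquiv.apply_symm_apply] at hd

end Complete

end SesqForm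

/-- `R = (A + μ)⁻¹` for an operator `A` with `A + μ ≥ 1`: a self-adjoint injective operator with
`0 ≤ R ≤ 1` such that `A u = g` if and only if `u = R (g + μ u)`. -/
structure IsShiftedInverse (A : H →ₗ.[ℂ] H) (μ : ℝ) (R : H →L[ℂ] H) : Prop where
  symmetric : ∀ x y : H, inner ℂ (R x) y = inner ℂ x (R y)
  nonneg : ∀ x : H, 0 ≤ (inner ℂ (R x) x).re
  norm_le : ‖R‖ ≤ 1
  injective : Function.Injective R
  mem_graph : ∀ u g : H, (u, g) ∈ A.graph ↔ u = R (g + (μ : ℂ) • u)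

theorem SesqForm.exists_isShiftedInverse {a : SesqForm H} (hg : a.IsGenerating)
    (hs : a.IsSymmetric) : ∃ R : H →L[ℂ] H, IsShiftedInverse a.op (1 - a.maxSemiBound) R := by
  set μ : ℝ := 1 - a.maxSemiBound with hμ
  choose r hr using SesqForm.exists_form_add_eq hg hs
  -- uniqueness makes the solution operator linear
  have hunique : ∀ (f : H) (u : a.domain), (∀ v : a.domain,
      a.form u v + (μ : ℂ) * inner ℂ (v : H) (u : H) = inner ℂ (v : H) f) → u = r f := by
    intro f u hu
    have h0 := hr f (u - r f)
    have h1 := hu (u - r f)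
    have h2 : a.form (u - r f) (u - r f) + (μ : ℂ) *
        inner ℂ ((u - r f : a.domain) : H) ((u - r f : a.domain) : H) = 0 := by
      have e : a.form (u - r f) = a.form u - a.form (r f) := map_sub _ _ _
      rw [e, LinearMap.sub_apply]
      have e' : inner ℂ ((u - r f : a.domain) : H) ((u - r f : a.domain) : H) =
        inner ℂ ((u - r f : a.domain) : H) (u : H) - inner ℂ ((u - r f : a.domain) : H) (r f : H) := by
        rw [← inner_sub_right]; rfl
      rw [e']
      linear_combination h1 - h0
    have := (SesqForm.formCore hg.semibounded hs).definite
      ((SesqForm.FormSpace.toDomain a).symm (u - r f)) h2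
    exact sub_eq_zero.1 ((LinearEquiv.map_eq_zero_iff _).1 this)
  have hadd : ∀ f g, r (f + g) = r f + r g := fun f g => by
    refine (hunique _ _ fun v => ?_).symm
    rw [map_add, LinearMap.add_apply, Submodule.coe_add, inner_add_right, inner_add_right,
      ← hr f v, ← hr g v]
    ring
  have hsmul : ∀ (c : ℂ) f, r (c • f) = c • r f := fun c f => by
    refine (hunique _ _ fun v => ?_).symm
    rw [map_smul, LinearMap.smul_apply, Submodule.coe_smul, inner_smul_right, inner_smul_right,
      ← hr f v, smul_eq_mul]
    ring
  -- `‖r f‖² ≤ ⟨f, r f⟩`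
  have hsq : ∀ f, ‖(r f : H)‖ ^ 2 ≤ (inner ℂ (r f : H) f).re := fun f => by
    refine (SesqForm.norm_sq_le_formNorm_sq hg.semibounded (r f)).trans (le_of_eq ?_)
    rw [← hr f (r f), inner_self_eq_norm_sq_to_K]
    simp [← Complex.ofReal_pow]
  have hbound : ∀ f, ‖(r f : H)‖ ≤ 1 * ‖f‖ := fun f => by
    rw [one_mul]
    rcases eq_or_ne ‖(r f : H)‖ 0 with h | h
    · rw [h]; exact norm_nonneg _
    · have h1 : ‖(r f : H)‖ ^ 2 ≤ ‖(r f : H)‖ * ‖f‖ :=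
        (hsq f).trans ((Complex.re_le_norm _).trans (norm_inner_le_norm _ _))
      rw [sq] at h1
      exact le_of_mul_le_mul_left h1 (lt_of_le_of_ne (norm_nonneg _) h.symm)
  let R₀ : H →ₗ[ℂ] H :=
    { toFun := fun f => (r f : H)
      map_add' := fun f g => by rw [hadd]; rfl
      map_smul' := fun c f => by rw [hsmul]; rfl }
  refine ⟨R₀.mkContinuous 1 hbound, ?_, ?_, LinearMap.mkContinuous_norm_le _ zero_le_one _, ?_, ?_⟩
  · intro x y
    have h1 := hr x (r y)
    have h2 := hr y (r x)
    change inner ℂ (r x : H) y = inner ℂ x (r y : H)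
    rw [← inner_conj_symm x, ← h1, ← h2, hs (r y) (r x)]
    simp
  · exact fun x => (sq_nonneg _).trans (hsq x)
  · refine (injective_iff_map_eq_zero _).2 fun f hf => ?_
    have hf' : r f = 0 := Subtype.ext hf
    refine hg.dense.eq_zero_of_inner_left (𝕜 := ℂ) fun v hv => ?_
    have := hr f ⟨v, hv⟩
    rw [hf'] at this
    rw [← inner_conj_symm, ← this]
    simp
  · intro u g
    rw [SesqForm.op_graph hg.dense]
    constructor
    · rintro ⟨hu, h⟩
      refine congrArg Subtype.val (hunique (g + (μ : ℂ) • u) ⟨u, hu⟩ fun v => ?_)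
      rw [h v, inner_add_right, inner_smul_right]
    · intro h
      have hu : u ∈ a.domain := h ▸ (r (g + (μ : ℂ) • u)).2
      have e : (⟨u, hu⟩ : a.domain) = r (g + (μ : ℂ) • u) := Subtype.ext h
      refine ⟨hu, fun v => ?_⟩
      have h1 := hr (g + (μ : ℂ) • u) v
      rw [← e, inner_add_right, inner_smul_right] at h1
      exact add_right_cancel h1

namespace IsShiftedInverse

variable {A : H →ₗ.[ℂ] H} {μ : ℝ} {R : H →L[ℂ] H}

theorem apply_mem_graph (h : IsShiftedInverse A μ R) (f : H) :
    (R f, f - (μ : ℂ) • R f) ∈ A.graph := (h.mem_graph _ _).2 (by simp)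

theorem denseRange [CompleteSpace H] (h : IsShiftedInverse A μ R) : DenseRange R := by
  have : (LinearMap.range (R : H →ₗ[ℂ] H)).topologicalClosure = ⊤ := by
    rw [Submodule.topologicalClosure_eq_top_iff, Submodule.eq_bot_iff]
    intro x hx
    refine h.injective ?_
    rw [map_zero]
    refine inner_self_eq_zero (𝕜 := ℂ).1 ?_
    rw [← h.symmetric]
    exact (Submodule.mem_orthogonal _ _).1 hx _ ⟨R x, rfl⟩
  intro x
  have hx : x ∈ (LinearMap.range (R : H →ₗ[ℂ] H)).topologicalClosure := this ▸ trivial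
  exact hx

theorem dense_domain [CompleteSpace H] (h : IsShiftedInverse A μ R) :
    Dense (A.domain : Set H) :=
  h.denseRange.mono (by
    rintro _ ⟨f, rfl⟩
    exact LinearPMap.mem_domain_of_mem_graph (h.apply_mem_graph f))

/-- An adjoint pair `(x, y)` of `A` satisfies `⟨x, f⟩ = ⟨y + μ x, R f⟩` for all `f`, so `(x, y)` is in
the graph of `A` by the symmetry of `R`. -/
theorem isSelfAdjoint [CompleteSpace H] (h : IsShiftedInverse A μ R) : IsSelfAdjoint A := by
  rw [LinearPMap.isSelfAdjoint_def]
  refine LinearPMap.eq_of_eq_graph ?_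
  rw [LinearPMap.adjoint_graph_eq_graph_adjoint h.dense_domain]
  ext ⟨x, y⟩
  rw [Submodule.mem_adjoint_iff]
  constructor
  · intro hxy
    rw [h.mem_graph]
    refine ext_inner_left ℂ fun f => ?_
    have h1 := hxy _ _ (h.apply_mem_graph f)
    simp only [inner_sub_left, inner_smul_left, Complex.conj_ofReal] at h1
    rw [← h.symmetric, inner_add_right, inner_smul_right]
    linear_combination h1
  · intro hxy u g hug
    rw [h.mem_graph] at hxy hug
    dsimp only
    have h1 : inner ℂ (R (g + (μ : ℂ) • u)) (y + (μ : ℂ) • x) =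
      inner ℂ (g + (μ : ℂ) • u) (R (y + (μ : ℂ) • x)) := h.symmetric _ _
    rw [← hxy, ← hug] at h1
    simp only [inner_add_left, inner_add_right, inner_smul_left, inner_smul_right,
      Complex.conj_ofReal] at h1
    linear_combination -h1

/-- `A ≥ -μ`. -/
theorem neg_mul_norm_sq_le (h : IsShiftedInverse A μ R) {u g : H} (hug : (u, g) ∈ A.graph) :
    -μ * ‖u‖ ^ 2 ≤ (inner ℂ u g).re := by
  have h1 := h.nonneg (g + (μ : ℂ) • u)
  rw [← (h.mem_graph u g).1 hug, inner_add_right, inner_smul_right, inner_self_eq_norm_sq_to_K] at h1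
  have : (inner ℂ u g + (μ : ℂ) * ((‖u‖ : ℝ) : ℂ) ^ 2).re = (inner ℂ u g).re + μ * ‖u‖ ^ 2 := by
    simp [← Complex.ofReal_pow]
  erw [this] at h1
  linarith

end IsShiftedInverse

end FormTheory

end Wentzell

/-! ### The analytic semigroup generated by a lower semi-bounded self-adjoint operator -/

namespace Wentzell

/-- The function `x ↦ exp (-z / x)`, continued by `0` at `x = 0`. -/
noncomputable def expInv (z x : ℂ) : ℂ := if x = 0 then 0 else Complex.exp (-z / x)

theorem expInv_zero (z : ℂ) : expInv z 0 = 0 := if_pos rfl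

theorem expInv_of_ne (z : ℂ) {x : ℂ} (hx : x ≠ 0) : expInv z x = Complex.exp (-z / x) := if_neg hx

theorem expInv_mul_expInv (z w x : ℂ) : expInv z x * expInv w x = expInv (z + w) x := by
  rcases eq_or_ne x 0 with rfl | hx
  · simp [expInv_zero]
  · rw [expInv_of_ne _ hx, expInv_of_ne _ hx, expInv_of_ne _ hx, ← Complex.exp_add]
    congr 1; ring

theorem norm_expInv (z : ℂ) {r : ℝ} (hr : 0 < r) : ‖expInv z r‖ = Real.exp (-(z.re / r)) := by
  rw [expInv_of_ne _ (by exact_mod_cast hr.ne'), Complex.norm_exp]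
  simp [Complex.div_ofReal_re, neg_div]

theorem norm_expInv_le_one {z : ℂ} (hz : 0 < z.re) {r : ℝ} (hr : 0 ≤ r) : ‖expInv z r‖ ≤ 1 := by
  rcases hr.eq_or_lt with rfl | hr
  · simp [expInv_zero]
  · rw [norm_expInv z hr, Real.exp_le_one_iff]
    simpa using (div_pos hz hr).le

theorem exp_neg_le_two_div_sq {y : ℝ} (hy : 0 < y) : Real.exp (-y) ≤ 2 / y ^ 2 := by
  rw [Real.exp_neg, inv_le_comm₀ (Real.exp_pos _) (by positivity), inv_div]
  have := Real.quadratic_le_exp_of_nonneg hy.le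
  linarith

theorem norm_expInv_le_sq {z : ℂ} (hz : 0 < z.re) {r : ℝ} (hr : 0 ≤ r) :
    ‖expInv z r‖ ≤ 2 / z.re ^ 2 * r ^ 2 := by
  rcases hr.eq_or_lt with rfl | hr
  · simp [expInv_zero]
  · rw [norm_expInv z hr]
    refine (exp_neg_le_two_div_sq (div_pos hz hr)).trans (le_of_eq ?_)
    field_simp

theorem norm_exp_sub_one_le_of_re_nonpos {v : ℂ} (hv : v.re ≤ 0) :
    ‖Complex.exp v - 1‖ ≤ 2 * ‖v‖ := by
  rcases le_total ‖v‖ 1 with h | h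
  · exact Complex.norm_exp_sub_one_le h
  · have : ‖Complex.exp v‖ ≤ 1 := by rw [Complex.norm_exp]; exact Real.exp_le_one_iff.2 hv
    have := norm_sub_le (Complex.exp v) 1
    rw [norm_one] at this
    linarith

/-- The interval `[0, 1]` of the real axis in the complex plane, which contains the spectrum of
`R = (A + μ)⁻¹`. -/
def unitSegment : Set ℂ := {x | ∃ r : ℝ, 0 ≤ r ∧ r ≤ 1 ∧ x = r}

/-- The bound `‖f x‖ ≤ C ‖x‖` gives the continuity at zero. -/
theorem continuousOn_unitSegment {f : ℂ → ℂ} (hf : ∀ x ≠ 0, ContinuousAt f x) {C : ℝ}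
    (hC : ∀ x ∈ unitSegment, ‖f x‖ ≤ C * ‖x‖) : ContinuousOn f unitSegment := by
  intro x hx
  rcases eq_or_ne x 0 with rfl | hx0
  · have h0 : f 0 = 0 := by simpa using hC 0 hx
    rw [ContinuousWithinAt, h0]
    refine squeeze_zero_norm' (eventually_mem_nhdsWithin.mono hC) ?_
    have : Tendsto (fun x : ℂ => C * ‖x‖) (𝓝 0) (𝓝 (C * ‖(0 : ℂ)‖)) := by
      exact (continuous_const.mul continuous_norm).tendsto 0
    rw [norm_zero, mul_zero] at this
    exact this.mono_left nhdsWithin_le_nhds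
  · exact (hf x hx0).continuousWithinAt

theorem continuousAt_expInv (z : ℂ) {x : ℂ} (hx : x ≠ 0) : ContinuousAt (expInv z) x := by
  have : (fun x => Complex.exp (-z / x)) =ᶠ[𝓝 x] expInv z := by
    filter_upwards [isOpen_ne.mem_nhds hx] with y hy
    exact (expInv_of_ne z hy).symm
  refine ContinuousAt.congr ?_ this
  exact Complex.continuous_exp.continuousAt.comp (continuousAt_const.div continuousAt_id hx)

theorem continuousOn_expInv {z : ℂ} (hz : 0 < z.re) : ContinuousOn (expInv z) unitSegment := by
  refine continuousOn_unitSegment (fun x hx => continuousAt_expInv z hx) (C := 2 / z.re ^ 2) ?_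
  rintro _ ⟨r, h0, h1, rfl⟩
  refine (norm_expInv_le_sq hz h0).trans ?_
  rw [Complex.norm_real, Real.norm_of_nonneg h0]
  gcongr
  nlinarith

theorem continuousOn_inv_mul_expInv {z : ℂ} (hz : 0 < z.re) :
    ContinuousOn (fun x => x⁻¹ * expInv z x) unitSegment := by
  refine continuousOn_unitSegment
    (fun x hx => (continuousAt_id.inv₀ hx).mul (continuousAt_expInv z hx)) (C := 2 / z.re ^ 2) ?_
  rintro _ ⟨r, h0, h1, rfl⟩
  rw [norm_mul, norm_inv, Complex.norm_real, Real.norm_of_nonneg h0]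
  rcases h0.eq_or_lt with rfl | hr
  · simp
  rw [inv_mul_le_iff₀ hr]
  refine (norm_expInv_le_sq hz h0).trans (le_of_eq (by ring))

/-- Quadratic bound for the remainder of the derivative of `z ↦ exp (-z / r)`, uniform in `r`. -/
theorem norm_expInv_sub_sub_le {z w : ℂ} (hz : 0 < z.re) (hw : ‖w - z‖ ≤ z.re / 2) {r : ℝ}
    (hr : 0 ≤ r) :
    ‖expInv w r - expInv z r - (w - z) * -((r : ℂ)⁻¹ * expInv z r)‖ ≤
      8 / z.re ^ 2 * ‖w - z‖ ^ 2 := by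
  rcases hr.eq_or_lt with rfl | hr
  · simp only [Complex.ofReal_zero, expInv_zero]; simp; positivity
  have hr' : (r : ℂ) ≠ 0 := by exact_mod_cast hr.ne'
  set v : ℂ := -((w - z) / r) with hv
  have hvn : ‖v‖ = ‖w - z‖ / r := by
    rw [hv, norm_neg, norm_div, Complex.norm_real, Real.norm_of_nonneg hr.le]
  have e1 : expInv w r = expInv z r * Complex.exp v := by
    rw [expInv_of_ne _ hr', expInv_of_ne _ hr', ← Complex.exp_add]
    congr 1; rw [hv]; field_simp; ring
  have e2 : expInv w r - expInv z r - (w - z) * -((r : ℂ)⁻¹ * expInv z r) =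
      expInv z r * (Complex.exp v - 1 - v) := by
    rw [e1, hv]; field_simp
  have h3 : ‖Complex.exp v - 1 - v‖ ≤ ‖v‖ ^ 2 * Real.exp ‖v‖ := by
    have := Complex.norm_exp_sub_sum_le_norm_mul_exp v 2
    simpa [Finset.sum_range_succ, sub_sub] using this
  rw [e2, norm_mul, norm_expInv z hr]
  have h4 : Real.exp (-(z.re / r)) * Real.exp ‖v‖ ≤ 8 / z.re ^ 2 * r ^ 2 := by
    rw [← Real.exp_add]
    calc Real.exp (-(z.re / r) + ‖v‖) ≤ Real.exp (-(z.re / (2 * r))) := by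
          rw [Real.exp_le_exp, hvn]
          have : ‖w - z‖ / r ≤ z.re / 2 / r := by gcongr
          have e : z.re / 2 / r = z.re / r - z.re / (2 * r) := by field_simp; ring
          linarith
      _ ≤ 2 / (z.re / (2 * r)) ^ 2 := exp_neg_le_two_div_sq (by positivity)
      _ = 8 / z.re ^ 2 * r ^ 2 := by field_simp; ring
  calc Real.exp (-(z.re / r)) * ‖Complex.exp v - 1 - v‖
      ≤ Real.exp (-(z.re / r)) * (‖v‖ ^ 2 * Real.exp ‖v‖) := by gcongr
    _ = (Real.exp (-(z.re / r)) * Real.exp ‖v‖) * ‖v‖ ^ 2 := by ring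
    _ ≤ (8 / z.re ^ 2 * r ^ 2) * ‖v‖ ^ 2 := by gcongr
    _ = 8 / z.re ^ 2 * ‖w - z‖ ^ 2 := by rw [hvn]; field_simp

theorem norm_expInv_sub_one_mul_le {z : ℂ} (hz : 0 < z.re) {r : ℝ} (hr : 0 ≤ r) :
    ‖(expInv z r - 1) * r‖ ≤ 2 * ‖z‖ := by
  rcases hr.eq_or_lt with rfl | hr
  · simp
  have hr' : (r : ℂ) ≠ 0 := by exact_mod_cast hr.ne'
  rw [expInv_of_ne _ hr', norm_mul, Complex.norm_real, Real.norm_of_nonneg hr.le]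
  have h := norm_exp_sub_one_le_of_re_nonpos (v := -z / r) (by
    rw [Complex.div_ofReal_re]; simpa [neg_div] using (div_pos hz hr).le)
  rw [norm_div, norm_neg, Complex.norm_real, Real.norm_of_nonneg hr.le] at h
  calc _ ≤ 2 * (‖z‖ / r) * r := by gcongr
    _ = 2 * ‖z‖ := by field_simp

theorem abs_exp_neg_sub_one_add_le {s : ℝ} (hs : 0 ≤ s) : |Real.exp (-s) - 1 + s| ≤ s ^ 2 := by
  rcases le_total s 1 with h | h
  · have := Real.abs_exp_sub_one_sub_id_le (x := -s) (by rwa [abs_neg, abs_of_nonneg hs])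
    simpa using this
  · have h1 := Real.add_one_le_exp (-s)
    have h2 : Real.exp (-s) ≤ 1 := Real.exp_le_one_iff.2 (by linarith)
    rw [abs_of_nonneg (by linarith)]
    nlinarith

theorem norm_diffQuotient_expInv_le {t : ℝ} (ht : 0 < t) {r : ℝ} (hr : 0 ≤ r) :
    ‖(t : ℂ)⁻¹ * ((expInv t r - 1) * r * r) + r‖ ≤ t := by
  rcases hr.eq_or_lt with rfl | hr
  · simpa using ht.le
  have hr' : (r : ℂ) ≠ 0 := by exact_mod_cast hr.ne'
  have ht' : (t : ℂ) ≠ 0 := by exact_mod_cast ht.ne'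
  have e : (t : ℂ)⁻¹ * ((expInv t r - 1) * r * r) + r =
      ((r ^ 2 / t * (Real.exp (-(t / r)) - 1 + t / r) : ℝ) : ℂ) := by
    rw [expInv_of_ne _ hr']
    push_cast
    rw [neg_div]
    field_simp
  rw [e, Complex.norm_real, norm_mul, Real.norm_of_nonneg (by positivity), Real.norm_eq_abs]
  calc r ^ 2 / t * |Real.exp (-(t / r)) - 1 + t / r| ≤ r ^ 2 / t * (t / r) ^ 2 := by
        gcongr; exact abs_exp_neg_sub_one_add_le (by positivity)
    _ = t := by field_simp

section Heat

variable {H : Type*} [NormedAddCommGroup H] [InnerProductSpace ℂ H] [CompleteSpace H]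

namespace IsShiftedInverse

variable {A : H →ₗ.[ℂ] H} {μ : ℝ} {R : H →L[ℂ] H}

theorem isSelfAdjoint_inverse (h : IsShiftedInverse A μ R) : IsSelfAdjoint R :=
  ContinuousLinearMap.isSelfAdjoint_iff_isSymmetric.2 h.symmetric

theorem spectrum_subset (h : IsShiftedInverse A μ R) : spectrum ℂ R ⊆ unitSegment := by
  intro x hx
  have h1 := h.isSelfAdjoint_inverse.mem_spectrum_eq_re hx
  have hpos : 0 ≤ R := by
    rw [ContinuousLinearMap.nonneg_iff_isPositive, ContinuousLinearMap.isPositive_def]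
    exact ⟨h.symmetric, h.nonneg⟩
  refine ⟨x.re, ?_, ?_, h1⟩
  · rw [h1] at hx
    exact spectrum_nonneg_of_nonneg hpos ((spectrum.algebraMap_mem_iff ℂ).1 hx)
  · refine (Complex.re_le_norm x).trans ((spectrum.norm_le_norm_mul_of_mem hx).trans ?_)
    calc ‖R‖ * ‖(1 : H →L[ℂ] H)‖ ≤ 1 * 1 :=
          mul_le_mul h.norm_le ContinuousLinearMap.norm_id_le (norm_nonneg _) zero_le_one
      _ = 1 := one_mul 1

end IsShiftedInverse

/-- `exp (-z R⁻¹)`, by the continuous functional calculus of `R`; meaningful for `0 < re z`. -/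
noncomputable def heat (R : H →L[ℂ] H) (z : ℂ) : H →L[ℂ] H := cfc (expInv z) R

namespace IsShiftedInverse

variable {A : H →ₗ.[ℂ] H} {μ : ℝ} {R : H →L[ℂ] H} (h : IsShiftedInverse A μ R)
include h

theorem norm_cfc_le {f : ℂ → ℂ} {C : ℝ} (hC : 0 ≤ C) (hf : ∀ r : ℝ, 0 ≤ r → ‖f r‖ ≤ C) :
    ‖cfc f R‖ ≤ C :=
  _root_.norm_cfc_le hC fun x hx => by
    obtain ⟨r, h0, -, rfl⟩ := h.spectrum_subset hx
    exact hf r h0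

theorem norm_heat_le {z : ℂ} (hz : 0 < z.re) : ‖heat R z‖ ≤ 1 :=
  h.norm_cfc_le zero_le_one fun _ hr => norm_expInv_le_one hz hr

theorem heat_mul_heat {z w : ℂ} (hz : 0 < z.re) (hw : 0 < w.re) :
    heat R (z + w) = heat R z * heat R w := by
  rw [heat, heat, heat, ← cfc_mul _ _ _ ((continuousOn_expInv hz).mono h.spectrum_subset)
    ((continuousOn_expInv hw).mono h.spectrum_subset)]
  exact cfc_congr fun x _ => (expInv_mul_expInv z w x).symm

theorem commute_heat (z : ℂ) : Commute R (heat R z) := by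
  have := cfc_commute_cfc (p := IsStarNormal) id (expInv z) R
  rwa [cfc_id ℂ R h.isSelfAdjoint_inverse.isStarNormal] at this

/-- `z ↦ exp (-z R⁻¹)` is holomorphic, with derivative `-R⁻¹ exp (-z R⁻¹)`. -/
theorem hasDerivAt_heat {z : ℂ} (hz : 0 < z.re) :
    HasDerivAt (heat R) (-cfc (fun x => x⁻¹ * expInv z x) R) z := by
  have hz2 : 0 < z.re / 2 := by positivity
  rw [hasDerivAt_iff_isLittleO]
  refine Asymptotics.IsBigO.trans_isLittleO ?_
    (Asymptotics.isLittleO_pow_sub_sub z one_lt_two)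
  refine Asymptotics.IsBigO.of_bound (8 / z.re ^ 2) ?_
  filter_upwards [Metric.closedBall_mem_nhds z hz2] with w hw
  rw [mem_closedBall_iff_norm] at hw
  have hw0 : 0 < w.re := by
    have h1 : |(w - z).re| ≤ z.re / 2 := (Complex.abs_re_le_norm _).trans hw
    rw [Complex.sub_re] at h1
    have := (abs_le.1 h1).1
    linarith
  have c1 := (continuousOn_expInv hz).mono h.spectrum_subset
  have c2 := (continuousOn_expInv hw0).mono h.spectrum_subset
  have c3 := (continuousOn_inv_mul_expInv hz).mono h.spectrum_subset
  have c4 : ContinuousOn (fun x => -(x⁻¹ * expInv z x)) (spectrum ℂ R) := c3.neg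
  have c5 : ContinuousOn (fun x => (w - z) * -(x⁻¹ * expInv z x)) (spectrum ℂ R) :=
    continuousOn_const.mul c4
  have e : heat R w - heat R z - (w - z) • -cfc (fun x => x⁻¹ * expInv z x) R =
      cfc (fun x => expInv w x - expInv z x - (w - z) * -(x⁻¹ * expInv z x)) R := by
    rw [cfc_sub (fun x => expInv w x - expInv z x) _ R (c2.sub c1) c5,
      cfc_sub _ _ R c2 c1, cfc_const_mul _ _ R c4, cfc_neg]
    rfl
  rw [e, norm_pow, norm_norm]
  exact h.norm_cfc_le (by positivity) fun r hr => norm_expInv_sub_sub_le hz hw hr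

/-- `exp (-z R⁻¹)` maps into the range of `R`. -/
theorem inverse_mul_deriv_heat {z : ℂ} (hz : 0 < z.re) :
    R * cfc (fun x => x⁻¹ * expInv z x) R = heat R z := by
  have hn := h.isSelfAdjoint_inverse.isStarNormal
  rw [heat]
  nth_rewrite 1 [← cfc_id ℂ R]
  rw [← cfc_mul _ _ R continuousOn_id ((continuousOn_inv_mul_expInv hz).mono h.spectrum_subset)]
  refine cfc_congr fun x _ => ?_
  rcases eq_or_ne x 0 with rfl | hx
  · simp [expInv_zero]
  · simp [hx]

/-- Strong continuity at `0` on the range of `R`, with a rate. -/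
theorem norm_heat_sub_one_mul_le {z : ℂ} (hz : 0 < z.re) :
    ‖(heat R z - 1) * R‖ ≤ 2 * ‖z‖ := by
  have hn := h.isSelfAdjoint_inverse.isStarNormal
  have c1 := (continuousOn_expInv hz).mono h.spectrum_subset
  have e : (heat R z - 1) * R = cfc (fun x => (expInv z x - 1) * x) R := by
    rw [cfc_mul (fun x => expInv z x - 1) (fun x => x) R (c1.sub continuousOn_const)
      continuousOn_id, cfc_sub _ _ R c1 continuousOn_const, cfc_id' ℂ R, cfc_const_one ℂ R, heat]
  rw [e]
  exact h.norm_cfc_le (by positivity) fun r hr => norm_expInv_sub_one_mul_le hz hr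

/-- Differentiability at `0` on the range of `R²`, with a rate. -/
theorem norm_diffQuotient_heat_le {t : ℝ} (ht : 0 < t) :
    ‖(t : ℂ)⁻¹ • ((heat R t - 1) * R * R) + R‖ ≤ t := by
  have hn := h.isSelfAdjoint_inverse.isStarNormal
  have c1 := (continuousOn_expInv (z := t) (by simpa using ht)).mono h.spectrum_subset
  have c2 : ContinuousOn (fun x => expInv t x - 1) (spectrum ℂ R) := c1.sub continuousOn_const
  have c3 : ContinuousOn (fun x => (expInv t x - 1) * x) (spectrum ℂ R) := c2.mul continuousOn_id
  have c4 : ContinuousOn (fun x => (expInv t x - 1) * x * x) (spectrum ℂ R) :=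
    c3.mul continuousOn_id
  have c5 : ContinuousOn (fun x => (t : ℂ)⁻¹ * ((expInv t x - 1) * x * x)) (spectrum ℂ R) :=
    continuousOn_const.mul c4
  have e : (t : ℂ)⁻¹ • ((heat R t - 1) * R * R) + R =
      cfc (fun x => (t : ℂ)⁻¹ * ((expInv t x - 1) * x * x) + x) R := by
    rw [cfc_add R (fun x => (t : ℂ)⁻¹ * ((expInv t x - 1) * x * x)) (fun x => x) c5
      continuousOn_id, cfc_const_mul _ _ R c4,
      cfc_mul (fun x => (expInv t x - 1) * x) (fun x => x) R c3 continuousOn_id,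
      cfc_mul (fun x => expInv t x - 1) (fun x => x) R c2 continuousOn_id,
      cfc_sub _ _ R c1 continuousOn_const, cfc_id' ℂ R, cfc_const_one ℂ R, heat]
  rw [e]
  exact h.norm_cfc_le ht.le fun r hr => norm_diffQuotient_expInv_le ht hr

end IsShiftedInverse

omit [CompleteSpace H] in
/-- Uniformly bounded operators which converge strongly on the range of an operator with dense
range converge strongly. -/
theorem tendsto_zero_of_norm_le_of_denseRange {ι : Type*} {l : Filter ι} {K : ι → H →L[ℂ] H}
    {R : H →L[ℂ] H} (hR : DenseRange R) {C : ℝ} (hK : ∀ᶠ i in l, ‖K i‖ ≤ C) {ε : ι → ℝ}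
    (hε : Tendsto ε l (𝓝 0)) (hKR : ∀ᶠ i in l, ‖K i * R‖ ≤ ε i) (x : H) :
    Tendsto (fun i => K i x) l (𝓝 0) := by
  rw [Metric.tendsto_nhds]
  intro δ hδ
  have hC : 0 < |C| + 1 := by positivity
  obtain ⟨y, hy⟩ : ∃ y, dist x (R y) < δ / 2 / (|C| + 1) :=
    hR.exists_dist_lt x (by positivity)
  have h1 : ∀ᶠ i in l, ε i * ‖y‖ < δ / 2 := by
    have : Tendsto (fun i => ε i * ‖y‖) l (𝓝 (0 * ‖y‖)) := hε.mul_const _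
    rw [zero_mul] at this
    exact this.eventually_lt_const (by positivity)
  filter_upwards [hK, hKR, h1] with i h2 h3 h4
  have e : K i x = K i (x - R y) + (K i * R) y := by
    simp [map_sub]
  rw [dist_zero_right, e]
  have h5 : ‖K i (x - R y)‖ ≤ (|C| + 1) * ‖x - R y‖ :=
    (K i).le_of_opNorm_le (h2.trans ((le_abs_self C).trans (by linarith))) _
  have h6 : ‖(K i * R) y‖ ≤ ε i * ‖y‖ := (K i * R).le_of_opNorm_le h3 y
  rw [dist_eq_norm, lt_div_iff₀ hC] at hy
  linarith [norm_add_le (K i (x - R y)) ((K i * R) y)]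

namespace IsShiftedInverse

variable {A : H →ₗ.[ℂ] H} {μ : ℝ} {R : H →L[ℂ] H} (h : IsShiftedInverse A μ R)
include h

theorem tendsto_heat (x : H) :
    Tendsto (fun z => heat R z x) (𝓝[{z : ℂ | 0 < z.re}] 0) (𝓝 x) := by
  have h0 : Tendsto (fun z : ℂ => 2 * ‖z‖) (𝓝[{z : ℂ | 0 < z.re}] 0) (𝓝 0) := by
    have : Tendsto (fun z : ℂ => 2 * ‖z‖) (𝓝 0) (𝓝 (2 * ‖(0 : ℂ)‖)) :=
      (continuous_const.mul continuous_norm).tendsto 0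
    rw [norm_zero, mul_zero] at this
    exact this.mono_left nhdsWithin_le_nhds
  have h1 := tendsto_zero_of_norm_le_of_denseRange (K := fun z => heat R z - 1) h.denseRange
    (C := 2) (eventually_mem_nhdsWithin.mono fun z hz => by
      refine (norm_sub_le _ _).trans ?_
      have := h.norm_heat_le hz
      have : ‖(1 : H →L[ℂ] H)‖ ≤ 1 := ContinuousLinearMap.norm_id_le
      linarith) h0
    (eventually_mem_nhdsWithin.mono fun z hz => h.norm_heat_sub_one_mul_le hz) x
  have h2 := h1.add_const x
  simpa using h2

theorem tendsto_diffQuotient_heat (w : H) :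
    Tendsto (fun t : ℝ => (t : ℂ)⁻¹ • (heat R t (R w) - R w)) (𝓝[>] 0) (𝓝 (-w)) := by
  have hid : Tendsto (fun t : ℝ => t) (𝓝[>] 0) (𝓝 0) := tendsto_nhdsWithin_of_tendsto_nhds tendsto_id
  have h1 := tendsto_zero_of_norm_le_of_denseRange
    (K := fun t : ℝ => (t : ℂ)⁻¹ • ((heat R t - 1) * R) + 1) h.denseRange (C := 3)
    (eventually_mem_nhdsWithin.mono fun t (ht : 0 < t) => by
      refine (norm_add_le _ _).trans ?_
      have h1 := h.norm_heat_sub_one_mul_le (z := t) (by simpa using ht)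
      have h2 : ‖(1 : H →L[ℂ] H)‖ ≤ 1 := ContinuousLinearMap.norm_id_le
      rw [norm_smul, norm_inv, Complex.norm_real, Real.norm_of_nonneg ht.le]
      rw [Complex.norm_real, Real.norm_of_nonneg ht.le] at h1
      have : t⁻¹ * ‖(heat R t - 1) * R‖ ≤ 2 := by
        rw [inv_mul_le_iff₀ ht]; linarith
      linarith) hid
    (eventually_mem_nhdsWithin.mono fun t (ht : 0 < t) => by
      have := h.norm_diffQuotient_heat_le ht
      rwa [add_mul, one_mul, smul_mul_assoc]) w
  have h2 := h1.sub_const w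
  rw [zero_sub] at h2
  refine h2.congr fun t => ?_
  simp

/-- The semigroup generated by `-A`, namely `exp (μ z) exp (-z R⁻¹)`. A difference quotient at `0` that
converges to `y` does so after applying `R`, which identifies `R y` and so the generator. -/
theorem exists_analyticSemigroup : ∃ T : ℝ → H →L[ℂ] H, IsAnalyticSemigroup T ∧
    IsGeneratorOf (-A) T ∧ ∀ x, ContinuousOn (fun t => T t x) (Ici 0) ∧
      ContDiffOn ℝ 1 (fun t => T t x) (Ioi 0) ∧
      ∀ t > 0, (T t x, -deriv (fun t => T t x) t) ∈ A.graph := by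
  set S : ℂ → H →L[ℂ] H := fun z => Complex.exp (μ * z) • heat R z with hS
  set T : ℝ → H →L[ℂ] H := fun t => if 0 < t then S t else 1 with hT
  have hTS : ∀ t : ℝ, 0 < t → T t = S t := fun t ht => if_pos ht
  have hT0 : T 0 = 1 := if_neg (lt_irrefl 0)
  have hSmul : ∀ z w : ℂ, 0 < z.re → 0 < w.re → S (z + w) = S z * S w := fun z w hz hw => by
    simp only [hS]
    rw [h.heat_mul_heat hz hw, mul_add, Complex.exp_add, smul_mul_smul_comm]
  have hSderiv : ∀ z : ℂ, 0 < z.re → HasDerivAt S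
      (Complex.exp (μ * z) • -cfc (fun x => x⁻¹ * expInv z x) R +
        (Complex.exp (μ * z) * μ) • heat R z) z := fun z hz => by
    have h1 : HasDerivAt (fun z : ℂ => Complex.exp (μ * z)) (Complex.exp (μ * z) * μ) z := by
      simpa using ((hasDerivAt_id z).const_mul (μ : ℂ)).cexp
    exact h1.smul (h.hasDerivAt_heat hz)
  have hSlim : ∀ x : H, Tendsto (fun z => S z x) (𝓝[{z : ℂ | 0 < z.re}] 0) (𝓝 x) := fun x => by
    have h1 : Tendsto (fun z : ℂ => Complex.exp (μ * z)) (𝓝[{z : ℂ | 0 < z.re}] 0) (𝓝 1) := by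
      have : Continuous fun z : ℂ => Complex.exp (μ * z) := by fun_prop
      have := this.tendsto 0
      rw [mul_zero, Complex.exp_zero] at this
      exact this.mono_left nhdsWithin_le_nhds
    have := h1.smul (h.tendsto_heat x)
    rwa [one_smul] at this
  have hofReal : Tendsto (fun t : ℝ => (t : ℂ)) (𝓝[>] 0) (𝓝[{z : ℂ | 0 < z.re}] 0) := by
    refine tendsto_nhdsWithin_iff.2 ⟨?_, eventually_mem_nhdsWithin.mono fun t ht => by simpa using ht⟩
    exact (Complex.continuous_ofReal.tendsto' 0 0 Complex.ofReal_zero).mono_left nhdsWithin_le_nhds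
  have hTlim : ∀ x : H, Tendsto (fun t => T t x) (𝓝[>] 0) (𝓝 x) := fun x =>
    ((hSlim x).comp hofReal).congr' (eventually_mem_nhdsWithin.mono fun t ht => by
      simp [hTS t ht])
  have hsector : sector (Real.pi / 2) ⊆ {z : ℂ | 0 < z.re} := by
    rintro z ⟨hz0, hz⟩
    exact (Complex.abs_arg_lt_pi_div_two_iff.1 hz).resolve_right hz0
  have hTderiv : ∀ (t : ℝ) (x : H), 0 < t → HasDerivAt (fun t => T t x)
      ((Complex.exp (μ * t) • -cfc (fun x => x⁻¹ * expInv t x) R +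
        (Complex.exp (μ * t) * μ) • heat R t) x) t := fun t x ht => by
    have h0 : HasDerivAt (fun s : ℝ => (s : ℂ)) ((1 : ℝ) : ℂ) t := (hasDerivAt_id t).ofReal_comp
    have h1 := (hSderiv t (by simpa using ht)).scomp t h0
    rw [Complex.ofReal_one, one_smul] at h1
    have h2 := ((ContinuousLinearMap.apply ℂ H x).restrictScalars ℝ).hasFDerivAt.comp_hasDerivAt t h1
    refine h2.congr_of_eventuallyEq ?_
    filter_upwards [isOpen_Ioi.mem_nhds ht] with s hs
    simp [hTS s hs]
  -- on the range of `R`, the difference quotients converge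
  have hgen : ∀ w : H, Tendsto (fun t : ℝ => ((t⁻¹ : ℝ) : ℂ) • (T t (R w) - R w)) (𝓝[>] 0)
      (𝓝 (-(w - (μ : ℂ) • R w))) := fun w => by
    have h1 : Tendsto (fun t : ℝ => Complex.exp (μ * t)) (𝓝[>] 0) (𝓝 1) := by
      have : Continuous fun t : ℝ => Complex.exp (μ * t) := by fun_prop
      have := this.tendsto 0
      rw [Complex.ofReal_zero, mul_zero, Complex.exp_zero] at this
      exact this.mono_left nhdsWithin_le_nhds
    have h2 : Tendsto (fun t : ℝ => (t : ℂ)⁻¹ * (Complex.exp (μ * t) - 1)) (𝓝[>] 0) (𝓝 μ) := by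
      have : HasDerivAt (fun z : ℂ => Complex.exp (μ * z)) μ ((0 : ℝ) : ℂ) := by
        simpa using ((hasDerivAt_id (0 : ℂ)).const_mul (μ : ℂ)).cexp
      have h3 := this.comp_ofReal.hasDerivWithinAt (s := Ioi 0)
      rw [hasDerivWithinAt_iff_tendsto_slope' (by simp)] at h3
      refine h3.congr fun t => ?_
      simp [slope_def_module]
    have h3 := (h1.smul (h.tendsto_diffQuotient_heat w)).add (h2.smul_const (R w))
    rw [one_smul] at h3
    rw [neg_sub, sub_eq_neg_add]
    refine h3.congr' (eventually_mem_nhdsWithin.mono fun t (ht : 0 < t) => ?_)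
    dsimp only
    rw [hTS t ht]
    simp only [hS, smul_apply, smul_sub, mul_sub, sub_smul, mul_smul,
      Complex.ofReal_inv, mul_one]
    rw [smul_comm (Complex.exp _) ((t : ℂ)⁻¹), smul_comm (Complex.exp _) ((t : ℂ)⁻¹)]
    abel
  refine ⟨T, ⟨⟨hT0, ?_, hTlim⟩, Real.pi / 2, by positivity, le_rfl, S,
    fun t ht => (hTS t ht).symm, ?_, ?_, ?_⟩, ?_, fun x => ⟨?_, ?_, ?_⟩⟩
  · intro s hs t ht
    rcases hs.eq_or_lt with rfl | hs
    · rw [zero_add, hT0, one_mul]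
    rcases ht.eq_or_lt with rfl | ht
    · rw [add_zero, hT0, mul_one]
    rw [hTS s hs, hTS t ht, hTS _ (add_pos hs ht), Complex.ofReal_add]
    exact hSmul _ _ (by simpa using hs) (by simpa using ht)
  · exact fun z hz => (hSderiv z (hsector hz)).differentiableAt.differentiableWithinAt
  · exact fun z hz w hw => hSmul z w (hsector hz) (hsector hw)
  · exact fun θ _ hθ x => (hSlim x).mono_left (nhdsWithin_mono _ fun z hz =>
      hsector ⟨hz.1, hz.2.trans hθ⟩)
  · intro x y
    have hneg : (x, y) ∈ (-A).graph ↔ (x, -y) ∈ A.graph := by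
      rw [LinearPMap.neg_graph]
      constructor
      · rintro ⟨⟨u, g⟩, hug, hxy⟩
        simp only [LinearMap.prodMap_apply, LinearMap.id_coe, id_eq, LinearMap.neg_apply,
          Prod.mk.injEq] at hxy
        rw [← hxy.1, ← hxy.2, neg_neg]
        exact hug
      · exact fun hx => ⟨(x, -y), hx, by simp⟩
    rw [hneg, h.mem_graph]
    constructor
    · intro hx
      have := hgen (-y + (μ : ℂ) • x)
      rw [← hx] at this
      simpa using this
    · intro hlim
      have h1 := (R.continuous.tendsto y).comp hlim
      have h2 := hgen x
      have h3 : R y = -(x - (μ : ℂ) • R x) := by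
        refine tendsto_nhds_unique (h1.congr' ?_) h2
        filter_upwards [self_mem_nhdsWithin] with t (ht : 0 < t)
        have hc : R (heat R t x) = heat R t (R x) := congrArg (· x) (h.commute_heat t)
        simp [hTS t ht, hS, hc]
      rw [map_add, map_neg, map_smul, h3]
      abel
  · intro t ht
    rcases (mem_Ici.1 ht).eq_or_lt with rfl | ht
    · rw [← continuousWithinAt_Ioi_iff_Ici, ContinuousWithinAt, hT0]
      exact hTlim x
    · exact (hTderiv t x ht).continuousAt.continuousWithinAt
  · have hd : DifferentiableOn ℂ S {z : ℂ | 0 < z.re} := fun z hz =>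
      (hSderiv z hz).differentiableAt.differentiableWithinAt
    have hc : ContDiffOn ℝ 1 S {z : ℂ | 0 < z.re} :=
      (hd.contDiffOn (isOpen_lt continuous_const Complex.continuous_re)).restrict_scalars ℝ
    have hc2 : ContDiffOn ℝ 1 (fun t : ℝ => S (t : ℂ)) (Ioi 0) :=
      hc.comp Complex.ofRealCLM.contDiff.contDiffOn fun t ht => by simpa using ht
    have hc3 := ((ContinuousLinearMap.apply ℂ H x).restrictScalars ℝ).contDiff.comp_contDiffOn hc2
    refine hc3.congr fun t ht => ?_
    simp [hTS t ht]
  · intro t ht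
    have hre : 0 < (t : ℂ).re := by simpa using ht
    rw [(hTderiv t x ht).deriv, h.mem_graph, hTS t ht]
    have e : ∀ v, R (cfc (fun x => x⁻¹ * expInv t x) R v) = heat R t v := fun v =>
      congrArg (· v) (h.inverse_mul_deriv_heat hre)
    simp only [hS, smul_apply, add_apply,
      neg_apply, smul_neg, map_add, map_neg, map_smul, neg_add, neg_neg, e,
      smul_smul]
    rw [mul_comm (μ : ℂ) (Complex.exp _)]
    abel

omit [CompleteSpace H] in
/-- Uniqueness for the Cauchy problem, by the energy estimate `(e^{-2μt} ‖u(t)‖²)' ≤ 0`. -/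
theorem eq_of_deriv_mem_graph {u v : ℝ → H} (hu : ContinuousOn u (Ici 0))
    (hv : ContinuousOn v (Ici 0)) (hu' : ∀ t > 0, DifferentiableAt ℝ u t)
    (hv' : ∀ t > 0, DifferentiableAt ℝ v t) (hug : ∀ t > 0, (u t, -deriv u t) ∈ A.graph)
    (hvg : ∀ t > 0, (v t, -deriv v t) ∈ A.graph) (h0 : u 0 = v 0) : ∀ t ≥ 0, u t = v t := by
  let : InnerProductSpace ℝ H := InnerProductSpace.rclikeToReal ℂ H
  set E : ℝ → ℝ := fun t => Real.exp (-2 * μ * t) * ‖u t - v t‖ ^ 2 with hE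
  have hderiv : ∀ t > 0, HasDerivAt E (Real.exp (-2 * μ * t) * (-2 * μ) * ‖u t - v t‖ ^ 2 +
      Real.exp (-2 * μ * t) * (2 * inner ℝ (u t - v t) (deriv u t - deriv v t))) t := by
    intro t ht
    have h1 : HasDerivAt (fun t => Real.exp (-2 * μ * t)) (Real.exp (-2 * μ * t) * (-2 * μ)) t := by
      simpa using ((hasDerivAt_id t).const_mul (-2 * μ)).exp
    exact h1.mul ((hu' t ht).hasDerivAt.sub (hv' t ht).hasDerivAt).norm_sq
  have hanti : AntitoneOn E (Ici 0) := by
    refine antitoneOn_of_deriv_nonpos (convex_Ici 0) ?_ ?_ ?_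
    · exact (by fun_prop : Continuous fun t => Real.exp (-2 * μ * t)).continuousOn.mul
        ((hu.sub hv).norm.pow 2)
    · rw [interior_Ici]
      exact fun t ht => (hderiv t ht).differentiableAt.differentiableWithinAt
    · rw [interior_Ici]
      intro t ht
      rw [(hderiv t ht).deriv]
      have h1 := h.neg_mul_norm_sq_le (A.graph.sub_mem (hug t ht) (hvg t ht))
      have e : -deriv u t - -deriv v t = -(deriv u t - deriv v t) := by abel
      rw [e, inner_neg_right] at h1
      have h2 : inner ℝ (u t - v t) (deriv u t - deriv v t) =
        (inner ℂ (u t - v t) (deriv u t - deriv v t)).re := real_inner_eq_re_inner ℂ _ _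
      rw [h2]
      rw [Complex.neg_re] at h1
      have : 0 < Real.exp (-2 * μ * t) := Real.exp_pos _
      nlinarith
  intro t ht
  have h1 := hanti (mem_Ici.2 le_rfl) (mem_Ici.2 ht) ht
  have h2 : Real.exp (-2 * μ * t) * ‖u t - v t‖ ^ 2 ≤ 0 := by simpa [hE, h0] using h1
  have h3 : ‖u t - v t‖ ^ 2 ≤ 0 := by
    by_contra hc
    exact absurd h2 (not_le.2 (mul_pos (Real.exp_pos _) (not_le.1 hc)))
  have h4 : ‖u t - v t‖ = 0 := pow_eq_zero_iff two_ne_zero |>.1 (le_antisymm h3 (sq_nonneg _))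
  exact sub_eq_zero.1 (norm_eq_zero.1 h4)

end IsShiftedInverse

end Heat

end Wentzell

/-! ### Bessel potentials of Schwartz functions -/

namespace Wentzell

section Bessel

open FourierTransform

variable {d : ℕ}

/-- The Bessel potential operator on Schwartz functions, so that the norm of `f` in `H^s(ℝ^d)` is
the `L²` norm of `bessel s f`. -/
noncomputable def bessel (s : ℝ) : 𝓢(Space d, ℂ) →L[ℂ] 𝓢(Space d, ℂ) :=
  SchwartzMap.fourierMultiplierCLM ℂ (fun x => (((1 + ‖x‖ ^ 2) ^ (s / 2) : ℝ) : ℂ))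

theorem isSobolevLift_bessel (s : ℝ) (f : 𝓢(Space d, ℂ)) :
    IsSobolevLift s (f.toLp 2 volume) ((bessel s f).toLp 2 volume) := by
  rw [IsSobolevLift, bessel, TemperedDistribution.besselPotential,
    Lp.toTemperedDistribution_toLp_eq, Lp.toTemperedDistribution_toLp_eq,
    TemperedDistribution.fourierMultiplierCLM_toTemperedDistributionCLM_eq (by fun_prop)]

theorem bessel_bessel (s t : ℝ) (f : 𝓢(Space d, ℂ)) : bessel s (bessel t f) = bessel (s + t) f := by
  rw [bessel, bessel, bessel, SchwartzMap.fourierMultiplierCLM_fourierMultiplierCLM_apply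
    (by fun_prop) (by fun_prop)]
  congr 1
  congr 1
  ext x
  rw [Pi.mul_apply, ← Complex.ofReal_mul, ← Real.rpow_add (by positivity), add_div]

theorem bessel_zero (f : 𝓢(Space d, ℂ)) : bessel 0 f = f := by
  simp [bessel]

theorem fourier_bessel (s : ℝ) (f : 𝓢(Space d, ℂ)) (ξ : Space d) :
    𝓕 (bessel s f) ξ = (((1 + ‖ξ‖ ^ 2) ^ (s / 2) : ℝ) : ℂ) * 𝓕 f ξ := by
  rw [bessel, SchwartzMap.fourierMultiplierCLM_apply, FourierTransform.fourier_fourierInv_eq,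
    SchwartzMap.smulLeftCLM_apply_apply (by fun_prop), smul_eq_mul]

/-- Plancherel's theorem turns a pointwise bound of the Fourier transforms into a bound of the
`L²` norms. -/
theorem norm_toLp_le_of_norm_fourier_le {f g : 𝓢(Space d, ℂ)} {C : ℝ}
    (h : ∀ ξ, ‖𝓕 f ξ‖ ≤ C * ‖𝓕 g ξ‖) : ‖f.toLp 2 volume‖ ≤ C * ‖g.toLp 2 volume‖ := by
  rw [← SchwartzMap.norm_fourier_toL2_eq, ← SchwartzMap.norm_fourier_toL2_eq g]
  refine Lp.norm_le_mul_norm_of_ae_le_mul ?_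
  filter_upwards [SchwartzMap.coeFn_toLp (𝓕 f) 2 volume, SchwartzMap.coeFn_toLp (𝓕 g) 2 volume]
    with ξ h1 h2
  rw [h1, h2]
  exact h ξ

theorem norm_toLp_le_norm_bessel {s : ℝ} (hs : 0 ≤ s) (f : 𝓢(Space d, ℂ)) :
    ‖f.toLp 2 volume‖ ≤ ‖(bessel s f).toLp 2 volume‖ := by
  rw [← one_mul ‖(bessel s f).toLp 2 volume‖]
  refine norm_toLp_le_of_norm_fourier_le fun ξ => ?_
  rw [fourier_bessel, one_mul, norm_mul, Complex.norm_real, Real.norm_of_nonneg (by positivity)]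
  have : 1 ≤ (1 + ‖ξ‖ ^ 2) ^ (s / 2) :=
    Real.one_le_rpow (by nlinarith [sq_nonneg ‖ξ‖]) (by positivity)
  nlinarith [norm_nonneg (𝓕 f ξ)]

/-- The difference `f(· + v) - f`. -/
noncomputable def shiftSub (v : Space d) (f : 𝓢(Space d, ℂ)) : 𝓢(Space d, ℂ) :=
  f.compSubConstCLM ℂ (-v) - f

theorem shiftSub_apply (v : Space d) (f : 𝓢(Space d, ℂ)) (x : Space d) :
    shiftSub v f x = f (x + v) - f x := by
  simp [shiftSub]

theorem fourier_shiftSub (v : Space d) (f : 𝓢(Space d, ℂ)) (ξ : Space d) :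
    𝓕 (shiftSub v f) ξ =
      (Complex.exp (((2 * Real.pi * inner ℝ v ξ : ℝ) : ℂ) * Complex.I) - 1) * 𝓕 f ξ := by
  have h1 : 𝓕 (f.compSubConstCLM ℂ (-v)) ξ =
      Complex.exp (((2 * Real.pi * inner ℝ v ξ : ℝ) : ℂ) * Complex.I) * 𝓕 f ξ := by
    have := congrFun (VectorFourier.fourierIntegral_comp_add_right Real.fourierChar
      (volume : Measure (Space d)) (innerₗ (Space d)) f v) ξ
    rw [SchwartzMap.fourier_coe, SchwartzMap.fourier_coe]
    have e : (f.compSubConstCLM ℂ (-v) : Space d → ℂ) = f ∘ fun x => x + v := by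
      ext x; simp
    rw [e]
    refine this.trans ?_
    rw [Circle.smul_def, Real.fourierChar_apply]
    rfl
  have h2 : 𝓕 (shiftSub v f) = 𝓕 (f.compSubConstCLM ℂ (-v)) - 𝓕 f :=
    map_sub (fourierCLM ℂ 𝓢(Space d, ℂ)) _ _
  rw [h2, sub_apply, h1]
  ring

theorem norm_exp_mul_I_sub_one_le {σ : ℝ} (h0 : 0 ≤ σ) (h1 : σ ≤ 1) (θ : ℝ) :
    ‖Complex.exp (θ * Complex.I) - 1‖ ≤ 2 * |θ| ^ σ := by
  have ha : ‖Complex.exp (θ * Complex.I) - 1‖ ≤ |θ| := by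
    rw [mul_comm]
    exact Real.norm_exp_I_mul_ofReal_sub_one_le
  have hb : ‖Complex.exp (θ * Complex.I) - 1‖ ≤ 2 := by
    refine (norm_sub_le _ _).trans ?_
    rw [Complex.norm_exp_ofReal_mul_I, norm_one]; norm_num
  rcases le_total |θ| 1 with h | h
  · rcases eq_or_ne θ 0 with rfl | hθ
    · simp; positivity
    have : |θ| ^ (1 : ℝ) ≤ |θ| ^ σ :=
      Real.rpow_le_rpow_of_exponent_ge (abs_pos.2 hθ) h h1
    rw [Real.rpow_one] at this
    have := Real.rpow_nonneg (abs_nonneg θ) σ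
    linarith
  · have := Real.one_le_rpow h h0
    linarith

/-- Translation is Hölder continuous of order `σ` from `H^s(ℝ^d)` to `L²(ℝ^d)`, for `σ ≤ 1` and
`σ ≤ s`. -/
theorem norm_shiftSub_le {s σ : ℝ} (h0 : 0 ≤ σ) (h1 : σ ≤ 1) (hs : σ ≤ s) (v : Space d)
    (f : 𝓢(Space d, ℂ)) :
    ‖(shiftSub v f).toLp 2 volume‖ ≤
      2 * (2 * Real.pi) ^ σ * ‖v‖ ^ σ * ‖(bessel s f).toLp 2 volume‖ := by
  refine norm_toLp_le_of_norm_fourier_le fun ξ => ?_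
  rw [fourier_shiftSub, fourier_bessel, norm_mul, norm_mul, Complex.norm_real,
    Real.norm_of_nonneg (by positivity), ← mul_assoc]
  refine mul_le_mul_of_nonneg_right ?_ (norm_nonneg _)
  refine (norm_exp_mul_I_sub_one_le h0 h1 _).trans ?_
  have h2 : |2 * Real.pi * inner ℝ v ξ| ≤ 2 * Real.pi * (‖v‖ * ‖ξ‖) := by
    rw [abs_mul, abs_of_pos (by positivity)]
    gcongr
    exact abs_real_inner_le_norm v ξ
  have h3 : |2 * Real.pi * inner ℝ v ξ| ^ σ ≤ (2 * Real.pi) ^ σ * (‖v‖ ^ σ * ‖ξ‖ ^ σ) := by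
    rw [← Real.mul_rpow (by positivity) (by positivity),
      ← Real.mul_rpow (by positivity) (by positivity)]
    exact Real.rpow_le_rpow (abs_nonneg _) h2 h0
  have h4 : ‖ξ‖ ^ σ ≤ (1 + ‖ξ‖ ^ 2) ^ (s / 2) := by
    calc ‖ξ‖ ^ σ = (‖ξ‖ ^ 2) ^ (σ / 2) := by
          rw [← Real.rpow_natCast, ← Real.rpow_mul (norm_nonneg _)]; congr 1; push_cast; ring
      _ ≤ (1 + ‖ξ‖ ^ 2) ^ (σ / 2) :=
          Real.rpow_le_rpow (by positivity) (by linarith) (by positivity)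
      _ ≤ (1 + ‖ξ‖ ^ 2) ^ (s / 2) :=
          Real.rpow_le_rpow_of_exponent_le (by nlinarith [sq_nonneg ‖ξ‖]) (by linarith)
  calc 2 * |2 * Real.pi * inner ℝ v ξ| ^ σ
      ≤ 2 * ((2 * Real.pi) ^ σ * (‖v‖ ^ σ * (1 + ‖ξ‖ ^ 2) ^ (s / 2))) := by
        gcongr; exact h3.trans (by gcongr)
    _ = _ := by ring

/-- Schwartz functions are dense in `H^s(ℝ^d)`, `s ≥ 0`. -/
theorem exists_schwartz_tendsto {s : ℝ} (hs : 0 ≤ s)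
    {U G : Lp ℂ 2 (volume : Measure (Space d))} (h : IsSobolevLift s U G) :
    ∃ f : ℕ → 𝓢(Space d, ℂ), Tendsto (fun n => (f n).toLp 2 volume) atTop (𝓝 U) ∧
      Tendsto (fun n => (bessel s (f n)).toLp 2 volume) atTop (𝓝 G) := by
  have hdense := SchwartzMap.denseRange_toLpCLM (E := Space d) (F := ℂ) (p := 2)
    (μ := volume) ENNReal.ofNat_ne_top
  obtain ⟨x, hx, hxG⟩ := mem_closure_iff_seq_limit.1 (hdense G)
  choose g hg using hx
  have hgG : Tendsto (fun n => (g n).toLp 2 volume) atTop (𝓝 G) := by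
    refine hxG.congr fun n => ?_
    rw [← hg n]; rfl
  have hfg : ∀ n, bessel s (bessel (-s) (g n)) = g n := fun n => by
    rw [bessel_bessel, add_neg_cancel, bessel_zero]
  have hsub : ∀ f f' : 𝓢(Space d, ℂ), (f - f').toLp 2 volume =
      f.toLp 2 volume - f'.toLp 2 volume := fun f f' =>
    map_sub (SchwartzMap.toLpCLM ℂ ℂ 2 volume) f f'
  refine ⟨fun n => bessel (-s) (g n), ?_, by simpa only [hfg] using hgG⟩
  -- the sequence is Cauchy in `L²` since the Bessel potential of order `-s` is a contraction
  have hC : CauchySeq fun n => (bessel (-s) (g n)).toLp 2 volume := by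
    refine Metric.cauchySeq_iff'.2 fun ε hε => ?_
    obtain ⟨N, hN⟩ := Metric.cauchySeq_iff'.1 hgG.cauchySeq ε hε
    refine ⟨N, fun n hn => lt_of_le_of_lt ?_ (hN n hn)⟩
    rw [dist_eq_norm, dist_eq_norm, ← hsub, ← hsub, ← map_sub]
    refine (norm_toLp_le_norm_bessel hs _).trans (le_of_eq ?_)
    rw [bessel_bessel, add_neg_cancel, bessel_zero]
  obtain ⟨V, hV⟩ := cauchySeq_tendsto_of_complete hC
  have hcont := (Lp.toTemperedDistributionCLM (E := Space d) ℂ volume 2).continuous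
  -- both `U` and `V` are the Bessel potential of order `-s` of `G`
  have h1 : Tendsto (fun n => TemperedDistribution.besselPotential (Space d) ℂ s
      (Lp.toTemperedDistributionCLM (E := Space d) ℂ volume 2
        ((bessel (-s) (g n)).toLp 2 volume))) atTop
      (𝓝 (TemperedDistribution.besselPotential (Space d) ℂ s
        (Lp.toTemperedDistributionCLM (E := Space d) ℂ volume 2 V))) :=
    (((TemperedDistribution.besselPotential (Space d) ℂ s).continuous.comp hcont).tendsto V).comp hV
  have h2 : Tendsto (fun n => Lp.toTemperedDistributionCLM (E := Space d) ℂ volume 2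
      ((g n).toLp 2 volume)) atTop
      (𝓝 (Lp.toTemperedDistributionCLM (E := Space d) ℂ volume 2 G)) :=
    (hcont.tendsto G).comp hgG
  have h3 : TemperedDistribution.besselPotential (Space d) ℂ s
      (Lp.toTemperedDistributionCLM (E := Space d) ℂ volume 2 V) =
      Lp.toTemperedDistributionCLM (E := Space d) ℂ volume 2 G := by
    refine tendsto_nhds_unique h1 (h2.congr fun n => ?_)
    have := isSobolevLift_bessel s (bessel (-s) (g n))
    rw [hfg] at this
    exact this.symm
  have h4 : Lp.toTemperedDistributionCLM (E := Space d) ℂ volume 2 V =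
      Lp.toTemperedDistributionCLM (E := Space d) ℂ volume 2 U := by
    have h5 := (TemperedDistribution.besselPotential_neg_apply_eq_iff s _ _).2 h3
    have h6 := (TemperedDistribution.besselPotential_neg_apply_eq_iff s _ _).2 h
    exact h5.symm.trans h6
  have h7 : V = U := LinearMap.ker_eq_bot.1
    (Lp.ker_toTemperedDistributionCLM_eq_bot (E := Space d) (F := ℂ) (μ := volume) (p := 2)) h4
  exact h7 ▸ hV

end Bessel

end Wentzell

/-! ### The trace inequality -/

namespace Wentzell

variable {d : ℕ}

theorem eLpNorm_two_sq {X E : Type*} [MeasurableSpace X] [NormedAddCommGroup E] (f : X → E)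
    (μ : Measure X) : eLpNorm f 2 μ ^ 2 = ∫⁻ x, ‖f x‖ₑ ^ 2 ∂μ := by
  have := eLpNorm_nnreal_pow_eq_lintegral (μ := μ) (f := f) (p := 2) two_ne_zero
  simpa using this

theorem add_sq_le_four_mul (a b : ENNReal) : (a + b) ^ 2 ≤ 4 * (a ^ 2 + b ^ 2) := by
  have h : a + b ≤ 2 * max a b := by
    rw [two_mul]; exact add_le_add (le_max_left _ _) (le_max_right _ _)
  calc (a + b) ^ 2 ≤ (2 * max a b) ^ 2 := by gcongr
    _ = 4 * (max a b) ^ 2 := by rw [mul_pow]; norm_num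
    _ ≤ 4 * (a ^ 2 + b ^ 2) := by
        gcongr
        rcases max_choice a b with h | h <;> rw [h]
        · exact le_self_add
        · exact le_add_self

/-- The measure `ν` is transversal to the direction `e`, seen from `Ω`: for small `h`, the image
of `ν ⊗ dt` on `0 < t ≤ h` under `(y, t) ↦ y + t e` is bounded by a multiple of the Lebesgue
measure on `Ω`. -/
def IsTransversal (ν : Measure (Space d)) (e : Space d) (Ω : Set (Space d)) (h₀ : ℝ) (C : ℝ≥0) :
    Prop :=
  ∀ h, 0 < h → h < h₀ → ∀ F : Space d → ENNReal, Measurable F →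
    ∫⁻ y, (∫⁻ t in Ioc 0 h, F (y + t • e)) ∂ν ≤ C * ∫⁻ x in Ω, F x

theorem enorm_integral_sq_le {h : ℝ} (hh : 0 ≤ h) {g : ℝ → ℂ} (hg : Continuous g) :
    ‖∫ t in (0)..h, g t‖ₑ ^ 2 ≤ ENNReal.ofReal h * ∫⁻ t in Ioc 0 h, ‖g t‖ₑ ^ 2 := by
  rw [intervalIntegral.integral_of_le hh]
  have h1 : ‖∫ t in Ioc 0 h, g t‖ₑ ≤ ∫⁻ t in Ioc 0 h, ‖g t‖ₑ := enorm_integral_le_lintegral_enorm _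
  have h2 := eLpNorm_le_eLpNorm_mul_rpow_measure_univ (μ := volume.restrict (Ioc 0 h)) (f := g)
    (p := 1) (q := 2) one_le_two hg.aestronglyMeasurable
  rw [eLpNorm_one_eq_lintegral_enorm] at h2
  have e : ((volume.restrict (Ioc 0 h)) univ ^ (1 / (1 : ENNReal).toReal - 1 / (2 : ENNReal).toReal))
      ^ 2 = ENNReal.ofReal h := by
    rw [← ENNReal.rpow_natCast, ← ENNReal.rpow_mul]
    norm_num
  calc _ ≤ (eLpNorm g 2 (volume.restrict (Ioc 0 h)) * _) ^ 2 := pow_le_pow_left' (h1.trans h2) 2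
    _ = _ := by rw [mul_pow, e, eLpNorm_two_sq, mul_comm]

theorem IsTransversal.lintegral_integral_sq_le {ν : Measure (Space d)} {e : Space d}
    {Ω : Set (Space d)} {h₀ : ℝ} {C : ℝ≥0} (hν : IsTransversal ν e Ω h₀ C) {h : ℝ} (h0 : 0 < h)
    (hh : h < h₀) {g : Space d → ℂ} (hg : Continuous g) :
    ∫⁻ y, ‖∫ t in (0)..h, g (y + t • e)‖ₑ ^ 2 ∂ν ≤
      ENNReal.ofReal h * (C * ∫⁻ x in Ω, ‖g x‖ₑ ^ 2) := by
  calc _ ≤ ∫⁻ y, (ENNReal.ofReal h * ∫⁻ t in Ioc 0 h, ‖g (y + t • e)‖ₑ ^ 2) ∂ν :=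
        lintegral_mono fun y => enorm_integral_sq_le h0.le (by fun_prop)
    _ = ENNReal.ofReal h * ∫⁻ y, (∫⁻ t in Ioc 0 h, ‖g (y + t • e)‖ₑ ^ 2) ∂ν :=
        lintegral_const_mul' _ _ ENNReal.ofReal_ne_top
    _ ≤ _ := by
        gcongr
        exact hν h h0 hh (fun x => ‖g x‖ₑ ^ 2) (hg.measurable.enorm.pow_const 2)

/-- The average of `f` over the segment from `y` to `y + h e`. -/
noncomputable def segmentAvg (e : Space d) (h : ℝ) (f : 𝓢(Space d, ℂ)) (y : Space d) : ℂ :=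
  (h⁻¹ : ℝ) • ∫ t in (0)..h, f (y + t • e)

theorem continuous_segmentAvg (e : Space d) (h : ℝ) (f : 𝓢(Space d, ℂ)) :
    Continuous (segmentAvg e h f) := by
  refine Continuous.const_smul (c := h⁻¹) ?_
  refine intervalIntegral.continuous_parametric_intervalIntegral_of_continuous' ?_ 0 h
  have := f.continuous
  fun_prop

/-- The average over the whole segment is the mean of those over its halves, and the halves differ by a
translation. -/
theorem segmentAvg_half_sub (e : Space d) {h : ℝ} (hh : 0 < h) (f : 𝓢(Space d, ℂ)) (y : Space d) :
    segmentAvg e (h / 2) f y - segmentAvg e h f y =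
      (-h⁻¹ : ℝ) • ∫ t in (0)..(h / 2), shiftSub ((h / 2) • e) f (y + t • e) := by
  have hc : Continuous fun t : ℝ => f (y + t • e) := by have := f.continuous; fun_prop
  have h1 : ∫ t in (0)..h, f (y + t • e) = (∫ t in (0)..(h / 2), f (y + t • e)) +
      ∫ t in (0)..(h / 2), f (y + t • e + (h / 2) • e) := by
    rw [← intervalIntegral.integral_add_adjacent_intervals (b := h / 2)
      (hc.intervalIntegrable _ _) (hc.intervalIntegrable _ _)]
    congr 1
    have := intervalIntegral.integral_comp_add_right (a := 0) (b := h / 2)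
      (fun t : ℝ => f (y + t • e)) (h / 2)
    rw [zero_add, add_halves] at this
    rw [← this]
    simp only [add_smul, add_assoc]
  have hc2 : Continuous fun t : ℝ => f (y + t • e + (h / 2) • e) := by
    have := f.continuous; fun_prop
  simp only [segmentAvg, shiftSub_apply]
  rw [intervalIntegral.integral_sub (hc2.intervalIntegrable _ _) (hc.intervalIntegrable _ _), h1]
  simp only [Complex.real_smul]
  push_cast
  have : (h : ℂ) ≠ 0 := by exact_mod_cast hh.ne'
  field_simp
  ring

theorem tendsto_segmentAvg (e : Space d) {h : ℝ} (hh : 0 < h) (f : 𝓢(Space d, ℂ)) (y : Space d) :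
    Tendsto (fun n : ℕ => segmentAvg e (h / 2 ^ n) f y) atTop (𝓝 (f y)) := by
  have hc : Continuous fun t : ℝ => f (y + t • e) := by have := f.continuous; fun_prop
  have h1 := (hc.integral_hasStrictDerivAt 0 0).hasDerivAt
  rw [hasDerivAt_iff_tendsto_slope] at h1
  have h2 : Tendsto (fun n : ℕ => h / 2 ^ n) atTop (𝓝[≠] 0) := by
    refine tendsto_nhdsWithin_iff.2 ⟨?_, Eventually.of_forall fun n =>
      (div_pos hh (pow_pos two_pos n)).ne'⟩
    have := (tendsto_pow_atTop_nhds_zero_of_lt_one (r := (1 / 2 : ℝ)) (by norm_num)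
      (by norm_num)).const_mul h
    rw [mul_zero] at this
    refine this.congr fun n => ?_
    rw [one_div, inv_pow, div_eq_mul_inv]
  have h3 := h1.comp h2
  simp only [zero_smul, add_zero] at h3
  refine h3.congr fun n => ?_
  simp [slope_def_module, segmentAvg]

theorem eLpNorm_le_ofReal_of_sq_le {X E : Type*} [MeasurableSpace X] [NormedAddCommGroup E]
    {f : X → E} {μ : Measure X} {c : ℝ} (hc : 0 ≤ c)
    (h : ∫⁻ x, ‖f x‖ₑ ^ 2 ∂μ ≤ ENNReal.ofReal (c ^ 2)) : eLpNorm f 2 μ ≤ ENNReal.ofReal c := by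
  rw [← eLpNorm_two_sq, ENNReal.ofReal_pow hc] at h
  exact (ENNReal.pow_le_pow_left_iff two_ne_zero).1 h

theorem lintegral_enorm_sq_eq (f : 𝓢(Space d, ℂ)) :
    ∫⁻ x, ‖f x‖ₑ ^ 2 = ENNReal.ofReal (‖f.toLp 2 volume‖ ^ 2) := by
  rw [← eLpNorm_two_sq, SchwartzMap.norm_toLp, ENNReal.ofReal_pow ENNReal.toReal_nonneg,
    ENNReal.ofReal_toReal (f.memLp 2 volume).eLpNorm_ne_top]

section

variable {ν : Measure (Space d)} {e : Space d} {Ω : Set (Space d)} {h₀ : ℝ} {C : ℝ≥0}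
  (hν : IsTransversal ν e Ω h₀ C) (he : ‖e‖ = 1) {s σ : ℝ} (hσ₁ : σ ≤ 1)
  (hσs : σ ≤ s) (hσ : 1 / 2 < σ)

include hν he hσ₁ hσs hσ in
theorem eLpNorm_segmentAvg_half_sub_le {h : ℝ} (h0 : 0 < h) (hh : h < h₀) (f : 𝓢(Space d, ℂ)) :
    eLpNorm (fun y => segmentAvg e (h / 2) f y - segmentAvg e h f y) 2 ν ≤
      ENNReal.ofReal (Real.sqrt C * (2 * (2 * Real.pi) ^ σ) * ‖(bessel s f).toLp 2 volume‖ *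
        h ^ (σ - 1 / 2)) := by
  set B := ‖(bessel s f).toLp 2 volume‖ with hB
  refine eLpNorm_le_ofReal_of_sq_le (by positivity) ?_
  set v : Space d := (h / 2) • e with hv
  have hvn : ‖v‖ = h / 2 := by
    rw [hv, norm_smul, he, mul_one, Real.norm_of_nonneg (by positivity)]
  have h1 := hν.lintegral_integral_sq_le (h := h / 2) (by positivity) (by linarith)
    (shiftSub v f).continuous
  have h2 : ∫⁻ x in Ω, ‖shiftSub v f x‖ₑ ^ 2 ≤
      ENNReal.ofReal ((2 * (2 * Real.pi) ^ σ * (h / 2) ^ σ * B) ^ 2) := by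
    refine (setLIntegral_le_lintegral _ _).trans ?_
    rw [lintegral_enorm_sq_eq]
    refine ENNReal.ofReal_le_ofReal (pow_le_pow_left₀ (norm_nonneg _) ?_ 2)
    rw [← hvn]
    exact norm_shiftSub_le (by linarith) hσ₁ hσs v f
  simp_rw [segmentAvg_half_sub e h0 f, enorm_smul]
  simp only [mul_pow ‖-h⁻¹‖ₑ]
  rw [lintegral_const_mul' _ _ (by simp), ← hv]
  have e1 : ‖(-h⁻¹ : ℝ)‖ₑ ^ 2 = ENNReal.ofReal (h⁻¹ ^ 2) := by
    rw [enorm_neg, ← ofReal_norm, Real.norm_of_nonneg (by positivity),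
      ENNReal.ofReal_pow (by positivity)]
  have e2 : (C : ENNReal) = ENNReal.ofReal (C : ℝ) := (ENNReal.ofReal_coe_nnreal).symm
  calc _ ≤ ENNReal.ofReal (h⁻¹ ^ 2) * (ENNReal.ofReal (h / 2) * (ENNReal.ofReal C *
        ENNReal.ofReal ((2 * (2 * Real.pi) ^ σ * (h / 2) ^ σ * B) ^ 2))) := by
        rw [e1, ← e2]
        gcongr
        exact h1.trans (by gcongr)
    _ = ENNReal.ofReal (h⁻¹ ^ 2 * (h / 2 * (C *
        (2 * (2 * Real.pi) ^ σ * (h / 2) ^ σ * B) ^ 2))) := by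
        rw [← ENNReal.ofReal_mul (by positivity), ← ENNReal.ofReal_mul (by positivity),
          ← ENNReal.ofReal_mul (by positivity)]
    _ ≤ _ := by
        refine ENNReal.ofReal_le_ofReal ?_
        have e3 : (h ^ (σ - 1 / 2)) ^ 2 = h⁻¹ * (h ^ σ) ^ 2 := by
          rw [Real.rpow_sub h0, ← Real.sqrt_eq_rpow, div_pow, Real.sq_sqrt h0.le]
          field_simp
        have e4 : (h / 2) ^ σ ≤ h ^ σ := Real.rpow_le_rpow (by positivity) (by linarith) (by linarith)
        have e5 : (Real.sqrt C * (2 * (2 * Real.pi) ^ σ) * B * h ^ (σ - 1 / 2)) ^ 2 =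
            C * (2 * (2 * Real.pi) ^ σ) ^ 2 * B ^ 2 * (h⁻¹ * (h ^ σ) ^ 2) := by
          rw [mul_pow, mul_pow _ B, mul_pow (Real.sqrt C), Real.sq_sqrt C.coe_nonneg, e3]
        rw [e5]
        calc h⁻¹ ^ 2 * (h / 2 * (C * (2 * (2 * Real.pi) ^ σ * (h / 2) ^ σ * B) ^ 2))
            ≤ h⁻¹ ^ 2 * (h * (C * (2 * (2 * Real.pi) ^ σ * h ^ σ * B) ^ 2)) := by
              gcongr; linarith
          _ = _ := by field_simp

include hν in
theorem eLpNorm_segmentAvg_le {h : ℝ} (h0 : 0 < h) (hh : h < h₀) (f : 𝓢(Space d, ℂ)) :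
    eLpNorm (segmentAvg e h f) 2 ν ^ 2 ≤
      C * ENNReal.ofReal h⁻¹ * ∫⁻ x in Ω, ‖f x‖ₑ ^ 2 := by
  rw [eLpNorm_two_sq]
  simp_rw [segmentAvg, enorm_smul, mul_pow]
  rw [lintegral_const_mul' _ _ (by simp)]
  have e1 : ‖(h⁻¹ : ℝ)‖ₑ ^ 2 = ENNReal.ofReal (h⁻¹ ^ 2) := by
    rw [← ofReal_norm, Real.norm_of_nonneg (by positivity), ENNReal.ofReal_pow (by positivity)]
  rw [e1]
  calc _ ≤ ENNReal.ofReal (h⁻¹ ^ 2) * (ENNReal.ofReal h * (C * ∫⁻ x in Ω, ‖f x‖ₑ ^ 2)) := by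
        gcongr; exact hν.lintegral_integral_sq_le h0 hh f.continuous
    _ = C * (ENNReal.ofReal (h⁻¹ ^ 2) * ENNReal.ofReal h) * ∫⁻ x in Ω, ‖f x‖ₑ ^ 2 := by ring
    _ = _ := by
        rw [← ENNReal.ofReal_mul (by positivity)]
        congr 3; field_simp

include hν he hσ₁ hσs hσ in
/-- The local trace inequality. The function is written as its average over segments of length `h`
plus the telescoping series of the differences of the averages over segments of length `h / 2 ^ k`;
the latter are averages of the differences `f(· + v) - f` with `‖v‖ = h / 2 ^ (k + 1)`. -/
theorem IsTransversal.lintegral_sq_le {h : ℝ} (h0 : 0 < h) (hh : h < h₀) (f : 𝓢(Space d, ℂ)) :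
    ∫⁻ y, ‖f y‖ₑ ^ 2 ∂ν ≤
      4 * (C * ENNReal.ofReal h⁻¹ * (∫⁻ x in Ω, ‖f x‖ₑ ^ 2) +
        ENNReal.ofReal (Real.sqrt C * (2 * (2 * Real.pi) ^ σ) * ‖(bessel s f).toLp 2 volume‖ *
          (h ^ (σ - 1 / 2) * (1 - (1 / 2) ^ (σ - 1 / 2))⁻¹)) ^ 2) := by
  set B := ‖(bessel s f).toLp 2 volume‖ with hB
  set τ := σ - 1 / 2 with hτ
  have hτ0 : 0 < τ := by rw [hτ]; linarith
  set M := Real.sqrt C * (2 * (2 * Real.pi) ^ σ) * B with hM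
  have hM0 : 0 ≤ M := by positivity
  set q : ℝ := (1 / 2) ^ τ with hq
  have hq0 : 0 ≤ q := by positivity
  have hq1 : q < 1 := Real.rpow_lt_one (by norm_num) (by norm_num) hτ0
  have hstep : ∀ n : ℕ, eLpNorm (segmentAvg e (h / 2 ^ n) f) 2 ν ≤
      eLpNorm (segmentAvg e h f) 2 ν +
        ENNReal.ofReal (M * (h ^ τ * ∑ k ∈ Finset.range n, q ^ k)) := by
    intro n
    induction n with
    | zero => simp
    | succ n ih =>
      have hn : h / 2 ^ n ≤ h := div_le_self h0.le (one_le_pow₀ one_le_two)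
      have h1 := eLpNorm_segmentAvg_half_sub_le hν he hσ₁ hσs hσ (h := h / 2 ^ n) (by positivity)
        (hn.trans_lt hh) f
      have e1 : h / 2 ^ n / 2 = h / 2 ^ (n + 1) := by rw [pow_succ]; field_simp
      have e2 : (h / 2 ^ n) ^ τ = h ^ τ * q ^ n := by
        rw [Real.div_rpow h0.le (by positivity), hq, ← Real.rpow_natCast, ← Real.rpow_mul (by norm_num),
          ← Real.rpow_natCast, ← Real.rpow_mul (by norm_num), one_div,
          Real.inv_rpow (by norm_num), div_eq_mul_inv, mul_comm τ]
      rw [e1, ← hτ, e2, ← hB, ← hM] at h1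
      have h2 : eLpNorm (segmentAvg e (h / 2 ^ (n + 1)) f) 2 ν ≤
          eLpNorm (segmentAvg e (h / 2 ^ n) f) 2 ν +
          eLpNorm (fun y => segmentAvg e (h / 2 ^ (n + 1)) f y - segmentAvg e (h / 2 ^ n) f y) 2 ν := by
        refine le_trans (le_of_eq ?_) (eLpNorm_add_le
          (continuous_segmentAvg e _ f).aestronglyMeasurable
          ((continuous_segmentAvg e _ f).sub (continuous_segmentAvg e _ f)).aestronglyMeasurable
          one_le_two)
        congr 1
        ext y
        simp
      refine h2.trans ((add_le_add ih h1).trans (le_of_eq ?_))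
      rw [add_assoc, ← ENNReal.ofReal_add (by positivity) (by positivity), Finset.sum_range_succ]
      congr 2; ring
  have hlim : eLpNorm f 2 ν ≤ eLpNorm (segmentAvg e h f) 2 ν +
      ENNReal.ofReal (M * (h ^ τ * (1 - q)⁻¹)) := by
    refine (Lp.eLpNorm_lim_le_liminf_eLpNorm
      (fun n => (continuous_segmentAvg e (h / 2 ^ n) f).aestronglyMeasurable) f
      (Eventually.of_forall fun y => tendsto_segmentAvg e h0 f y)).trans ?_
    refine liminf_le_of_frequently_le' (Eventually.frequently (Eventually.of_forall fun n => ?_))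
    refine (hstep n).trans ?_
    gcongr
    rw [← tsum_geometric_of_lt_one hq0 hq1]
    exact (summable_geometric_of_lt_one hq0 hq1).sum_le_tsum _ fun k _ => by positivity
  rw [← eLpNorm_two_sq]
  refine (pow_le_pow_left' hlim 2).trans ((add_sq_le_four_mul _ _).trans ?_)
  gcongr
  exact eLpNorm_segmentAvg_le hν h0 hh f

end

end Wentzell

/-! ### The surface measure of a Lipschitz domain -/

namespace Wentzell

variable {d : ℕ}

section Chart

variable (e : Space d)

/-- The decomposition `ℝ^d = e^⊥ × ℝ e`. -/
noncomputable def orthogonalSplit (he : ‖e‖ = 1) : ((ℝ ∙ e)ᗮ × ℝ) ≃L[ℝ] Space d :=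
  LinearEquiv.toContinuousLinearEquiv
    { toFun := fun p => (p.1 : Space d) + p.2 • e
      map_add' := fun p q => by
        simp only [Prod.fst_add, Prod.snd_add, Submodule.coe_add, add_smul]; abel
      map_smul' := fun c p => by
        simp only [Prod.smul_fst, Prod.smul_snd, Submodule.coe_smul, smul_eq_mul, mul_smul,
          RingHom.id_apply, smul_add]
      invFun := fun y => (⟨y - (inner ℝ e y : ℝ) • e, by
        rw [Submodule.mem_orthogonal_singleton_iff_inner_right, inner_sub_right, inner_smul_right,
          real_inner_self_eq_norm_sq, he]; ring⟩, inner ℝ e y)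
      left_inv := fun p => by
        have h1 : inner ℝ e (p.1 : Space d) = 0 :=
          Submodule.mem_orthogonal_singleton_iff_inner_right.1 p.1.2
        have h2 : inner ℝ e ((p.1 : Space d) + p.2 • e) = p.2 := by
          rw [inner_add_right, inner_smul_right, real_inner_self_eq_norm_sq, he, h1]; ring
        refine Prod.ext (Subtype.ext ?_) h2
        simp only [h2]
        abel
      right_inv := fun y => by simp }

/-- Fubini's theorem for `ℝ^d = e^⊥ × ℝ e`, up to a constant that comes from the uniqueness of Haar
measure. -/
theorem exists_lintegral_orthogonal_le (he : ‖e‖ = 1) : ∃ c : ℝ≥0, ∀ F : Space d → ENNReal,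
    Measurable F →
      ∫⁻ w : (ℝ ∙ e)ᗮ, (∫⁻ t : ℝ, F ((w : Space d) + t • e)) = c * ∫⁻ x, F x := by
  let L := orthogonalSplit e he
  have := L.isAddHaarMeasure_map (volume.prod volume)
  refine ⟨(Measure.map L (volume.prod volume)).addHaarScalarFactor volume, fun F hF => ?_⟩
  have h1 := Measure.isAddLeftInvariant_eq_smul (Measure.map L (volume.prod volume)) volume
  have hL : Measurable L := L.continuous.measurable
  have h2 : ∫⁻ x, F x ∂(Measure.map L (volume.prod volume)) =
      ∫⁻ w : (ℝ ∙ e)ᗮ, (∫⁻ t : ℝ, F ((w : Space d) + t • e)) := by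
    rw [lintegral_map hF hL, lintegral_prod (fun p => F (L p)) (hF.comp hL).aemeasurable]
    rfl
  rw [← h2]
  conv_lhs => rw [h1]
  rw [lintegral_smul_measure]
  rfl

variable {e} {φ : Space d → ℝ} {K : ℝ≥0}

theorem lipschitzWith_graph (he : ‖e‖ = 1) (hφ : LipschitzWith K φ) :
    LipschitzWith (1 + K) (fun w : (ℝ ∙ e)ᗮ => (w : Space d) + φ w • e) := by
  refine LipschitzWith.add (LipschitzWith.subtype_val _) ?_
  refine LipschitzWith.of_dist_le_mul fun w w' => ?_
  rw [dist_eq_norm, ← sub_smul, norm_smul, he, mul_one, ← dist_eq_norm]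
  exact hφ.dist_le_mul w w'

/-- On a Lipschitz graph, the surface measure is bounded by a multiple of the Lebesgue measure of
the parameter domain. -/
theorem hausdorff_restrict_graph_le (hd : 1 ≤ d) (he : ‖e‖ = 1) (hφ : LipschitzWith K φ)
    {S : Set (Space d)} (hS : MeasurableSet S)
    (hSφ : ∀ y ∈ S, φ (y - (inner ℝ e y : ℝ) • e) = inner ℝ e y) :
    (μHE[d - 1]).restrict S ≤ ((1 + K) ^ (d - 1) : ℝ≥0) •
      (Measure.map (fun w : (ℝ ∙ e)ᗮ => (w : Space d) + φ w • e) volume).restrict S := by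
  set g : (ℝ ∙ e)ᗮ → Space d := fun w => (w : Space d) + φ w • e with hg
  have hgL : LipschitzWith (1 + K) g := lipschitzWith_graph he hφ
  have hgm : Measurable g := hgL.continuous.measurable
  have hfact : Fact (Module.finrank ℝ (Space d) = (d - 1) + 1) :=
    ⟨by rw [finrank_euclideanSpace_fin]; omega⟩
  have he0 : e ≠ 0 := by rintro rfl; simp at he
  have hdim : Module.finrank ℝ (ℝ ∙ e)ᗮ = d - 1 := Submodule.finrank_orthogonal_span_singleton he0
  have hvol : (μHE[d - 1] : Measure (ℝ ∙ e)ᗮ) = volume := by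
    rw [← InnerProductSpace.euclideanHausdorffMeasure_eq_volume, hdim]
  have himage : ∀ s : Set (ℝ ∙ e)ᗮ,
      μHE[d - 1] (g '' s) ≤ ((1 + K) ^ (d - 1) : ℝ≥0) * μHE[d - 1] s := fun s => by
    rw [Measure.euclideanHausdorffMeasure_def, Measure.euclideanHausdorffMeasure_def,
      Measure.smul_apply, Measure.smul_apply, ENNReal.smul_def, ENNReal.smul_def, smul_eq_mul,
      smul_eq_mul, mul_left_comm]
    gcongr
    have := hgL.hausdorffMeasure_image_le (d := ((d - 1 : ℕ) : ℝ)) (by positivity) s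
    refine this.trans (le_of_eq ?_)
    rw [ENNReal.rpow_natCast]; norm_cast
  refine Measure.le_iff.2 fun A hA => ?_
  rw [Measure.restrict_apply hA, Measure.smul_apply, Measure.restrict_apply hA,
    Measure.map_apply hgm (hA.inter hS), ENNReal.smul_def, smul_eq_mul, ← hvol]
  refine le_trans (measure_mono ?_) (himage _)
  rintro y ⟨hyA, hyS⟩
  have hw : y - (inner ℝ e y : ℝ) • e ∈ (ℝ ∙ e)ᗮ := ((orthogonalSplit e he).symm y).1.2
  have hgy : g ⟨y - (inner ℝ e y : ℝ) • e, hw⟩ = y := by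
    rw [hg]; simp only [hSφ y hyS]; abel
  refine ⟨⟨y - (inner ℝ e y : ℝ) • e, hw⟩, ?_, hgy⟩
  rw [mem_preimage, hgy]
  exact ⟨hyA, hyS⟩

/-- Near a boundary point of a Lipschitz domain, the surface measure is transversal to the
direction over which the boundary is a graph. -/
theorem isTransversal_of_chart (hd : 1 ≤ d) {Ω : Set (Space d)} (hΩ : IsOpen Ω) (he : ‖e‖ = 1)
    (hφ : LipschitzWith K φ) {x : Space d} {r : ℝ} (hr : 0 < r)
    (hchart : ∀ y ∈ Metric.ball x r,
      (y ∈ Ω ↔ φ (y - (inner ℝ e y : ℝ) • e) < (inner ℝ e y : ℝ))) :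
    ∃ C : ℝ≥0, IsTransversal ((μHE[d - 1]).restrict (frontier Ω ∩ Metric.ball x (r / 2))) e Ω
      (r / 2) C := by
  set S : Set (Space d) := frontier Ω ∩ Metric.ball x (r / 2) with hS
  have hSm : MeasurableSet S := isClosed_frontier.measurableSet.inter Metric.isOpen_ball.measurableSet
  have hSφ : ∀ y ∈ S, φ (y - (inner ℝ e y : ℝ) • e) = inner ℝ e y := by
    rintro y ⟨hyf, hyb⟩
    have hyr : y ∈ Metric.ball x r := Metric.ball_subset_ball (by linarith) hyb
    refine le_antisymm ?_ ?_
    · -- `y` is a limit of points of `Ω`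
      have h1 : (closure (Ω ∩ Metric.ball x r)) ⊆
          {z | φ (z - (inner ℝ e z : ℝ) • e) ≤ (inner ℝ e z : ℝ)} := by
        refine closure_minimal (fun z hz => ((hchart z hz.2).1 hz.1).le) ?_
        have := hφ.continuous
        exact isClosed_le (by fun_prop) (by fun_prop)
      refine h1 ?_
      rw [inter_comm]
      exact Metric.isOpen_ball.inter_closure ⟨hyr, frontier_subset_closure hyf⟩
    · have hy : y ∉ Ω := by
        rw [hΩ.frontier_eq] at hyf; exact hyf.2
      exact not_lt.1 fun hc => hy ((hchart y hyr).2 hc)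
  obtain ⟨c, hc⟩ := exists_lintegral_orthogonal_le e he
  set g : (ℝ ∙ e)ᗮ → Space d := fun w => (w : Space d) + φ w • e with hg
  have hgm : Measurable g := (lipschitzWith_graph he hφ).continuous.measurable
  refine ⟨(1 + K) ^ (d - 1) * c, fun h h0 hh F hF => ?_⟩
  set F' : Space d → ENNReal := Ω.indicator F with hF'
  have hF'm : Measurable F' := hF.indicator hΩ.measurableSet
  have hin : ∀ y ∈ S, ∫⁻ t in Ioc 0 h, F (y + t • e) = ∫⁻ t in Ioc 0 h, F' (y + t • e) := by
    intro y hy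
    refine setLIntegral_congr_fun measurableSet_Ioc fun t ht => ?_
    have hball : y + t • e ∈ Metric.ball x r := by
      rw [Metric.mem_ball]
      calc dist (y + t • e) x ≤ dist (y + t • e) y + dist y x := dist_triangle _ _ _
        _ < r / 2 + r / 2 := by
            refine add_lt_add ?_ hy.2
            rw [dist_eq_norm, add_sub_cancel_left, norm_smul, he, mul_one,
              Real.norm_of_nonneg ht.1.le]
            exact ht.2.trans_lt hh
        _ = r := add_halves r
    have hinner : (inner ℝ e (y + t • e) : ℝ) = inner ℝ e y + t := by
      rw [inner_add_right, inner_smul_right, real_inner_self_eq_norm_sq, he]; ring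
    have hΩt : y + t • e ∈ Ω := by
      rw [hchart _ hball, hinner]
      have : y + t • e - (inner ℝ e y + t : ℝ) • e = y - (inner ℝ e y : ℝ) • e := by
        rw [add_smul]; abel
      rw [this, hSφ y hy]
      linarith [ht.1]
    exact (indicator_of_mem hΩt F).symm
  have hmeas : Measurable fun y => ∫⁻ t in Ioc 0 h, F' (y + t • e) := by
    refine Measurable.lintegral_prod_right' (f := fun p : Space d × ℝ => F' (p.1 + p.2 • e)) ?_
    exact hF'm.comp (by fun_prop)
  calc ∫⁻ y in S, (∫⁻ t in Ioc 0 h, F (y + t • e)) ∂μHE[d - 1]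
      = ∫⁻ y in S, (∫⁻ t in Ioc 0 h, F' (y + t • e)) ∂μHE[d - 1] :=
        setLIntegral_congr_fun hSm hin
    _ ≤ ∫⁻ y, (∫⁻ t in Ioc 0 h, F' (y + t • e)) ∂(((1 + K) ^ (d - 1) : ℝ≥0) •
        Measure.map g volume) := by
        refine lintegral_mono' ?_ le_rfl
        refine (hausdorff_restrict_graph_le hd he hφ hSm hSφ).trans ?_
        refine Measure.le_iff.2 fun A _ => ?_
        rw [Measure.smul_apply, Measure.smul_apply, ENNReal.smul_def, ENNReal.smul_def, smul_eq_mul,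
          smul_eq_mul]
        gcongr
        exact Measure.restrict_le_self
    _ = ((1 + K) ^ (d - 1) : ℝ≥0) * ∫⁻ w, (∫⁻ t in Ioc 0 h, F' (g w + t • e)) := by
        rw [lintegral_smul_measure, lintegral_map hmeas hgm]; rfl
    _ ≤ ((1 + K) ^ (d - 1) : ℝ≥0) * ∫⁻ w : (ℝ ∙ e)ᗮ, (∫⁻ t : ℝ, F' ((w : Space d) + t • e)) := by
        refine mul_le_mul_right (lintegral_mono fun w => ?_) _
        refine (setLIntegral_le_lintegral _ _).trans (le_of_eq ?_)
        rw [← lintegral_add_right_eq_self (fun t : ℝ => F' ((w : Space d) + t • e)) (φ w)]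
        refine lintegral_congr fun t => ?_
        rw [hg]
        congr 1
        simp only [add_smul]; abel
    _ = (((1 + K) ^ (d - 1) * c : ℝ≥0) : ENNReal) * ∫⁻ x in Ω, F x := by
        rw [hc F' hF'm, hF', lintegral_indicator hΩ.measurableSet, ENNReal.coe_mul, mul_assoc]

end Chart

/-- The mass of `ν` is controlled by the volume of the region it sweeps out. -/
theorem IsTransversal.measure_univ_lt_top {ν : Measure (Space d)} {e : Space d} {Ω : Set (Space d)}
    {h₀ : ℝ} {C : ℝ≥0} (hν : IsTransversal ν e Ω h₀ C) (h0 : 0 < h₀) (hΩ : volume Ω < ⊤) :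
    ν univ < ⊤ := by
  have h1 := hν (h₀ / 2) (by positivity) (by linarith) (fun _ => 1) measurable_const
  simp only [lintegral_const, one_mul, Measure.restrict_apply_univ, Real.volume_Ioc, sub_zero] at h1
  by_contra hc
  rw [not_lt, top_le_iff] at hc
  rw [hc, ENNReal.mul_top (by simpa using h0)] at h1
  exact absurd h1 (not_le.2 (ENNReal.mul_lt_top ENNReal.coe_lt_top hΩ))

/-- A property of compact parts of the boundary which holds for charts and finite unions holds for
the boundary. -/
theorem IsBoundedLipschitzDomain.frontier_induction (hd : 1 ≤ d) {Ω : Set (Space d)}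
    (hΩ : IsBoundedLipschitzDomain Ω) {P : Set (Space d) → Prop} (hempty : P ∅)
    (hmono : ∀ ⦃s t : Set (Space d)⦄, s ⊆ t → P t → P s)
    (hunion : ∀ ⦃s t : Set (Space d)⦄, P s → P t → P (s ∪ t))
    (hloc : ∀ (s : Set (Space d)) (e : Space d) (h₀ : ℝ) (C : ℝ≥0), ‖e‖ = 1 → 0 < h₀ →
      IsTransversal ((μHE[d - 1]).restrict s) e Ω h₀ C → P s) : P (frontier Ω) := by
  have hcompact : IsCompact (frontier Ω) :=
    Metric.isCompact_of_isClosed_isBounded isClosed_frontier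
      (hΩ.isBounded.closure.subset frontier_subset_closure)
  refine hcompact.induction_on hempty hmono hunion fun x hx => ?_
  obtain ⟨e, he, K, φ, hφ, r, hr, hchart⟩ := hΩ.lipschitz x hx
  obtain ⟨C, hC⟩ := isTransversal_of_chart hd hΩ.isOpen he hφ hr hchart
  refine ⟨_, ?_, hloc _ e (r / 2) C he (by positivity) hC⟩
  exact inter_mem_nhdsWithin _ (Metric.ball_mem_nhds x (by positivity))

theorem IsBoundedLipschitzDomain.isFiniteMeasure_surfaceMeasure (hd : 1 ≤ d) {Ω : Set (Space d)}
    (hΩ : IsBoundedLipschitzDomain Ω) : IsFiniteMeasure (surfaceMeasure Ω) := by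
  have h : (μHE[d - 1] : Measure (Space d)) (frontier Ω) < ⊤ := by
    refine hΩ.frontier_induction hd (P := fun s => (μHE[d - 1] : Measure (Space d)) s < ⊤) ?_ ?_ ?_ ?_
    · simp
    · exact fun s t hst ht => (measure_mono hst).trans_lt ht
    · exact fun s t hs ht => (measure_union_le s t).trans_lt (ENNReal.add_lt_top.2 ⟨hs, ht⟩)
    · intro s e h₀ C _ h0 hC
      have := hC.measure_univ_lt_top h0 hΩ.isBounded.measure_lt_top
      rwa [Measure.restrict_apply_univ] at this
  exact ⟨by rwa [surfaceMeasure, Measure.restrict_apply_univ]⟩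

/-- The trace inequality for smooth functions, with a free parameter `h` that makes the coefficient of
the norm of `H^s(ℝ^d)` small; only the values on `Ω` enter the other term. -/
theorem IsBoundedLipschitzDomain.exists_trace_inequality (hd : 1 ≤ d) {Ω : Set (Space d)}
    (hΩ : IsBoundedLipschitzDomain Ω) {s : ℝ} (hs : 1 / 2 < s) :
    ∃ (D h₀ τ : ℝ), 0 ≤ D ∧ 0 < h₀ ∧ 0 < τ ∧ ∀ h, 0 < h → h < h₀ → ∀ f : 𝓢(Space d, ℂ),
      eLpNorm f 2 (surfaceMeasure Ω) ^ 2 ≤ ENNReal.ofReal (D *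
        (h⁻¹ * ‖smoothL2 Ω f‖ ^ 2 + h ^ τ * ‖(bessel s f).toLp 2 volume‖ ^ 2)) := by
  -- translation differences gain at most one order of smoothness
  set σ := min s 1 with hσ
  have hσ2 : 1 / 2 < σ := lt_min hs (by norm_num)
  have hσs : σ ≤ s := min_le_left _ _
  have hσ1 : σ ≤ 1 := min_le_right _ _
  suffices H : ∃ (D h₀ : ℝ), 0 ≤ D ∧ 0 < h₀ ∧ ∀ h, 0 < h → h < h₀ → ∀ f : 𝓢(Space d, ℂ),
      ∫⁻ x in frontier Ω, ‖f x‖ₑ ^ 2 ∂μHE[d - 1] ≤ ENNReal.ofReal (D *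
        (h⁻¹ * ‖smoothL2 Ω f‖ ^ 2 +
          (h ^ (σ - 1 / 2)) ^ 2 * ‖(bessel s f).toLp 2 volume‖ ^ 2)) by
    obtain ⟨D, h₀, hD, hh₀, H⟩ := H
    refine ⟨D, h₀, (σ - 1 / 2) * 2, hD, hh₀, by linarith, fun h h0 hh f => ?_⟩
    rw [eLpNorm_two_sq, surfaceMeasure]
    have e1 : h ^ ((σ - 1 / 2) * 2) = (h ^ (σ - 1 / 2)) ^ 2 := by
      rw [← Real.rpow_natCast (h ^ _), ← Real.rpow_mul h0.le]; norm_num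
    rw [e1]
    exact H h h0 hh f
  refine hΩ.frontier_induction hd (P := fun S => ∃ (D h₀ : ℝ), 0 ≤ D ∧ 0 < h₀ ∧ ∀ h, 0 < h →
    h < h₀ → ∀ f : 𝓢(Space d, ℂ), ∫⁻ x in S, ‖f x‖ₑ ^ 2 ∂μHE[d - 1] ≤ ENNReal.ofReal (D *
        (h⁻¹ * ‖smoothL2 Ω f‖ ^ 2 +
          (h ^ (σ - 1 / 2)) ^ 2 * ‖(bessel s f).toLp 2 volume‖ ^ 2))) ?_ ?_ ?_ ?_
  · exact ⟨0, 1, le_rfl, one_pos, fun h _ _ f => by simp⟩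
  · rintro S T hST ⟨D, h₀, hD, hh₀, H⟩
    exact ⟨D, h₀, hD, hh₀, fun h h0 hh f => (lintegral_mono_set hST).trans (H h h0 hh f)⟩
  · rintro S T ⟨D, h₀, hD, hh₀, H⟩ ⟨D', h₀', hD', hh₀', H'⟩
    refine ⟨D + D', min h₀ h₀', by positivity, lt_min hh₀ hh₀', fun h h0 hh f => ?_⟩
    refine (lintegral_union_le _ _ _).trans ((add_le_add
      (H h h0 (hh.trans_le (min_le_left _ _)) f)
      (H' h h0 (hh.trans_le (min_le_right _ _)) f)).trans (le_of_eq ?_))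
    rw [← ENNReal.ofReal_add (by positivity) (by positivity), add_mul]
  · intro S e h₀ C he hh₀ hC
    set Q : ℝ := (2 * (2 * Real.pi) ^ σ * (1 - (1 / 2) ^ (σ - 1 / 2))⁻¹) ^ 2 with hQ
    refine ⟨4 * C * max 1 Q, h₀, by positivity, hh₀, fun h h0 hh f => ?_⟩
    refine (hC.lintegral_sq_le he hσ1 hσs hσ2 h0 hh f).trans ?_
    have hq : (1 / 2 : ℝ) ^ (σ - 1 / 2) < 1 :=
      Real.rpow_lt_one (by norm_num) (by norm_num) (by linarith)
    have hΩf : ∫⁻ x in Ω, ‖f x‖ₑ ^ 2 = ENNReal.ofReal (‖smoothL2 Ω f‖ ^ 2) := by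
      have e1 : smoothL2 Ω f =ᵐ[volume.restrict Ω] f := by
        refine (LpToLpRestrictCLM_coeFn ℂ Ω (f.toLp 2 volume)).trans ?_
        exact ae_restrict_of_ae (f.coeFn_toLp 2 volume)
      rw [← eLpNorm_two_sq, Lp.norm_def, ENNReal.ofReal_pow ENNReal.toReal_nonneg,
        ENNReal.ofReal_toReal (Lp.eLpNorm_ne_top _), eLpNorm_congr_ae e1]
    have hC' : (C : ENNReal) = ENNReal.ofReal (C : ℝ) := (ENNReal.ofReal_coe_nnreal).symm
    have h4 : (4 : ENNReal) = ENNReal.ofReal 4 := by simp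
    have hpos : 0 ≤ (1 - (1 / 2 : ℝ) ^ (σ - 1 / 2))⁻¹ := inv_nonneg.2 (by linarith)
    rw [hΩf, hC', h4, ← ENNReal.ofReal_pow (by positivity), ← ENNReal.ofReal_mul (by positivity),
      ← ENNReal.ofReal_mul (by positivity), ← ENNReal.ofReal_add (by positivity) (by positivity),
      ← ENNReal.ofReal_mul (by positivity)]
    refine ENNReal.ofReal_le_ofReal ?_
    have e5 : (Real.sqrt C * (2 * (2 * Real.pi) ^ σ) * ‖(bessel s f).toLp 2 volume‖ *
        (h ^ (σ - 1 / 2) * (1 - (1 / 2) ^ (σ - 1 / 2))⁻¹)) ^ 2 =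
        C * Q * ((h ^ (σ - 1 / 2)) ^ 2 * ‖(bessel s f).toLp 2 volume‖ ^ 2) := by
      rw [hQ]
      simp only [mul_pow, Real.sq_sqrt C.coe_nonneg]
      ring
    rw [e5]
    have a1 : C * h⁻¹ * ‖smoothL2 Ω f‖ ^ 2 ≤ C * max 1 Q * (h⁻¹ * ‖smoothL2 Ω f‖ ^ 2) := by
      have : (C : ℝ) ≤ C * max 1 Q := le_mul_of_one_le_right C.coe_nonneg (le_max_left _ _)
      rw [mul_assoc]
      gcongr
    have a2 : C * Q * ((h ^ (σ - 1 / 2)) ^ 2 * ‖(bessel s f).toLp 2 volume‖ ^ 2) ≤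
        C * max 1 Q * ((h ^ (σ - 1 / 2)) ^ 2 * ‖(bessel s f).toLp 2 volume‖ ^ 2) := by
      gcongr
      exact le_max_right _ _
    linarith

end Wentzell

/-! ### The Dirichlet trace -/

namespace Wentzell

variable {d : ℕ} {Ω : Set (Space d)}

theorem toLp_sub (f g : 𝓢(Space d, ℂ)) (μ : Measure (Space d)) [μ.HasTemperateGrowth] :
    (f - g).toLp 2 μ = f.toLp 2 μ - g.toLp 2 μ :=
  map_sub (SchwartzMap.toLpCLM ℂ ℂ 2 μ) f g

theorem smoothL2_sub (f g : 𝓢(Space d, ℂ)) : smoothL2 Ω (f - g) = smoothL2 Ω f - smoothL2 Ω g := by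
  rw [smoothL2, toLp_sub, map_sub]; rfl

theorem norm_restrictL2_le (U : Lp ℂ 2 (volume : Measure (Space d))) : ‖restrictL2 Ω U‖ ≤ ‖U‖ :=
  norm_Lp_toLp_restrict_le Ω U

theorem IsSobolevLift.sub {s : ℝ} {U G U' G' : Lp ℂ 2 (volume : Measure (Space d))}
    (h : IsSobolevLift s U G) (h' : IsSobolevLift s U' G') :
    IsSobolevLift s (U - U') (G - G') := by
  have := h.add (h'.smul (-1))
  rwa [neg_one_smul, neg_one_smul, ← sub_eq_add_neg, ← sub_eq_add_neg] at this

/-- In the bound by `h⁻¹ a + h ^ τ m` with `a → 0` and `m` bounded, `n → ∞` comes first and `h → 0`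
second. -/
theorem tendsto_zero_of_interpolation {x a m : ℕ → ℝ} {D h₀ τ M : ℝ} (hx : ∀ n, 0 ≤ x n)
    (hD : 0 ≤ D) (hh₀ : 0 < h₀) (hτ : 0 < τ) (ha : Tendsto a atTop (𝓝 0)) (hm : Tendsto m atTop (𝓝 M))
    (h : ∀ h, 0 < h → h < h₀ → ∀ n, x n ≤ D * (h⁻¹ * a n + h ^ τ * m n)) :
    Tendsto x atTop (𝓝 0) := by
  rw [Metric.tendsto_atTop']
  intro ε hε
  have h1 : Tendsto (fun h : ℝ => D * (h ^ τ * (|M| + 1))) (𝓝[>] 0) (𝓝 0) := by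
    have : Continuous fun h : ℝ => h ^ τ := Real.continuous_rpow_const hτ.le
    have h2 : Continuous fun h : ℝ => D * (h ^ τ * (|M| + 1)) := by fun_prop
    have h3 := h2.tendsto 0
    rw [Real.zero_rpow hτ.ne', zero_mul, mul_zero] at h3
    exact h3.mono_left nhdsWithin_le_nhds
  have h2 : ∀ᶠ h in 𝓝[>] (0 : ℝ), h < h₀ := mem_nhdsWithin_of_mem_nhds (Iio_mem_nhds hh₀)
  obtain ⟨k, hk1, hk2, hk0⟩ := ((h1.eventually_lt_const (half_pos hε)).and
    (h2.and self_mem_nhdsWithin)).exists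
  have hk0 : 0 < k := hk0
  have h3 : Tendsto (fun n => D * (k⁻¹ * a n)) atTop (𝓝 0) := by
    have := (ha.const_mul k⁻¹).const_mul D
    rwa [mul_zero, mul_zero] at this
  have h4 : ∀ᶠ n in atTop, m n < |M| + 1 :=
    hm.eventually_lt_const (lt_of_le_of_lt (le_abs_self M) (lt_add_one _))
  obtain ⟨N, hN⟩ := eventually_atTop.1 ((h3.eventually_lt_const (half_pos hε)).and h4)
  refine ⟨N, fun n hn => ?_⟩
  obtain ⟨h5, h6⟩ := hN n hn.le
  rw [Real.dist_eq, sub_zero, abs_of_nonneg (hx n)]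
  have h7 : D * (k ^ τ * m n) ≤ D * (k ^ τ * (|M| + 1)) := by gcongr
  have h8 := h k hk0 hk2 n
  rw [mul_add] at h8
  linarith

section Trace

variable [IsFiniteMeasure (surfaceMeasure Ω)] {s : ℝ}

theorem norm_toLp_surface_sq_le {f : 𝓢(Space d, ℂ)} {c : ℝ} (hc : 0 ≤ c)
    (h : eLpNorm f 2 (surfaceMeasure Ω) ^ 2 ≤ ENNReal.ofReal c) :
    ‖f.toLp 2 (surfaceMeasure Ω)‖ ^ 2 ≤ c := by
  rw [SchwartzMap.norm_toLp, ← ENNReal.toReal_pow]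
  exact ENNReal.toReal_le_of_le_ofReal hc h

/-- The trace inequality: an extension `U ∈ H^s(ℝ^d)` of `f|_Ω` controls the trace of `f`, although
`U` and `f` are unrelated off `Ω`. The difference `f - U` vanishes on `Ω`, and letting first the
approximation of `U` by smooth functions converge, then `h → 0` in the parametrised trace
inequality, its trace vanishes. -/
theorem IsBoundedLipschitzDomain.exists_norm_trace_le (hd : 1 ≤ d)
    (hΩ : IsBoundedLipschitzDomain Ω) (hs : 1 / 2 < s) :
    ∃ C : ℝ≥0, 0 < C ∧ ∀ (f : 𝓢(Space d, ℂ)) (U G : Lp ℂ 2 (volume : Measure (Space d))),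
      restrictL2 Ω U = smoothL2 Ω f → IsSobolevLift s U G →
        ‖f.toLp 2 (surfaceMeasure Ω)‖ ≤ C * ‖G‖ := by
  obtain ⟨D, h₀, τ, hD, hh₀, hτ, H⟩ := hΩ.exists_trace_inequality hd hs
  have hs0 : 0 ≤ s := by linarith
  have Hr : ∀ h, 0 < h → h < h₀ → ∀ f : 𝓢(Space d, ℂ),
      ‖f.toLp 2 (surfaceMeasure Ω)‖ ^ 2 ≤
        D * (h⁻¹ * ‖smoothL2 Ω f‖ ^ 2 + h ^ τ * ‖(bessel s f).toLp 2 volume‖ ^ 2) :=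
    fun h h0 hh f => norm_toLp_surface_sq_le (by positivity) (H h h0 hh f)
  set k := h₀ / 2 with hk
  have hk0 : 0 < k := by positivity
  set C : ℝ≥0 := ⟨Real.sqrt (D * (k⁻¹ + k ^ τ)) + 1, by positivity⟩ with hC
  have hsmooth : ∀ f : 𝓢(Space d, ℂ),
      ‖f.toLp 2 (surfaceMeasure Ω)‖ ≤ C * ‖(bessel s f).toLp 2 volume‖ := fun f => by
    have h1 := Hr k hk0 (by rw [hk]; linarith) f
    have h2 : ‖smoothL2 Ω f‖ ≤ ‖(bessel s f).toLp 2 volume‖ :=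
      (norm_restrictL2_le _).trans (norm_toLp_le_norm_bessel hs0 f)
    have h3 : ‖f.toLp 2 (surfaceMeasure Ω)‖ ^ 2 ≤
        (Real.sqrt (D * (k⁻¹ + k ^ τ)) * ‖(bessel s f).toLp 2 volume‖) ^ 2 := by
      rw [mul_pow, Real.sq_sqrt (by positivity)]
      refine h1.trans ?_
      rw [mul_assoc, add_mul]
      gcongr
    have h4 := (sq_le_sq₀ (norm_nonneg _) (by positivity)).1 h3
    refine h4.trans ?_
    gcongr
    exact le_add_of_nonneg_right zero_le_one
  refine ⟨C, lt_of_lt_of_le one_pos (le_add_of_nonneg_left (Real.sqrt_nonneg _) :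
    (1 : ℝ) ≤ Real.sqrt (D * (k⁻¹ + k ^ τ)) + 1), fun f U G hU hG => ?_⟩
  obtain ⟨g, hgU, hgG⟩ := exists_schwartz_tendsto hs0 hG
  have ha : Tendsto (fun n => ‖smoothL2 Ω (f - g n)‖ ^ 2) atTop (𝓝 0) := by
    have h1 : Tendsto (fun n => ‖restrictL2 Ω (U - (g n).toLp 2 volume)‖ ^ 2) atTop
        (𝓝 (‖restrictL2 Ω (U - U)‖ ^ 2)) :=
      (((restrictL2 Ω).continuous.tendsto _).comp (tendsto_const_nhds.sub hgU)).norm.pow 2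
    rw [sub_self, map_zero, norm_zero, zero_pow two_ne_zero] at h1
    refine h1.congr fun n => ?_
    rw [map_sub, hU, smoothL2_sub]; rfl
  have hm : Tendsto (fun n => ‖(bessel s (f - g n)).toLp 2 volume‖ ^ 2) atTop
      (𝓝 (‖(bessel s f).toLp 2 volume - G‖ ^ 2)) := by
    have h1 := (hgG.const_sub ((bessel s f).toLp 2 volume)).norm.pow 2
    refine h1.congr fun n => ?_
    rw [map_sub, toLp_sub]
  have hx := tendsto_zero_of_interpolation
    (x := fun n => ‖(f - g n).toLp 2 (surfaceMeasure Ω)‖ ^ 2) (fun n => sq_nonneg _) hD hh₀ hτ ha hm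
    fun h h0 hh n => Hr h h0 hh (f - g n)
  have hx' : Tendsto (fun n => ‖(f - g n).toLp 2 (surfaceMeasure Ω)‖) atTop (𝓝 0) := by
    have := hx.sqrt
    rw [Real.sqrt_zero] at this
    exact this.congr fun n => Real.sqrt_sq (norm_nonneg _)
  have hlim : Tendsto (fun n => ‖(f - g n).toLp 2 (surfaceMeasure Ω)‖ +
      C * ‖(bessel s (g n)).toLp 2 volume‖) atTop (𝓝 (0 + C * ‖G‖)) :=
    hx'.add (hgG.norm.const_mul _)
  rw [zero_add] at hlim
  refine ge_of_tendsto' hlim fun n => ?_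
  calc ‖f.toLp 2 (surfaceMeasure Ω)‖
      = ‖(f - g n).toLp 2 (surfaceMeasure Ω) + (g n).toLp 2 (surfaceMeasure Ω)‖ := by
        rw [toLp_sub, sub_add_cancel]
    _ ≤ _ := (norm_add_le _ _).trans (by gcongr; exact hsmooth (g n))

theorem IsBoundedLipschitzDomain.exists_enorm_toLp_le (hd : 1 ≤ d)
    (hΩ : IsBoundedLipschitzDomain Ω) (hs : 1 / 2 < s) :
    ∃ C : ℝ≥0, ∀ f : 𝓢(Space d, ℂ),
      ‖f.toLp 2 (surfaceMeasure Ω)‖ₑ ≤ C * sobolevENorm Ω s (smoothL2 Ω f) := by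
  obtain ⟨C, hC, H⟩ := hΩ.exists_norm_trace_le hd hs
  refine ⟨C, fun f => ?_⟩
  unfold sobolevENorm
  rw [ENNReal.mul_iInf_of_ne (by simpa using hC.ne') ENNReal.coe_ne_top]
  refine le_iInf ?_
  rintro ⟨⟨U, G⟩, h1, h2⟩
  have := H f U G h1 h2
  rw [← ofReal_norm, ← ofReal_norm, ← ENNReal.ofReal_coe_nnreal,
    ← ENNReal.ofReal_mul C.coe_nonneg]
  exact ENNReal.ofReal_le_ofReal this

theorem eLpNorm_sub_eq_enorm (f : 𝓢(Space d, ℂ)) (g : L2Bdry Ω) :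
    eLpNorm (fun x => f x - g x) 2 (surfaceMeasure Ω) =
      ‖f.toLp 2 (surfaceMeasure Ω) - g‖ₑ := by
  rw [Lp.enorm_def]
  refine eLpNorm_congr_ae ?_
  filter_upwards [Lp.coeFn_sub (f.toLp 2 (surfaceMeasure Ω)) g,
    f.coeFn_toLp 2 (surfaceMeasure Ω)] with x h1 h2
  rw [h1, Pi.sub_apply, h2]

theorem mem_traceGraph_iff {p : L2 Ω × L2Bdry Ω} : p ∈ traceGraph Ω s ↔
    ∃ φ : ℕ → 𝓢(Space d, ℂ),
      Tendsto (fun n => sobolevENorm Ω s (smoothL2 Ω (φ n) - p.1)) atTop (𝓝 0) ∧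
      Tendsto (fun n => (φ n).toLp 2 (surfaceMeasure Ω)) atTop (𝓝 p.2) := by
  refine exists_congr fun φ => and_congr_right fun _ => ?_
  rw [tendsto_iff_edist_tendsto_0]
  simp only [eLpNorm_sub_eq_enorm, edist_eq_enorm_sub]

theorem smooth_mem_traceGraph (φ : 𝓢(Space d, ℂ)) :
    (smoothL2 Ω φ, φ.toLp 2 (surfaceMeasure Ω)) ∈ traceGraph Ω s := by
  refine mem_traceGraph_iff.2 ⟨fun _ => φ, ?_, tendsto_const_nhds⟩
  simp only [sub_self, sobolevENorm_zero]
  exact tendsto_const_nhds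

omit [IsFiniteMeasure (surfaceMeasure Ω)] in
theorem memSobolev_iff {u : L2 Ω} : MemSobolev Ω s u ↔
    ∃ U G : Lp ℂ 2 (volume : Measure (Space d)), restrictL2 Ω U = u ∧ IsSobolevLift s U G := by
  constructor
  · intro h
    by_contra hc
    push Not at hc
    refine absurd h (not_lt.2 ?_)
    exact le_iInf fun ⟨⟨U, G⟩, h1, h2⟩ => absurd h2 (hc U G h1)
  · rintro ⟨U, G, h1, h2⟩
    exact (sobolevENorm_le h1 h2).trans_lt enorm_lt_top

omit [IsFiniteMeasure (surfaceMeasure Ω)] in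
theorem memSobolev_smoothL2 (φ : 𝓢(Space d, ℂ)) : MemSobolev Ω s (smoothL2 Ω φ) :=
  memSobolev_iff.2 ⟨_, _, rfl, isSobolevLift_bessel s φ⟩

omit [IsFiniteMeasure (surfaceMeasure Ω)] in
theorem sobolevENorm_neg (u : L2 Ω) : sobolevENorm Ω s (-u) ≤ sobolevENorm Ω s u := by
  have := sobolevENorm_smul_le Ω s (-1) u
  simpa using this

theorem IsBoundedLipschitzDomain.exists_enorm_le_of_mem_traceGraph (hd : 1 ≤ d)
    (hΩ : IsBoundedLipschitzDomain Ω) (hs : 1 / 2 < s) :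
    ∃ C : ℝ≥0, ∀ p ∈ traceGraph Ω s, ‖p.2‖ₑ ≤ C * sobolevENorm Ω s p.1 := by
  obtain ⟨C, H⟩ := hΩ.exists_enorm_toLp_le hd hs
  refine ⟨C, fun p hp => ?_⟩
  obtain ⟨φ, h1, h2⟩ := mem_traceGraph_iff.1 hp
  have h3 : Tendsto (fun n => C * (sobolevENorm Ω s (smoothL2 Ω (φ n) - p.1) +
      sobolevENorm Ω s p.1)) atTop (𝓝 (C * (0 + sobolevENorm Ω s p.1))) :=
    ENNReal.Tendsto.const_mul (h1.add tendsto_const_nhds) (Or.inr ENNReal.coe_ne_top)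
  rw [zero_add] at h3
  refine le_of_tendsto_of_tendsto' h2.enorm h3 fun n => ?_
  refine (H (φ n)).trans ?_
  gcongr
  have := sobolevENorm_add_le Ω s (smoothL2 Ω (φ n) - p.1) p.1
  rwa [sub_add_cancel] at this

theorem IsBoundedLipschitzDomain.trace_graph (hd : 1 ≤ d)
    (hΩ : IsBoundedLipschitzDomain Ω) (hs : 1 / 2 < s) :
    (trace Ω s).graph = traceGraph Ω s := by
  obtain ⟨C, H⟩ := hΩ.exists_enorm_le_of_mem_traceGraph hd hs
  refine Submodule.toLinearPMap_graph_eq _ fun p hp h0 => ?_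
  have := H p hp
  rw [h0, sobolevENorm_zero, mul_zero] at this
  simpa using this

theorem IsBoundedLipschitzDomain.mem_trace_domain_iff (hd : 1 ≤ d)
    (hΩ : IsBoundedLipschitzDomain Ω) (hs : 1 / 2 < s) (u : L2 Ω) :
    u ∈ (trace Ω s).domain ↔ MemSobolev Ω s u := by
  constructor
  · rintro ⟨p, hp, rfl⟩
    obtain ⟨φ, h1, -⟩ := mem_traceGraph_iff.1 hp
    obtain ⟨n, hn⟩ := (h1.eventually_lt_const ENNReal.zero_lt_top).exists
    have h2 := sobolevENorm_add_le Ω s (smoothL2 Ω (φ n)) (-(smoothL2 Ω (φ n) - p.1))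
    have e : smoothL2 Ω (φ n) + -(smoothL2 Ω (φ n) - p.1) = p.1 := by abel
    rw [e] at h2
    exact h2.trans_lt (ENNReal.add_lt_top.2
      ⟨memSobolev_smoothL2 _, (sobolevENorm_neg _).trans_lt hn⟩)
  · -- the trace of `u` is the limit of the traces of smooth approximations of an extension
    intro hu
    obtain ⟨C, -, H⟩ := hΩ.exists_norm_trace_le hd hs
    obtain ⟨U, G, hU, hG⟩ := memSobolev_iff.1 hu
    obtain ⟨f, hfU, hfG⟩ := exists_schwartz_tendsto (by linarith) hG
    have hcauchy : CauchySeq fun n => (f n).toLp 2 (surfaceMeasure Ω) := by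
      refine Metric.cauchySeq_iff'.2 fun ε hε => ?_
      obtain ⟨N, hN⟩ := Metric.cauchySeq_iff'.1 hfG.cauchySeq (ε / (C + 1)) (by positivity)
      refine ⟨N, fun n hn => ?_⟩
      have h1 := hN n hn
      rw [dist_eq_norm, ← toLp_sub, ← map_sub, lt_div_iff₀ (by positivity)] at h1
      rw [dist_eq_norm, ← toLp_sub]
      have h2 := H (f n - f N) _ _ rfl (isSobolevLift_bessel s (f n - f N))
      nlinarith [norm_nonneg ((bessel s (f n - f N)).toLp 2 (volume : Measure (Space d)))]
    obtain ⟨g, hg⟩ := cauchySeq_tendsto_of_complete hcauchy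
    refine ⟨(u, g), mem_traceGraph_iff.2 ⟨f, ?_, hg⟩, rfl⟩
    have h1 : Tendsto (fun n => ‖(bessel s (f n)).toLp 2 volume - G‖ₑ) atTop (𝓝 0) := by
      have := (hfG.sub_const G).enorm
      rwa [sub_self, enorm_zero] at this
    refine tendsto_of_tendsto_of_tendsto_of_le_of_le tendsto_const_nhds h1
      (fun _ => bot_le) fun n => ?_
    refine sobolevENorm_le ?_ ((isSobolevLift_bessel s (f n)).sub hG)
    rw [map_sub, hU]; rfl

/-- Restrictions of smooth functions to `Γ` are dense in `L²(Γ)`. -/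
theorem exists_schwartz_toLp_surface_near (g : L2Bdry Ω) {ε : ℝ} (hε : 0 < ε) :
    ∃ φ : 𝓢(Space d, ℂ), ‖φ.toLp 2 (surfaceMeasure Ω) - g‖ < ε := by
  have hdense := SchwartzMap.denseRange_toLpCLM (E := Space d) (F := ℂ) (p := 2)
    (μ := surfaceMeasure Ω) ENNReal.ofNat_ne_top
  obtain ⟨φ, hφ⟩ := hdense.exists_dist_lt g hε
  refine ⟨φ, ?_⟩
  rw [dist_comm, dist_eq_norm] at hφ
  exact hφ

end Trace

end Wentzell

/-! ### The subsidiary operators and the Neumann traces -/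

namespace Wentzell

variable {d : ℕ} {Ω : Set (Space d)} {ρ : ℝ} {b : SesqForm (L2 Ω)}

variable (Ω ρ b) in
/-- What the analysis of the Neumann traces uses of an admissible form: the trace is bounded on
`D(b)`, its range on `D(B_N)` is dense (that is, has trivial orthogonal complement), and `B_0` is
densely defined. -/
structure IsTraceSetting : Prop where
  generating : b.IsGenerating
  symmetric : b.IsSymmetric
  mem_tr : ∀ u ∈ b.domain, u ∈ (tr Ω ρ).domain
  tr_le : ∃ C : ℝ, 0 ≤ C ∧ ∀ (u : b.domain) (t : L2Bdry Ω), ((u : L2 Ω), t) ∈ (tr Ω ρ).graph →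
    ‖t‖ ≤ C * b.formNorm u
  eq_zero_of_orthogonal : ∀ g : L2Bdry Ω, (∀ v w t, (v, w) ∈ (opN Ω b).graph →
    (v, t) ∈ (tr Ω ρ).graph → inner ℂ t g = 0) → g = 0
  dense : Dense (((opD Ω ρ b).domain ⊓ (opN Ω b).domain : Submodule ℂ (L2 Ω)) : Set (L2 Ω))

theorem IsAdmissible.isTraceSetting (hd : 1 ≤ d) (hΩ : IsBoundedLipschitzDomain Ω) (hρ : 0 < ρ)
    (hb : IsAdmissible Ω ρ b)
    (hdense : Dense (((opD Ω ρ b).domain ⊓ (opN Ω b).domain : Submodule ℂ (L2 Ω)) : Set (L2 Ω))) :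
    IsTraceSetting Ω ρ b := by
  have := hΩ.isFiniteMeasure_surfaceMeasure hd
  have hs : 1 / 2 < 1 / 2 + ρ := by linarith
  have hgr := hΩ.trace_graph hd hs
  obtain ⟨C, hC⟩ := hΩ.exists_enorm_le_of_mem_traceGraph hd hs
  obtain ⟨C', hC'⟩ := hb.embedding
  have hmem : ∀ u ∈ b.domain, u ∈ (tr Ω ρ).domain := fun u hu =>
    (hΩ.mem_trace_domain_iff hd hs u).2
      ((hC' ⟨u, hu⟩).trans_lt (ENNReal.mul_lt_top ENNReal.coe_lt_top ENNReal.ofReal_lt_top))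
  have hle : ∀ (u : b.domain) (t : L2Bdry Ω), ((u : L2 Ω), t) ∈ (tr Ω ρ).graph →
      ‖t‖ ≤ (C * C' : ℝ≥0) * b.formNorm u := fun u t hut => by
    rw [hgr] at hut
    have h1 : ‖t‖ₑ ≤ C * (C' * ENNReal.ofReal (b.formNorm u)) :=
      (hC _ hut).trans (by gcongr; exact hC' u)
    rw [← ofReal_norm, ← mul_assoc, ← ENNReal.coe_mul, ← ENNReal.ofReal_coe_nnreal,
      ← ENNReal.ofReal_mul (NNReal.coe_nonneg _)] at h1
    exact (ENNReal.ofReal_le_ofReal_iff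
      (mul_nonneg (NNReal.coe_nonneg _) (SesqForm.formNorm_nonneg u))).1 h1
  refine ⟨hb.generating, hb.symmetric, hmem, ⟨_, NNReal.coe_nonneg _, hle⟩, fun g hg => ?_, hdense⟩
  -- `g` is orthogonal to `tr D(B_N)`, hence to `tr D(b)`, to traces of smooth functions, to `L²(Γ)`
  have hb0 : ∀ (u : b.domain) (t : L2Bdry Ω), ((u : L2 Ω), t) ∈ (tr Ω ρ).graph →
      inner ℂ t g = 0 := fun u t hut => by
    rw [← norm_eq_zero]
    refine le_antisymm (le_of_forall_pos_le_add fun ε hε => ?_) (norm_nonneg _)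
    set K : ℝ := (C * C' : ℝ≥0) * ‖g‖ + 1 with hK
    have hK0 : 0 < K := by positivity
    obtain ⟨w, hw, hlt⟩ := SesqForm.exists_mem_op_domain_formNorm_sub_lt hb.generating hb.symmetric
      u (div_pos hε hK0)
    have h1 := LinearPMap.mem_graph (tr Ω ρ) ⟨(w : L2 Ω), hmem _ w.2⟩
    have h2 := hg _ _ _ (LinearPMap.mem_graph (opN Ω b) ⟨(w : L2 Ω), hw⟩) h1
    have h3 := hle (u - w) _ (Submodule.sub_mem _ hut h1)
    have h4 : inner ℂ t g = inner ℂ (t - tr Ω ρ ⟨(w : L2 Ω), hmem _ w.2⟩) g := by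
      rw [inner_sub_left, h2, sub_zero]
    rw [h4, zero_add]
    calc _ ≤ ‖t - tr Ω ρ ⟨(w : L2 Ω), hmem _ w.2⟩‖ * ‖g‖ := norm_inner_le_norm _ _
      _ ≤ ((C * C' : ℝ≥0) * b.formNorm (u - w)) * ‖g‖ := by gcongr
      _ = ((C * C' : ℝ≥0) * ‖g‖) * b.formNorm (u - w) := by ring
      _ ≤ K * (ε / K) := by
        gcongr
        · exact SesqForm.formNorm_nonneg _
        · exact le_add_of_nonneg_right zero_le_one
      _ = ε := mul_div_cancel₀ _ hK0.ne'
  have hφ0 : ∀ φ : 𝓢(Space d, ℂ), inner ℂ (φ.toLp 2 (surfaceMeasure Ω)) g = 0 := fun φ => by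
    rw [← norm_eq_zero]
    refine le_antisymm (le_of_forall_pos_le_add fun ε hε => ?_) (norm_nonneg _)
    set K : ℝ≥0 := C * ‖g‖₊ + 1 with hK
    have hK0 : 0 < K := by positivity
    obtain ⟨u, hu⟩ := hb.dense (smoothL2 Ω φ) (memSobolev_smoothL2 φ) (ENNReal.ofReal (ε / K))
      (ENNReal.ofReal_pos.2 (by positivity))
    have h1 := LinearPMap.mem_graph (tr Ω ρ) ⟨(u : L2 Ω), hmem _ u.2⟩
    have h2 := hb0 u _ h1
    have h3 := hC _ (Submodule.sub_mem _ (hgr ▸ h1) (smooth_mem_traceGraph φ))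
    set t := tr Ω ρ ⟨(u : L2 Ω), hmem _ u.2⟩
    have h5 : ‖t - φ.toLp 2 (surfaceMeasure Ω)‖ ≤ C * (ε / K) := by
      have h6 : ‖t - φ.toLp 2 (surfaceMeasure Ω)‖ₑ ≤ C * ENNReal.ofReal (ε / K) :=
        h3.trans (by gcongr; exact hu.le)
      rw [← ofReal_norm, ← ENNReal.ofReal_coe_nnreal,
        ← ENNReal.ofReal_mul (NNReal.coe_nonneg _)] at h6
      exact (ENNReal.ofReal_le_ofReal_iff (by positivity)).1 h6
    have h4 : inner ℂ (φ.toLp 2 (surfaceMeasure Ω)) g =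
        -inner ℂ (t - φ.toLp 2 (surfaceMeasure Ω)) g := by
      rw [inner_sub_left, h2, zero_sub, neg_neg]
    rw [h4, norm_neg, zero_add]
    calc _ ≤ ‖t - φ.toLp 2 (surfaceMeasure Ω)‖ * ‖g‖ := norm_inner_le_norm _ _
      _ ≤ (C * (ε / K)) * ‖g‖ := by gcongr
      _ = (C * ‖g‖) * (ε / K) := by ring
      _ ≤ K * (ε / K) := by
        gcongr
        rw [hK, NNReal.coe_add, NNReal.coe_mul, coe_nnnorm]
        exact (le_add_of_nonneg_right zero_le_one)
      _ = ε := mul_div_cancel₀ _ (by positivity)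
  have hd : Dense (Set.range fun φ : 𝓢(Space d, ℂ) => φ.toLp 2 (surfaceMeasure Ω)) :=
    Metric.dense_iff.2 fun x r hr => by
      obtain ⟨φ, hφ⟩ := exists_schwartz_toLp_surface_near x hr
      exact ⟨_, by rwa [Metric.mem_ball, dist_eq_norm], φ, rfl⟩
  refine hd.eq_zero_of_inner_left (𝕜 := ℂ) ?_
  rintro _ ⟨φ, rfl⟩
  exact inner_eq_zero_symm.1 (hφ0 φ)

namespace IsTraceSetting

variable (h : IsTraceSetting Ω ρ b)
include h

theorem opN_graph : (opN Ω b).graph = b.opGraph := SesqForm.op_graph h.generating.dense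

theorem mem_opN_graph {u w : L2 Ω} : (u, w) ∈ (opN Ω b).graph ↔
    ∃ hu : u ∈ b.domain, ∀ v : b.domain, b.form ⟨u, hu⟩ v = inner ℂ (v : L2 Ω) w := by
  rw [h.opN_graph]; rfl

theorem mem_domain_of_mem_opN_graph {u w : L2 Ω} (hu : (u, w) ∈ (opN Ω b).graph) : u ∈ b.domain :=
  (h.mem_opN_graph.1 hu).1

theorem exists_mem_tr_graph {u w : L2 Ω} (hu : (u, w) ∈ (opN Ω b).graph) :
    ∃ t, (u, t) ∈ (tr Ω ρ).graph :=
  LinearPMap.mem_domain_iff.1 (h.mem_tr u (h.mem_domain_of_mem_opN_graph hu))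

theorem isSelfAdjoint_opN : IsSelfAdjoint (opN Ω b) := by
  obtain ⟨R, hR⟩ := SesqForm.exists_isShiftedInverse h.generating h.symmetric
  exact hR.isSelfAdjoint

/-- `B_N` is self-adjoint, as a description of its graph. -/
theorem mem_opN_graph_iff_symm {u f : L2 Ω} : (u, f) ∈ (opN Ω b).graph ↔
    ∀ v w, (v, w) ∈ (opN Ω b).graph → inner ℂ w u = inner ℂ v f := by
  have h1 := h.isSelfAdjoint_opN
  have h2 := LinearPMap.adjoint_graph_eq_graph_adjoint h1.dense_domain
  rw [(LinearPMap.isSelfAdjoint_def).1 h1] at h2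
  conv_lhs => rw [h2]
  rw [Submodule.mem_adjoint_iff]
  simp only [sub_eq_zero]

/-- A bound of the form norm by the graph norm of `B_N`. -/
theorem formNorm_sq_le : ∃ C : ℝ, 0 ≤ C ∧ ∀ (u : b.domain) (w : L2 Ω),
    ((u : L2 Ω), w) ∈ (opN Ω b).graph → b.formNorm u ^ 2 ≤ C * (‖(u : L2 Ω)‖ ^ 2 + ‖w‖ ^ 2) := by
  refine ⟨1 + |1 - b.maxSemiBound|, by positivity, fun u w huw => ?_⟩
  rw [SesqForm.formNorm_sq h.generating.semibounded]
  have h1 : (b.form u u).re ≤ ‖(u : L2 Ω)‖ * ‖w‖ := by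
    obtain ⟨hu, hw⟩ := h.mem_opN_graph.1 huw
    rw [show b.form u u = inner ℂ (u : L2 Ω) w from hw u]
    exact (Complex.re_le_norm _).trans (norm_inner_le_norm _ _)
  have h2 := le_abs_self (1 - b.maxSemiBound)
  have h3 := mul_le_mul_of_nonneg_right h2 (sq_nonneg ‖(u : L2 Ω)‖)
  have h4 := mul_nonneg (abs_nonneg (1 - b.maxSemiBound)) (sq_nonneg ‖w‖)
  nlinarith [two_mul_le_add_sq ‖(u : L2 Ω)‖ ‖w‖, sq_nonneg ‖(u : L2 Ω)‖, sq_nonneg ‖w‖]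

/-- The trace is bounded with respect to the graph norm of `B_N`. -/
theorem tr_sq_le : ∃ C : ℝ, 0 ≤ C ∧ ∀ u w t, (u, w) ∈ (opN Ω b).graph → (u, t) ∈ (tr Ω ρ).graph →
    ‖t‖ ^ 2 ≤ C * (‖u‖ ^ 2 + ‖w‖ ^ 2) := by
  obtain ⟨C, hC0, hC⟩ := h.tr_le
  obtain ⟨D, hD0, hD⟩ := h.formNorm_sq_le
  refine ⟨C ^ 2 * D, by positivity, fun u w t huw hut => ?_⟩
  have hu := h.mem_domain_of_mem_opN_graph huw
  calc ‖t‖ ^ 2 ≤ (C * b.formNorm ⟨u, hu⟩) ^ 2 := by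
        gcongr; exact hC ⟨u, hu⟩ t hut
    _ = C ^ 2 * b.formNorm ⟨u, hu⟩ ^ 2 := by ring
    _ ≤ C ^ 2 * (D * (‖u‖ ^ 2 + ‖w‖ ^ 2)) := by gcongr; exact hD ⟨u, hu⟩ w huw
    _ = _ := by ring

omit h in
theorem mem_tr_graph_of_mem_opD {v : L2 Ω} (hv : v ∈ (opD Ω ρ b).domain) :
    (v, (0 : L2Bdry Ω)) ∈ (tr Ω ρ).graph := by
  rw [opD, SesqForm.op, Submodule.toLinearPMap_domain] at hv
  obtain ⟨⟨v, f⟩, ⟨hv, -⟩, rfl⟩ := hv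
  exact hv.2

/-- The adjoint of `B_0`, in terms of `B_N`. -/
theorem mem_op0Adj_graph {u f : L2 Ω} : (u, f) ∈ (op0Adj Ω ρ b).graph ↔
    ∀ v w, v ∈ (opD Ω ρ b).domain → (v, w) ∈ (opN Ω b).graph → inner ℂ w u = inner ℂ v f := by
  have hd : Dense ((op0 Ω ρ b).domain : Set (L2 Ω)) := h.dense
  rw [op0Adj, LinearPMap.adjoint_graph_eq_graph_adjoint hd, Submodule.mem_adjoint_iff]
  simp only [sub_eq_zero]
  constructor
  · intro H v w hv hw
    refine H v w ?_
    have hN := LinearPMap.mem_domain_of_mem_graph hw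
    rw [LinearPMap.mem_graph_iff]
    refine ⟨⟨v, hv, hN⟩, rfl, ?_⟩
    exact (LinearPMap.domRestrict_apply (f := opN Ω b) (y := ⟨v, hN⟩) rfl).trans
      ((LinearPMap.image_iff hN).2 hw).symm
  · intro H v w hw
    refine H v w (LinearPMap.mem_domain_of_mem_graph hw).1 ?_
    exact LinearPMap.le_graph_of_le LinearPMap.domRestrict_le hw

/-- `B_N` is an extension of `B_0` that is its own adjoint, so `B_0^*` extends `B_N`. -/
theorem mem_op0Adj_graph_of_mem_opN_graph {u f : L2 Ω} (hu : (u, f) ∈ (opN Ω b).graph) :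
    (u, f) ∈ (op0Adj Ω ρ b).graph :=
  h.mem_op0Adj_graph.2 fun v w _ hvw => h.mem_opN_graph_iff_symm.1 hu v w hvw

omit h in
theorem mem_veryWeakNeumannGraph {u : L2 Ω} {g : L2Bdry Ω} :
    (u, g) ∈ veryWeakNeumannGraph Ω ρ b ↔ ∃ f, (u, f) ∈ (op0Adj Ω ρ b).graph ∧
      ∀ v w t, (v, w) ∈ (opN Ω b).graph → (v, t) ∈ (tr Ω ρ).graph →
        inner ℂ v f - inner ℂ w u = inner ℂ t g := by
  constructor
  · rintro ⟨h0, H⟩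
    refine ⟨_, LinearPMap.mem_graph _ ⟨u, h0⟩, fun v w t hvw hvt => ?_⟩
    have hv := LinearPMap.mem_domain_of_mem_graph hvw
    have ht := LinearPMap.mem_domain_of_mem_graph hvt
    rw [(LinearPMap.image_iff hv).2 hvw, (LinearPMap.image_iff ht).2 hvt]
    exact H ⟨v, hv⟩ ht
  · rintro ⟨f, hf, H⟩
    have h0 := LinearPMap.mem_domain_of_mem_graph hf
    refine ⟨h0, fun v hv => ?_⟩
    rw [← (LinearPMap.image_iff h0).2 hf]
    exact H _ _ _ (LinearPMap.mem_graph _ v) (LinearPMap.mem_graph _ ⟨_, hv⟩)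

omit h in
theorem mem_weakNeumannGraph {u : L2 Ω} {g : L2Bdry Ω} :
    (u, g) ∈ weakNeumannGraph Ω ρ b ↔ ∃ (hu : u ∈ b.domain) (f : L2 Ω),
      (u, f) ∈ (op0Adj Ω ρ b).graph ∧ ∀ (v : b.domain) (t : L2Bdry Ω), (↑v, t) ∈ (tr Ω ρ).graph →
        inner ℂ (v : L2 Ω) f - b.form ⟨u, hu⟩ v = inner ℂ t g := by
  constructor
  · rintro ⟨hu, h0, H⟩
    refine ⟨hu, _, LinearPMap.mem_graph _ ⟨u, h0⟩, fun v t hvt => ?_⟩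
    have ht := LinearPMap.mem_domain_of_mem_graph hvt
    rw [(LinearPMap.image_iff ht).2 hvt]
    exact H v ht
  · rintro ⟨hu, f, hf, H⟩
    have h0 := LinearPMap.mem_domain_of_mem_graph hf
    refine ⟨hu, h0, fun v hv => ?_⟩
    rw [← (LinearPMap.image_iff h0).2 hf]
    exact H _ _ (LinearPMap.mem_graph _ ⟨_, hv⟩)

/-- `N^b ⊆ 𝒩^b`, by the symmetry of `b`. -/
theorem weakNeumannGraph_le : weakNeumannGraph Ω ρ b ≤ veryWeakNeumannGraph Ω ρ b := by
  rintro ⟨u, g⟩ hug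
  obtain ⟨hu, f, hf, H⟩ := mem_weakNeumannGraph.1 hug
  refine mem_veryWeakNeumannGraph.2 ⟨f, hf, fun v w t hvw hvt => ?_⟩
  obtain ⟨hv, hw⟩ := h.mem_opN_graph.1 hvw
  rw [← H ⟨v, hv⟩ t hvt, h.symmetric, hw]
  simp

theorem veryWeakNeumann_graph : (veryWeakNeumann Ω ρ b).graph = veryWeakNeumannGraph Ω ρ b := by
  refine Submodule.toLinearPMap_graph_eq _ ?_
  rintro ⟨u, g⟩ hug (rfl : u = 0)
  obtain ⟨f, hf, H⟩ := mem_veryWeakNeumannGraph.1 hug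
  have hf0 : f = 0 := LinearPMap.graph_fst_eq_zero_snd _ hf rfl
  refine h.eq_zero_of_orthogonal g fun v w t hvw hvt => ?_
  rw [← H v w t hvw hvt, hf0, inner_zero_right, inner_zero_right, sub_zero]

theorem weakNeumann_graph : (weakNeumann Ω ρ b).graph = weakNeumannGraph Ω ρ b := by
  refine Submodule.toLinearPMap_graph_eq _ fun p hp h0 => ?_
  have h1 := h.weakNeumannGraph_le hp
  rw [← h.veryWeakNeumann_graph] at h1
  exact LinearPMap.graph_fst_eq_zero_snd _ h1 h0

/-- The Neumann traces vanish on `D(B_N)`. -/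
theorem mem_veryWeakNeumannGraph_zero {u f : L2 Ω} (hu : (u, f) ∈ (opN Ω b).graph) :
    (u, (0 : L2Bdry Ω)) ∈ veryWeakNeumannGraph Ω ρ b :=
  mem_veryWeakNeumannGraph.2 ⟨f, h.mem_op0Adj_graph_of_mem_opN_graph hu, fun v w t hvw _ => by
    rw [h.mem_opN_graph_iff_symm.1 hu v w hvw, sub_self, inner_zero_right]⟩

theorem mem_weakNeumannGraph_zero {u f : L2 Ω} (hu : (u, f) ∈ (opN Ω b).graph) :
    (u, (0 : L2Bdry Ω)) ∈ weakNeumannGraph Ω ρ b := by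
  obtain ⟨hu', H⟩ := h.mem_opN_graph.1 hu
  refine mem_weakNeumannGraph.2
    ⟨hu', f, h.mem_op0Adj_graph_of_mem_opN_graph hu, fun v t _ => ?_⟩
  rw [H v, sub_self, inner_zero_right]

/-- If `N^b` is surjective, the two Neumann traces agree: for `u ∈ D(𝒩^b)` and `N^b w = 𝒩^b u` the
difference `u - w` has vanishing trace `𝒩^b`, so it lies in `D(B_N^*) = D(B_N)`, on which `N^b` is
defined. -/
theorem weakNeumann_eq (hsurj : ∀ g : L2Bdry Ω, ∃ u, weakNeumann Ω ρ b u = g) :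
    weakNeumann Ω ρ b = veryWeakNeumann Ω ρ b := by
  refine LinearPMap.eq_of_eq_graph ?_
  rw [h.weakNeumann_graph, h.veryWeakNeumann_graph]
  refine le_antisymm h.weakNeumannGraph_le ?_
  rintro ⟨u, g⟩ hug
  obtain ⟨w, hw⟩ := hsurj g
  have hwg : ((w : L2 Ω), g) ∈ weakNeumannGraph Ω ρ b := by
    rw [← h.weakNeumann_graph, ← hw]; exact LinearPMap.mem_graph _ w
  have h1 := Submodule.sub_mem _ hug (h.weakNeumannGraph_le hwg)
  rw [Prod.mk_sub_mk, sub_self] at h1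
  obtain ⟨f, hf, H⟩ := mem_veryWeakNeumannGraph.1 h1
  have h2 : (u - w, f) ∈ (opN Ω b).graph := h.mem_opN_graph_iff_symm.2 fun v z hvz => by
    obtain ⟨t, ht⟩ := h.exists_mem_tr_graph hvz
    have := H v z t hvz ht
    rw [inner_zero_right, sub_eq_zero] at this
    exact this.symm
  have h3 := Submodule.add_mem _ (h.mem_weakNeumannGraph_zero h2) hwg
  rwa [Prod.mk_add_mk, sub_add_cancel, zero_add] at h3

end IsTraceSetting

end Wentzell

/-! ### Multiplication operators and the weighted boundary space -/

namespace Wentzell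

section Multiplication

variable {X : Type*} [MeasurableSpace X] {μ : Measure X}

theorem coeFn_mulLinfty (m : Lp ℝ ⊤ μ) (f : Lp ℂ 2 μ) :
    mulLinfty m f =ᵐ[μ] fun x => (m x : ℂ) * f x := by
  filter_upwards [Lp.coeFn_lpSMul (r := 2) m f] with x hx
  rw [show (mulLinfty m f) x = (m • f : Lp ℂ 2 μ) x from rfl, hx]
  simp

theorem norm_mulLinfty_le (m : Lp ℝ ⊤ μ) (f : Lp ℂ 2 μ) : ‖mulLinfty m f‖ ≤ ‖m‖ * ‖f‖ :=
  Lp.norm_smul_le m f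

theorem inner_mulLinfty_left (m : Lp ℝ ⊤ μ) (f g : Lp ℂ 2 μ) :
    inner ℂ (mulLinfty m f) g = inner ℂ f (mulLinfty m g) := by
  rw [L2.inner_def, L2.inner_def]
  refine integral_congr_ae ?_
  filter_upwards [coeFn_mulLinfty m f, coeFn_mulLinfty m g] with x h1 h2
  rw [h1, h2]
  simp only [RCLike.inner_apply, map_mul, Complex.conj_ofReal]
  ring

theorem le_inner_mulLinfty {m : Lp ℝ ⊤ μ} {η : ℝ} (hm : ∀ᵐ x ∂μ, η ≤ m x) (f : Lp ℂ 2 μ) :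
    η * ‖f‖ ^ 2 ≤ (inner ℂ f (mulLinfty m f)).re := by
  have h1 : η * ‖f‖ ^ 2 = (inner ℂ f ((η : ℂ) • f)).re := by
    rw [inner_smul_right, inner_self_eq_norm_sq_to_K]
    simp [← Complex.ofReal_pow]
  rw [h1, L2.inner_def, L2.inner_def]
  change RCLike.re (K := ℂ) _ ≤ RCLike.re (K := ℂ) _
  rw [← integral_re (L2.integrable_inner _ _), ← integral_re (L2.integrable_inner _ _)]
  refine integral_mono_ae (L2.integrable_inner _ _).re (L2.integrable_inner _ _).re ?_
  filter_upwards [hm, coeFn_mulLinfty m f, Lp.coeFn_smul (η : ℂ) f] with x h1 h2 h3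
  simp only [h2, h3, Pi.smul_apply, smul_eq_mul, RCLike.inner_apply]
  have e : ∀ c : ℝ, RCLike.re ((c : ℂ) * f x * (starRingEnd ℂ) (f x)) = c * ‖f x‖ ^ 2 := fun c => by
    rw [mul_assoc, Complex.mul_conj, Complex.normSq_eq_norm_sq, ← Complex.ofReal_mul]
    simp only [RCLike.re_to_complex, Complex.ofReal_re]
  rw [e, e]
  gcongr

end Multiplication

variable {d : ℕ} {Ω : Set (Space d)} {β : Lp ℝ ⊤ (surfaceMeasure Ω)} {η : ℝ}

theorem aemeasurable_weight (β : Lp ℝ ⊤ (surfaceMeasure Ω)) :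
    AEMeasurable (fun x => ENNReal.ofReal (β x)⁻¹) (surfaceMeasure Ω) :=
  (Lp.aestronglyMeasurable β).aemeasurable.inv.ennreal_ofReal

theorem weightedMeasure_le (hη : 0 < η) (hβ : ∀ᵐ x ∂(surfaceMeasure Ω), η ≤ β x) :
    weightedMeasure Ω β ≤ ENNReal.ofReal η⁻¹ • surfaceMeasure Ω := by
  rw [weightedMeasure, ← withDensity_const]
  refine withDensity_mono ?_
  filter_upwards [hβ] with x hx
  exact ENNReal.ofReal_le_ofReal (inv_anti₀ hη hx)

/-- As `β⁻¹` is bounded, `L²(Γ)` embeds into `L²(Γ, β⁻¹ dS)`. -/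
theorem exists_toWeighted (hη : 0 < η) (hβ : ∀ᵐ x ∂(surfaceMeasure Ω), η ≤ β x) :
    ∃ C : ℝ, 0 ≤ C ∧ ∀ t : L2Bdry Ω, ∃ f : Lp ℂ 2 (weightedMeasure Ω β),
      f =ᵐ[weightedMeasure Ω β] t ∧ ‖f‖ ≤ C * ‖t‖ := by
  have hle := weightedMeasure_le hη hβ
  refine ⟨(ENNReal.ofReal η⁻¹ ^ (1 / 2 : ℝ)).toReal, ENNReal.toReal_nonneg, fun t => ?_⟩
  have ht : MemLp t 2 (weightedMeasure Ω β) :=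
    (Lp.memLp t).of_measure_le_smul ENNReal.ofReal_ne_top hle
  refine ⟨ht.toLp t, ht.coeFn_toLp, ?_⟩
  rw [Lp.norm_toLp, Lp.norm_def, ← ENNReal.toReal_mul]
  refine ENNReal.toReal_mono (ENNReal.mul_ne_top (ENNReal.rpow_ne_top_of_nonneg (by norm_num)
    ENNReal.ofReal_ne_top) (Lp.eLpNorm_ne_top t)) ?_
  refine (eLpNorm_mono_measure _ hle).trans ?_
  rw [eLpNorm_smul_measure_of_ne_top (by norm_num)]
  simp

theorem exists_eq_mul_weighted (hη : 0 < η) (hβ : ∀ᵐ x ∂(surfaceMeasure Ω), η ≤ β x)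
    (s : L2Bdry Ω) : ∃ f : Lp ℂ 2 (weightedMeasure Ω β),
      f =ᵐ[weightedMeasure Ω β] fun x => (β x : ℂ) * s x := by
  obtain ⟨C, -, hC⟩ := exists_toWeighted hη hβ
  obtain ⟨f, hf, -⟩ := hC (mulLinfty β s)
  exact ⟨f, hf.trans ((weightedMeasure_ac Ω β).ae_le (coeFn_mulLinfty β s))⟩

theorem surfaceMeasure_ac_weighted (hη : 0 < η) (hβ : ∀ᵐ x ∂(surfaceMeasure Ω), η ≤ β x) :
    surfaceMeasure Ω ≪ weightedMeasure Ω β := by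
  refine withDensity_absolutelyContinuous' (aemeasurable_weight β) ?_
  filter_upwards [hβ] with x hx
  exact (ENNReal.ofReal_pos.2 (inv_pos.2 (hη.trans_le hx))).ne'

/-- Every element of `L²(Γ, β⁻¹ dS)` is `β` times an element of `L²(Γ)`. -/
theorem exists_eq_mul_of_weighted (hη : 0 < η) (hβ : ∀ᵐ x ∂(surfaceMeasure Ω), η ≤ β x)
    (f : Lp ℂ 2 (weightedMeasure Ω β)) : ∃ s : L2Bdry Ω,
      f =ᵐ[weightedMeasure Ω β] fun x => (β x : ℂ) * s x := by
  have hac := surfaceMeasure_ac_weighted hη hβ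
  have hmeas : AEStronglyMeasurable (fun x => ((β x)⁻¹ : ℂ) * f x) (surfaceMeasure Ω) := by
    refine AEStronglyMeasurable.mul ?_ ((Lp.aestronglyMeasurable f).mono_ac hac)
    exact (Complex.measurable_ofReal.comp_aemeasurable
      (Lp.aestronglyMeasurable β).aemeasurable).inv.aestronglyMeasurable
  have hmem : MemLp (fun x => ((β x)⁻¹ : ℂ) * f x) 2 (surfaceMeasure Ω) := by
    refine ⟨hmeas, ?_⟩
    have hf : ∫⁻ x, ‖f x‖ₑ ^ (2 : ℝ) ∂(weightedMeasure Ω β) < ⊤ := by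
      have := lintegral_rpow_enorm_lt_top_of_eLpNorm_lt_top (p := 2) two_ne_zero
        ENNReal.ofNat_ne_top (Lp.eLpNorm_lt_top f)
      simpa using this
    rw [eLpNorm_lt_top_iff_lintegral_rpow_enorm_lt_top two_ne_zero ENNReal.ofNat_ne_top]
    have hfm : AEMeasurable (fun x => ‖f x‖ₑ ^ (2 : ℝ)) (weightedMeasure Ω β) :=
      (Lp.aestronglyMeasurable f).enorm.pow_const (2 : ℝ)
    have hwd := lintegral_withDensity_eq_lintegral_mul₀' (aemeasurable_weight β) hfm
    rw [show ∫⁻ x, ‖f x‖ₑ ^ (2 : ℝ) ∂(weightedMeasure Ω β) = _ from hwd] at hf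
    refine lt_of_le_of_lt (lintegral_mono_ae ?_)
      (ENNReal.mul_lt_top (ENNReal.ofReal_lt_top (r := η⁻¹)) hf |>.trans_le'
        (lintegral_const_mul' _ _ ENNReal.ofReal_ne_top).le)
    filter_upwards [hβ] with x hx
    have hx0 := hη.trans_le hx
    have e : ‖((β x)⁻¹ : ℂ) * f x‖ₑ = ENNReal.ofReal (β x)⁻¹ * ‖f x‖ₑ := by
      rw [enorm_mul, ← Complex.ofReal_inv, ← ofReal_norm, Complex.norm_real, Real.norm_eq_abs,
        abs_of_pos (inv_pos.2 hx0)]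
    rw [e]
    simp only [ENNReal.toReal_ofNat, Pi.mul_apply]
    rw [ENNReal.mul_rpow_of_nonneg _ _ zero_le_two, ← mul_assoc, ENNReal.rpow_two, sq]
    gcongr
  refine ⟨hmem.toLp _, ?_⟩
  filter_upwards [(weightedMeasure_ac Ω β).ae_le hmem.coeFn_toLp,
    (weightedMeasure_ac Ω β).ae_le hβ] with x h1 h2
  have hx0 : (β x : ℂ) ≠ 0 := Complex.ofReal_ne_zero.2 (hη.trans_le h2).ne'
  rw [h1, ← mul_assoc, mul_inv_cancel₀ hx0, one_mul]

/-- The weight `β⁻¹` of the inner product cancels against `β`. -/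
theorem inner_weighted (hη : 0 < η) (hβ : ∀ᵐ x ∂(surfaceMeasure Ω), η ≤ β x)
    {f g : Lp ℂ 2 (weightedMeasure Ω β)} {t s : L2Bdry Ω} (hf : f =ᵐ[weightedMeasure Ω β] t)
    (hg : g =ᵐ[weightedMeasure Ω β] fun x => (β x : ℂ) * s x) : inner ℂ f g = inner ℂ t s := by
  rw [L2.inner_def, L2.inner_def]
  have h1 : ∫ x, inner ℂ (f x) (g x) ∂(weightedMeasure Ω β) =
      ∫ x, inner ℂ (t x) ((β x : ℂ) * s x) ∂(weightedMeasure Ω β) := by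
    refine integral_congr_ae ?_
    filter_upwards [hf, hg] with x h1 h2
    rw [h1, h2]
  rw [h1, weightedMeasure, integral_withDensity_eq_integral_toReal_smul₀ (aemeasurable_weight β)
    (Eventually.of_forall fun _ => ENNReal.ofReal_lt_top)]
  refine integral_congr_ae ?_
  filter_upwards [hβ] with x hx
  have hx0 := hη.trans_le hx
  rw [ENNReal.toReal_ofReal (inv_pos.2 hx0).le, ← smul_eq_mul, inner_smul_right,
    Complex.real_smul, ← mul_assoc, Complex.ofReal_inv,
    inv_mul_cancel₀ (Complex.ofReal_ne_zero.2 hx0.ne'), one_mul]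

end Wentzell

/-! ### The primary form and its operator -/

namespace Wentzell

variable {d : ℕ} {Ω : Set (Space d)} {ρ : ℝ} {b : SesqForm (L2 Ω)}
  {α : Lp ℝ ⊤ ((volume : Measure (Space d)).restrict Ω)} {β γ : Lp ℝ ⊤ (surfaceMeasure Ω)}

theorem ProdSpace.inner_eq (u v : ProdSpace Ω β) :
    inner ℂ u v = inner ℂ u.fst v.fst + inner ℂ u.snd v.snd := rfl

theorem mem_primaryDomain {u : ProdSpace Ω β} : u ∈ primaryDomain Ω ρ b β ↔
    ∃ w t, (u.fst, w) ∈ (opN Ω b).graph ∧ (u.fst, t) ∈ (tr Ω ρ).graph ∧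
      u.snd =ᵐ[weightedMeasure Ω β] t := by
  constructor
  · rintro ⟨hN, hT, hu⟩
    exact ⟨_, _, LinearPMap.mem_graph _ ⟨_, hN⟩, LinearPMap.mem_graph _ ⟨_, hT⟩, hu⟩
  · rintro ⟨w, t, hw, ht, hu⟩
    have hT := LinearPMap.mem_domain_of_mem_graph ht
    refine ⟨LinearPMap.mem_domain_of_mem_graph hw, hT, ?_⟩
    rwa [← (LinearPMap.image_iff hT).2 ht]

theorem primaryOpN_mem_graph (u : primaryDomain Ω ρ b β) :
    ((u : ProdSpace Ω β).fst, primaryOpN Ω ρ b β u) ∈ (opN Ω b).graph :=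
  LinearPMap.mem_graph (opN Ω b) ⟨(u : ProdSpace Ω β).fst, u.2.1⟩

theorem primaryOpN_eq {u : ProdSpace Ω β} (hu : u ∈ primaryDomain Ω ρ b β) {w : L2 Ω}
    (hw : (u.fst, w) ∈ (opN Ω b).graph) : primaryOpN Ω ρ b β ⟨u, hu⟩ = w :=
  ((LinearPMap.image_iff hu.1).2 hw).symm

theorem primaryForm_apply (u v : (primaryForm Ω ρ b α β γ).domain) :
    (primaryForm Ω ρ b α β γ).form u v =
      inner ℂ (primaryOpN Ω ρ b β v) (mulLinfty α (primaryOpN Ω ρ b β u)) +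
      inner ℂ (v : ProdSpace Ω β).snd (mulGamma Ω β γ (u : ProdSpace Ω β).snd) := rfl

theorem primaryForm_apply_of_mem_graph {u v : (primaryForm Ω ρ b α β γ).domain} {w w' : L2 Ω}
    (hw : ((u : ProdSpace Ω β).fst, w) ∈ (opN Ω b).graph)
    (hw' : ((v : ProdSpace Ω β).fst, w') ∈ (opN Ω b).graph) :
    (primaryForm Ω ρ b α β γ).form u v = inner ℂ w' (mulLinfty α w) +
      inner ℂ (v : ProdSpace Ω β).snd (mulGamma Ω β γ (u : ProdSpace Ω β).snd) := by
  have h1 : primaryOpN Ω ρ b β u = w := primaryOpN_eq u.2 hw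
  have h2 : primaryOpN Ω ρ b β v = w' := primaryOpN_eq v.2 hw'
  rw [← h1, ← h2]
  rfl

theorem coeFn_mulGamma (f : Lp ℂ 2 (weightedMeasure Ω β)) :
    mulGamma Ω β γ f =ᵐ[weightedMeasure Ω β] fun x => (γ x : ℂ) * f x := by
  have h : linftyOfAC (weightedMeasure_ac Ω β) γ =ᵐ[weightedMeasure Ω β] γ := MemLp.coeFn_toLp _
  filter_upwards [coeFn_mulLinfty (linftyOfAC (weightedMeasure_ac Ω β) γ) f, h] with x h1 h2
  rw [mulGamma, h1, h2]

theorem exists_norm_mulGamma_le (β γ : Lp ℝ ⊤ (surfaceMeasure Ω)) : ∃ G : ℝ, 0 ≤ G ∧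
    ∀ f : Lp ℂ 2 (weightedMeasure Ω β), ‖mulGamma Ω β γ f‖ ≤ G * ‖f‖ :=
  ⟨_, norm_nonneg _, norm_mulLinfty_le (linftyOfAC (weightedMeasure_ac Ω β) γ)⟩

theorem primaryForm_isSymmetric : (primaryForm Ω ρ b α β γ).IsSymmetric := fun u v => by
  rw [primaryForm_apply, primaryForm_apply, star_add, ← starRingEnd_apply, ← starRingEnd_apply,
    inner_conj_symm, inner_conj_symm, inner_mulLinfty_left, mulGamma, inner_mulLinfty_left]

variable {η : ℝ}

/-- The quadratic form controls `B_N u₁`. -/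
theorem exists_le_primaryForm
    (hα : ∀ᵐ x ∂((volume : Measure (Space d)).restrict Ω), η ≤ α x) :
    ∃ G : ℝ, 0 ≤ G ∧ ∀ u : (primaryForm Ω ρ b α β γ).domain,
      η * ‖primaryOpN Ω ρ b β u‖ ^ 2 ≤
        ((primaryForm Ω ρ b α β γ).form u u).re + G * ‖(u : ProdSpace Ω β)‖ ^ 2 := by
  obtain ⟨G, hG0, hG⟩ := exists_norm_mulGamma_le β γ
  refine ⟨G, hG0, fun u => ?_⟩
  rw [primaryForm_apply, Complex.add_re]
  have h1 := le_inner_mulLinfty hα (primaryOpN Ω ρ b β u)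
  have h2 := (abs_le.1 ((Complex.abs_re_le_norm _).trans
    (norm_inner_le_norm (𝕜 := ℂ) (u : ProdSpace Ω β).snd
      (mulGamma Ω β γ (u : ProdSpace Ω β).snd)))).1
  have h3 := hG (u : ProdSpace Ω β).snd
  have h4 := WithLp.norm_snd_le _ (u : ProdSpace Ω β)
  have h5 : ‖(u : ProdSpace Ω β).snd‖ * ‖mulGamma Ω β γ (u : ProdSpace Ω β).snd‖ ≤
      ‖(u : ProdSpace Ω β)‖ * (G * ‖(u : ProdSpace Ω β)‖) := by
    gcongr; exact h3.trans (by gcongr)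
  nlinarith

theorem exists_norm_primaryForm_le (Ω : Set (Space d)) (ρ : ℝ) (b : SesqForm (L2 Ω))
    (α : Lp ℝ ⊤ ((volume : Measure (Space d)).restrict Ω)) (β γ : Lp ℝ ⊤ (surfaceMeasure Ω)) :
    ∃ G : ℝ, 0 ≤ G ∧ ∀ u v : (primaryForm Ω ρ b α β γ).domain,
      ‖(primaryForm Ω ρ b α β γ).form u v‖ ≤
        ‖α‖ * (‖primaryOpN Ω ρ b β u‖ * ‖primaryOpN Ω ρ b β v‖) +
          G * (‖(u : ProdSpace Ω β)‖ * ‖(v : ProdSpace Ω β)‖) := by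
  obtain ⟨G, hG0, hG⟩ := exists_norm_mulGamma_le β γ
  refine ⟨G, hG0, fun u v => ?_⟩
  rw [primaryForm_apply]
  refine (norm_add_le _ _).trans (add_le_add ?_ ?_)
  · refine (norm_inner_le_norm _ _).trans ?_
    calc _ ≤ ‖primaryOpN Ω ρ b β v‖ * (‖α‖ * ‖primaryOpN Ω ρ b β u‖) := by
          gcongr; exact norm_mulLinfty_le _ _
      _ = _ := by ring
  · refine (norm_inner_le_norm _ _).trans ?_
    calc _ ≤ ‖(v : ProdSpace Ω β)‖ * (G * ‖(u : ProdSpace Ω β)‖) := by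
          gcongr
          · exact WithLp.norm_snd_le _ _
          · exact (hG _).trans (by gcongr; exact WithLp.norm_snd_le _ _)
      _ = _ := by ring

theorem primaryForm_semibounded (hη : 0 < η)
    (hα : ∀ᵐ x ∂((volume : Measure (Space d)).restrict Ω), η ≤ α x) :
    ∃ c, (primaryForm Ω ρ b α β γ).IsSemiBound c := by
  obtain ⟨G, -, hG⟩ := exists_le_primaryForm (ρ := ρ) (b := b) (β := β) (γ := γ) hα
  refine ⟨-G, fun u => ?_⟩
  have := hG u
  have h1 : 0 ≤ η * ‖primaryOpN Ω ρ b β u‖ ^ 2 := by positivity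
  linarith

theorem exists_norm_primaryOpN_le (hη : 0 < η)
    (hα : ∀ᵐ x ∂((volume : Measure (Space d)).restrict Ω), η ≤ α x) :
    ∃ D : ℝ, 0 ≤ D ∧ ∀ u : (primaryForm Ω ρ b α β γ).domain,
      ‖primaryOpN Ω ρ b β u‖ ≤ D * (primaryForm Ω ρ b α β γ).formNorm u := by
  obtain ⟨G, hG0, hG⟩ := exists_le_primaryForm (ρ := ρ) (b := b) (β := β) (γ := γ) hα
  have hsb := primaryForm_semibounded (ρ := ρ) (b := b) (β := β) (γ := γ) hη hα
  set a := primaryForm Ω ρ b α β γ with ha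
  set K := 1 + |1 - a.maxSemiBound| + G with hK
  have hK0 : 0 ≤ K := by positivity
  refine ⟨Real.sqrt (η⁻¹ * K), Real.sqrt_nonneg _, fun u => ?_⟩
  refine (sq_le_sq₀ (norm_nonneg _)
    (mul_nonneg (Real.sqrt_nonneg _) (SesqForm.formNorm_nonneg u))).1 ?_
  rw [mul_pow, Real.sq_sqrt (by positivity), mul_assoc, ← div_eq_inv_mul, le_div_iff₀ hη]
  have h1 := SesqForm.formNorm_sq hsb u
  have h2 : ‖(u : ProdSpace Ω β)‖ ^ 2 ≤ a.formNorm u ^ 2 := by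
    gcongr; exact SesqForm.norm_le_formNorm hsb u
  have h3 := mul_le_mul_of_nonneg_right (neg_abs_le (1 - a.maxSemiBound))
    (sq_nonneg ‖(u : ProdSpace Ω β)‖)
  have h4 := mul_le_mul_of_nonneg_left h2 (abs_nonneg (1 - a.maxSemiBound))
  have h5 := mul_le_mul_of_nonneg_left h2 hG0
  have h6 := hG u
  rw [hK]
  linarith

theorem primaryForm_isContinuous (hη : 0 < η)
    (hα : ∀ᵐ x ∂((volume : Measure (Space d)).restrict Ω), η ≤ α x) :
    (primaryForm Ω ρ b α β γ).IsContinuous := by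
  have hsb := primaryForm_semibounded (ρ := ρ) (b := b) (β := β) (γ := γ) hη hα
  obtain ⟨D, hD0, hD⟩ := exists_norm_primaryOpN_le (ρ := ρ) (b := b) (β := β) (γ := γ) hη hα
  obtain ⟨G, hG0, hG⟩ := exists_norm_primaryForm_le Ω ρ b α β γ
  refine ⟨‖α‖ * D ^ 2 + G, fun u v => (hG u v).trans ?_⟩
  have hu := SesqForm.formNorm_nonneg u
  have hv := SesqForm.formNorm_nonneg v
  calc _ ≤ ‖α‖ * ((D * (primaryForm Ω ρ b α β γ).formNorm u) *
        (D * (primaryForm Ω ρ b α β γ).formNorm v)) +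
        G * ((primaryForm Ω ρ b α β γ).formNorm u * (primaryForm Ω ρ b α β γ).formNorm v) := by
        gcongr
        · exact hD u
        · exact hD v
        · exact SesqForm.norm_le_formNorm hsb u
        · exact SesqForm.norm_le_formNorm hsb v
    _ = _ := by ring

namespace IsTraceSetting

variable (h : IsTraceSetting Ω ρ b)
include h

/-- The primary domain is closed in the graph norm of `B_N`. -/
theorem mem_primaryDomain_of_tendsto (hη : 0 < η) (hβ : ∀ᵐ x ∂(surfaceMeasure Ω), η ≤ β x)
    {x : ℕ → primaryDomain Ω ρ b β} {u : ProdSpace Ω β} {w : L2 Ω}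
    (hx : Tendsto (fun n => (x n : ProdSpace Ω β)) atTop (𝓝 u))
    (hw : Tendsto (fun n => primaryOpN Ω ρ b β (x n)) atTop (𝓝 w)) :
    u ∈ primaryDomain Ω ρ b β ∧ (u.fst, w) ∈ (opN Ω b).graph := by
  have hx0 := tendsto_iff_norm_sub_tendsto_zero.1 hx
  have hw0 := tendsto_iff_norm_sub_tendsto_zero.1 hw
  have h1 : Tendsto (fun n => ‖(x n : ProdSpace Ω β).fst - u.fst‖) atTop (𝓝 0) :=
    squeeze_zero (fun _ => norm_nonneg _)
      (fun n => WithLp.norm_fst_le _ ((x n : ProdSpace Ω β) - u)) hx0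
  have h2 : Tendsto (fun n => ‖(x n : ProdSpace Ω β).snd - u.snd‖) atTop (𝓝 0) :=
    squeeze_zero (fun _ => norm_nonneg _)
      (fun n => WithLp.norm_snd_le _ ((x n : ProdSpace Ω β) - u)) hx0
  have huw : (u.fst, w) ∈ (opN Ω b).graph := by
    refine h.isSelfAdjoint_opN.isClosed.mem_of_tendsto
      ((tendsto_iff_norm_sub_tendsto_zero.2 h1).prodMk_nhds hw) (Eventually.of_forall fun n => ?_)
    exact primaryOpN_mem_graph (x n)
  obtain ⟨t, ht⟩ := h.exists_mem_tr_graph huw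
  obtain ⟨C, hC0, hC⟩ := h.tr_sq_le
  obtain ⟨C', hC'0, hC'⟩ := exists_toWeighted hη hβ
  obtain ⟨f, hft, -⟩ := hC' t
  have h3 : Tendsto (fun n => C' * Real.sqrt (C * (‖(x n : ProdSpace Ω β).fst - u.fst‖ ^ 2 +
      ‖primaryOpN Ω ρ b β (x n) - w‖ ^ 2))) atTop (𝓝 0) := by
    have := ((((h1.pow 2).add (hw0.pow 2)).const_mul C).sqrt).const_mul C'
    simpa using this
  have h4 : ∀ n, ‖(x n : ProdSpace Ω β).snd - f‖ ≤
      C' * Real.sqrt (C * (‖(x n : ProdSpace Ω β).fst - u.fst‖ ^ 2 +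
        ‖primaryOpN Ω ρ b β (x n) - w‖ ^ 2)) := fun n => by
    obtain ⟨wn, tn, hwn, htn, hn⟩ := mem_primaryDomain.1 (x n).2
    obtain ⟨g, hg, hgle⟩ := hC' (tn - t)
    have e : (x n : ProdSpace Ω β).snd - f = g := by
      refine Lp.ext ?_
      filter_upwards [Lp.coeFn_sub (x n : ProdSpace Ω β).snd f, hn, hft, hg,
        (weightedMeasure_ac Ω β).ae_le (Lp.coeFn_sub tn t)] with y e1 e2 e3 e4 e5
      rw [e1, Pi.sub_apply, e2, e3, e4, e5, Pi.sub_apply]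
    rw [e]
    refine hgle.trans (mul_le_mul_of_nonneg_left (Real.le_sqrt_of_sq_le ?_) hC'0)
    exact hC _ _ _ (Submodule.sub_mem _ (primaryOpN_mem_graph (x n)) huw)
      (Submodule.sub_mem _ htn ht)
  have h5 : u.snd = f := tendsto_nhds_unique (tendsto_iff_norm_sub_tendsto_zero.2 h2)
    (tendsto_iff_norm_sub_tendsto_zero.2 (squeeze_zero (fun _ => norm_nonneg _) h4 h3))
  exact ⟨mem_primaryDomain.2 ⟨w, t, huw, ht, h5 ▸ hft⟩, huw⟩

theorem primaryForm_isClosed (hη : 0 < η)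
    (hα : ∀ᵐ x ∂((volume : Measure (Space d)).restrict Ω), η ≤ α x)
    (hβ : ∀ᵐ x ∂(surfaceMeasure Ω), η ≤ β x) : (primaryForm Ω ρ b α β γ).IsClosed := by
  have hsb := primaryForm_semibounded (ρ := ρ) (b := b) (β := β) (γ := γ) hη hα
  obtain ⟨D, hD0, hD⟩ := exists_norm_primaryOpN_le (ρ := ρ) (b := b) (β := β) (γ := γ) hη hα
  obtain ⟨G, hG0, hG⟩ := exists_norm_primaryForm_le Ω ρ b α β γ
  set a := primaryForm Ω ρ b α β γ with ha
  intro x hx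
  have hcx : CauchySeq fun n => (x n : ProdSpace Ω β) := Metric.cauchySeq_iff.2 fun ε hε => by
    obtain ⟨N, hN⟩ := hx ε hε
    refine ⟨N, fun m hm n hn => ?_⟩
    rw [dist_eq_norm]
    exact (SesqForm.norm_le_formNorm hsb (x m - x n)).trans_lt (hN m hm n hn)
  have hcw : CauchySeq fun n => primaryOpN Ω ρ b β (x n) := Metric.cauchySeq_iff.2 fun ε hε => by
    obtain ⟨N, hN⟩ := hx (ε / (D + 1)) (by positivity)
    refine ⟨N, fun m hm n hn => ?_⟩
    rw [dist_eq_norm, show primaryOpN Ω ρ b β (x m) - primaryOpN Ω ρ b β (x n) =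
      primaryOpN Ω ρ b β (x m - x n) from (map_sub (primaryOpN Ω ρ b β) (x m) (x n)).symm]
    have h1 := hN m hm n hn
    rw [lt_div_iff₀ (by positivity)] at h1
    have h2 := SesqForm.formNorm_nonneg (x m - x n)
    refine (hD (x m - x n)).trans_lt ?_
    linarith
  obtain ⟨u, hu⟩ := cauchySeq_tendsto_of_complete hcx
  obtain ⟨w, hw⟩ := cauchySeq_tendsto_of_complete hcw
  obtain ⟨hmem, hgr⟩ := h.mem_primaryDomain_of_tendsto hη hβ hu hw
  refine ⟨⟨u, hmem⟩, ?_⟩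
  have hx0 := tendsto_iff_norm_sub_tendsto_zero.1 hu
  have hw0 := tendsto_iff_norm_sub_tendsto_zero.1 hw
  have hB : ∀ n, primaryOpN Ω ρ b β (x n - ⟨u, hmem⟩ : a.domain) =
      primaryOpN Ω ρ b β (x n) - w := fun n => by
    rw [← primaryOpN_eq hmem hgr]
    exact map_sub (primaryOpN Ω ρ b β) (x n) ⟨u, hmem⟩
  have h3 : Tendsto (fun n => Real.sqrt (‖α‖ * ‖primaryOpN Ω ρ b β (x n) - w‖ ^ 2 +
      (G + |1 - a.maxSemiBound|) * ‖(x n : ProdSpace Ω β) - u‖ ^ 2)) atTop (𝓝 0) := by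
    have := (((hw0.pow 2).const_mul ‖α‖).add
      ((hx0.pow 2).const_mul (G + |1 - a.maxSemiBound|))).sqrt
    simpa using this
  refine squeeze_zero (fun n => SesqForm.formNorm_nonneg _) (fun n => ?_) h3
  refine Real.le_sqrt_of_sq_le ?_
  rw [SesqForm.formNorm_sq hsb]
  have h4 := (Complex.re_le_norm _).trans (hG (x n - ⟨u, hmem⟩ : a.domain) (x n - ⟨u, hmem⟩ : a.domain))
  rw [hB] at h4
  have e : ((x n - ⟨u, hmem⟩ : a.domain) : ProdSpace Ω β) = (x n : ProdSpace Ω β) - u := rfl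
  rw [e] at h4 ⊢
  have h5 := mul_le_mul_of_nonneg_right (le_abs_self (1 - a.maxSemiBound))
    (sq_nonneg ‖(x n : ProdSpace Ω β) - u‖)
  rw [add_mul, sq, sq] at *
  linarith

omit h in
/-- Every element of `D(B_N)` is the first entry of an element of the primary domain. -/
theorem exists_mem_primaryDomain (hη : 0 < η) (hβ : ∀ᵐ x ∂(surfaceMeasure Ω), η ≤ β x)
    {v w : L2 Ω} {t : L2Bdry Ω} (hw : (v, w) ∈ (opN Ω b).graph) (ht : (v, t) ∈ (tr Ω ρ).graph) :
    ∃ f : Lp ℂ 2 (weightedMeasure Ω β), f =ᵐ[weightedMeasure Ω β] t ∧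
      (WithLp.toLp 2 (v, f) : ProdSpace Ω β) ∈ primaryDomain Ω ρ b β := by
  obtain ⟨C, -, hC⟩ := exists_toWeighted hη hβ
  obtain ⟨f, hf, -⟩ := hC t
  exact ⟨f, hf, mem_primaryDomain.2 ⟨w, t, hw, ht, hf⟩⟩

/-- An element of `ℋ` orthogonal to `D(a)` vanishes: its first entry because `D(B_0)` is dense and
`tr` vanishes there, its second entry because `tr D(B_N)` is dense. -/
theorem primaryForm_dense (hη : 0 < η) (hβ : ∀ᵐ x ∂(surfaceMeasure Ω), η ≤ β x) :
    Dense ((primaryForm Ω ρ b α β γ).domain : Set (ProdSpace Ω β)) := by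
  have hbot : (primaryDomain Ω ρ b β)ᗮ = ⊥ := by
    rw [Submodule.eq_bot_iff]
    intro z hz
    obtain ⟨s, hs⟩ := exists_eq_mul_of_weighted hη hβ z.snd
    have key : ∀ v w t, (v, w) ∈ (opN Ω b).graph → (v, t) ∈ (tr Ω ρ).graph →
        inner ℂ v z.fst + inner ℂ t s = 0 := fun v w t hw ht => by
      obtain ⟨f, hf, hmem⟩ := exists_mem_primaryDomain hη hβ hw ht
      have := (Submodule.mem_orthogonal _ _).1 hz _ hmem
      rw [ProdSpace.inner_eq] at this
      rw [← inner_weighted hη hβ hf hs]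
      exact this
    have h1 : z.fst = 0 := by
      refine h.dense.eq_zero_of_inner_left (𝕜 := ℂ) fun v hv => ?_
      have := key v _ 0 (LinearPMap.mem_graph _ ⟨v, hv.2⟩) (mem_tr_graph_of_mem_opD hv.1)
      rw [inner_zero_left, add_zero] at this
      exact inner_eq_zero_symm.1 this
    have h2 : s = 0 := h.eq_zero_of_orthogonal s fun v w t hw ht => by
      have := key v w t hw ht
      rwa [h1, inner_zero_right, zero_add] at this
    have h3 : z.snd = 0 := by
      refine Lp.ext ?_
      filter_upwards [hs, (weightedMeasure_ac Ω β).ae_le (Lp.coeFn_zero ℂ 2 (surfaceMeasure Ω)),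
        Lp.coeFn_zero ℂ 2 (weightedMeasure Ω β)] with x e1 e2 e3
      rw [e1, h2, e2, e3]
      simp
    rw [← norm_eq_zero, ← sq_eq_zero_iff, WithLp.prod_norm_sq_eq_of_L2, h1, h3]
    simp
  have := Submodule.topologicalClosure_eq_top_iff.2 hbot
  exact Submodule.dense_iff_topologicalClosure_eq_top.2 this

theorem primaryForm_isGenerating (hη : 0 < η)
    (hα : ∀ᵐ x ∂((volume : Measure (Space d)).restrict Ω), η ≤ α x)
    (hβ : ∀ᵐ x ∂(surfaceMeasure Ω), η ≤ β x) : (primaryForm Ω ρ b α β γ).IsGenerating :=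
  ⟨h.primaryForm_dense hη hβ, primaryForm_semibounded hη hα, primaryForm_isContinuous hη hα,
    h.primaryForm_isClosed hη hα hβ⟩

/-- The operator of the primary form is the Wentzell operator matrix. Testing with `v ∈ D(B_0)`, where
`tr v = 0`, gives the equation in `Ω`; what is left is the equation on `Γ`, whose right hand side is
written as `β` times an element `s` of `L²(Γ)`. -/
theorem mem_primaryOp_graph (hη : 0 < η) (hβ : ∀ᵐ x ∂(surfaceMeasure Ω), η ≤ β x)
    {u f : ProdSpace Ω β} : (u, f) ∈ (primaryOp Ω ρ b α β γ).graph ↔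
      ∃ w t s, (u.fst, w) ∈ (opN Ω b).graph ∧ (u.fst, t) ∈ (tr Ω ρ).graph ∧
        u.snd =ᵐ[weightedMeasure Ω β] t ∧ (mulLinfty α w, f.fst) ∈ (op0Adj Ω ρ b).graph ∧
        (mulLinfty α w, s) ∈ (veryWeakNeumann Ω ρ b).graph ∧
        ∀ᵐ x ∂(weightedMeasure Ω β), f.snd x = -(β x : ℂ) * s x + (γ x : ℂ) * u.snd x := by
  rw [h.veryWeakNeumann_graph, primaryOp, SesqForm.op_graph (h.primaryForm_dense hη hβ)]
  constructor
  · rintro ⟨hu, H⟩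
    obtain ⟨w, t, hw, ht, hut⟩ := mem_primaryDomain.1 hu
    obtain ⟨s, hs⟩ := exists_eq_mul_of_weighted hη hβ (mulGamma Ω β γ u.snd - f.snd)
    have key : ∀ v w' t', (v, w') ∈ (opN Ω b).graph → (v, t') ∈ (tr Ω ρ).graph →
        inner ℂ v f.fst - inner ℂ w' (mulLinfty α w) = inner ℂ t' s := fun v w' t' hw' ht' => by
      obtain ⟨g, hg, hmem⟩ := exists_mem_primaryDomain hη hβ hw' ht'
      have h1 := H ⟨_, hmem⟩
      rw [primaryForm_apply_of_mem_graph (u := ⟨u, hu⟩) (v := ⟨_, hmem⟩) hw hw',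
        ProdSpace.inner_eq] at h1
      rw [← inner_weighted hη hβ hg hs, inner_sub_right]
      dsimp only [WithLp.toLp_fst, WithLp.toLp_snd] at h1
      linear_combination -h1
    have h0 : (mulLinfty α w, f.fst) ∈ (op0Adj Ω ρ b).graph :=
      h.mem_op0Adj_graph.2 fun v w' hv hw' => by
        have := key v w' 0 hw' (mem_tr_graph_of_mem_opD hv)
        rw [inner_zero_left, sub_eq_zero] at this
        exact this.symm
    refine ⟨w, t, s, hw, ht, hut, h0, mem_veryWeakNeumannGraph.2 ⟨f.fst, h0, key⟩, ?_⟩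
    filter_upwards [hs, Lp.coeFn_sub (mulGamma Ω β γ u.snd) f.snd, coeFn_mulGamma u.snd]
      with x e1 e2 e3
    rw [e2, Pi.sub_apply, e3] at e1
    linear_combination -e1
  · rintro ⟨w, t, s, hw, ht, hut, h0, hs, hf⟩
    have hu : u ∈ primaryDomain Ω ρ b β := mem_primaryDomain.2 ⟨w, t, hw, ht, hut⟩
    refine ⟨hu, fun v => ?_⟩
    obtain ⟨w', t', hw', ht', hvt⟩ := mem_primaryDomain.1 v.2
    obtain ⟨f', hf', H⟩ := mem_veryWeakNeumannGraph.1 hs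
    have hff : f' = f.fst := LinearPMap.mem_graph_snd_inj _ hf' h0 rfl
    have hsf : (mulGamma Ω β γ u.snd - f.snd : Lp ℂ 2 (weightedMeasure Ω β))
        =ᵐ[weightedMeasure Ω β] fun x => (β x : ℂ) * s x := by
      filter_upwards [hf, Lp.coeFn_sub (mulGamma Ω β γ u.snd) f.snd, coeFn_mulGamma u.snd]
        with x e1 e2 e3
      rw [e2, Pi.sub_apply, e3, e1]
      ring
    have h1 := H _ _ _ hw' ht'
    rw [← inner_weighted hη hβ hvt hsf, inner_sub_right, hff] at h1
    rw [primaryForm_apply_of_mem_graph (u := ⟨u, hu⟩) hw hw', ProdSpace.inner_eq]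
    dsimp only
    linear_combination -h1

end IsTraceSetting

end Wentzell

/-! ### The Wentzell operator matrix and the Cauchy problem -/

namespace Wentzell

variable {d : ℕ} {Ω : Set (Space d)} {ρ : ℝ} {b : SesqForm (L2 Ω)}
  {α : Lp ℝ ⊤ ((volume : Measure (Space d)).restrict Ω)} {β γ : Lp ℝ ⊤ (surfaceMeasure Ω)}
  {η : ℝ}

theorem mem_wentzellDomain_and_isWentzellValue_iff {N : L2 Ω →ₗ.[ℂ] L2Bdry Ω}
    {u f : ProdSpace Ω β} :
    u ∈ wentzellDomain Ω ρ b α β N ∧ IsWentzellValue Ω ρ b α β γ N u f ↔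
      ∃ w t s, (u.fst, w) ∈ (opN Ω b).graph ∧ (u.fst, t) ∈ (tr Ω ρ).graph ∧
        u.snd =ᵐ[weightedMeasure Ω β] t ∧ (mulLinfty α w, f.fst) ∈ (op0Adj Ω ρ b).graph ∧
        (mulLinfty α w, s) ∈ N.graph ∧
        ∀ᵐ x ∂(weightedMeasure Ω β), f.snd x = -(β x : ℂ) * s x + (γ x : ℂ) * u.snd x := by
  constructor
  · rintro ⟨⟨-, hT, hu⟩, hN, h0, hs, hf1, hf2⟩
    refine ⟨_, _, _, LinearPMap.mem_graph _ ⟨_, hN⟩, LinearPMap.mem_graph _ ⟨_, hT⟩, hu, ?_,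
      LinearPMap.mem_graph _ ⟨_, hs⟩, hf2⟩
    rw [hf1]
    exact LinearPMap.mem_graph _ ⟨_, h0⟩
  · rintro ⟨w, t, s, hw, ht, hu, h0, hs, hf⟩
    have hN := LinearPMap.mem_domain_of_mem_graph hw
    have hT := LinearPMap.mem_domain_of_mem_graph ht
    obtain rfl := (LinearPMap.image_iff hN).2 hw
    obtain rfl := (LinearPMap.image_iff hT).2 ht
    have h0' := LinearPMap.mem_domain_of_mem_graph h0
    have hs' := LinearPMap.mem_domain_of_mem_graph hs
    obtain rfl := (LinearPMap.image_iff hs').2 hs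
    exact ⟨⟨⟨hN, hs'⟩, hT, hu⟩, hN, h0', hs', (LinearPMap.image_iff h0').2 h0, hf⟩

namespace IsTraceSetting

variable (h : IsTraceSetting Ω ρ b)
include h

theorem mem_primaryOp_graph_iff (hη : 0 < η) (hβ : ∀ᵐ x ∂(surfaceMeasure Ω), η ≤ β x)
    {u f : ProdSpace Ω β} : (u, f) ∈ (primaryOp Ω ρ b α β γ).graph ↔
      u ∈ wentzellDomain Ω ρ b α β (veryWeakNeumann Ω ρ b) ∧
        IsWentzellValue Ω ρ b α β γ (veryWeakNeumann Ω ρ b) u f := by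
  rw [h.mem_primaryOp_graph hη hβ, mem_wentzellDomain_and_isWentzellValue_iff]

theorem primaryOp_domain_eq (hη : 0 < η) (hβ : ∀ᵐ x ∂(surfaceMeasure Ω), η ≤ β x) :
    ((primaryOp Ω ρ b α β γ).domain : Set (ProdSpace Ω β)) =
      wentzellDomain Ω ρ b α β (veryWeakNeumann Ω ρ b) := by
  ext u
  constructor
  · intro hu
    exact ((h.mem_primaryOp_graph_iff hη hβ).1 (LinearPMap.mem_graph _ ⟨u, hu⟩)).1
  · rintro ⟨⟨hN, hs⟩, hT, hu⟩
    -- the value of the operator matrix at `u` is an element of `ℋ`, as `β` is bounded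
    have hg := LinearPMap.mem_graph (veryWeakNeumann Ω ρ b) ⟨_, hs⟩
    have hg' := hg
    rw [h.veryWeakNeumann_graph] at hg'
    obtain ⟨f₁, hf₁, -⟩ := mem_veryWeakNeumannGraph.1 hg'
    obtain ⟨f₂, hf₂⟩ := exists_eq_mul_weighted hη hβ (veryWeakNeumann Ω ρ b ⟨_, hs⟩)
    refine LinearPMap.mem_domain_of_mem_graph (y := (WithLp.toLp 2
      (f₁, mulGamma Ω β γ u.snd - f₂) : ProdSpace Ω β)) ((h.mem_primaryOp_graph hη hβ).2
      ⟨_, _, _, LinearPMap.mem_graph _ ⟨_, hN⟩, LinearPMap.mem_graph _ ⟨_, hT⟩, hu, hf₁, hg, ?_⟩)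
    filter_upwards [hf₂, Lp.coeFn_sub (mulGamma Ω β γ u.snd) f₂, coeFn_mulGamma u.snd]
      with x e1 e2 e3
    rw [WithLp.toLp_snd, e2, Pi.sub_apply, e3, e1]
    ring

/-- A solution of the Cauchy problem is a classical solution of `u' = -𝒜 u`; the homogeneous
Neumann condition holds on all of `D(B_N)`. -/
theorem isWentzellSolution_iff (hη : 0 < η) (hβ : ∀ᵐ x ∂(surfaceMeasure Ω), η ≤ β x)
    {u₀ : ProdSpace Ω β} {u : ℝ → ProdSpace Ω β} :
    IsWentzellSolution Ω ρ b α β γ (veryWeakNeumann Ω ρ b) u₀ u ↔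
      ContinuousOn u (Ici 0) ∧ u 0 = u₀ ∧ ContDiffOn ℝ 1 u (Ioi 0) ∧
        ∀ t > 0, (u t, -deriv u t) ∈ (primaryOp Ω ρ b α β γ).graph := by
  constructor
  · exact fun H => ⟨H.continuous, H.initial, H.contDiff, fun t ht =>
      (h.mem_primaryOp_graph_iff hη hβ).2 ⟨H.mem_domain t ht, H.evolution t ht⟩⟩
  · rintro ⟨h1, h2, h3, h4⟩
    refine ⟨h1, h2, h3, fun t ht => ((h.mem_primaryOp_graph_iff hη hβ).1 (h4 t ht)).1,
      fun t ht => ?_, fun t ht => ((h.mem_primaryOp_graph_iff hη hβ).1 (h4 t ht)).2⟩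
    obtain ⟨w, -, -, hw, -⟩ := (h.mem_primaryOp_graph hη hβ).1 (h4 t ht)
    have hg := h.mem_veryWeakNeumannGraph_zero hw
    rw [← h.veryWeakNeumann_graph] at hg
    have hg' := LinearPMap.mem_domain_of_mem_graph hg
    exact ⟨hg', ((LinearPMap.image_iff hg').2 hg).symm⟩

end IsTraceSetting

end Wentzell

theorem mainTheorem2 {d : ℕ} (hd : 1 ≤ d) (Ω : Set (Wentzell.Space d))
    (hΩ : Wentzell.IsBoundedLipschitzDomain Ω)
    (α : Lp ℝ ⊤ ((volume : Measure (Wentzell.Space d)).restrict Ω))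
    (β γ : Lp ℝ ⊤ (Wentzell.surfaceMeasure Ω))
    (η : ℝ) (hη : 0 < η)
    (hα : ∀ᵐ x ∂((volume : Measure (Wentzell.Space d)).restrict Ω), η ≤ α x)
    (hβ : ∀ᵐ x ∂(Wentzell.surfaceMeasure Ω), η ≤ β x)
    (ρ : ℝ) (hρ₀ : 0 < ρ) (hρ₁ : ρ < 1)
    (b : Wentzell.SesqForm (Wentzell.L2 Ω)) (hb : Wentzell.IsAdmissible Ω ρ b)
    (hdense : Dense (((Wentzell.opD Ω ρ b).domain ⊓ (Wentzell.opN Ω b).domain :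
      Submodule ℂ (Wentzell.L2 Ω)) : Set (Wentzell.L2 Ω))) :
    -- the Dirichlet trace and both Neumann traces are well-defined operators
    ((Wentzell.tr Ω ρ).graph = Wentzell.traceGraph Ω (1 / 2 + ρ) ∧
      (∀ u : Wentzell.L2 Ω, u ∈ (Wentzell.tr Ω ρ).domain ↔
        Wentzell.MemSobolev Ω (1 / 2 + ρ) u) ∧
      (Wentzell.weakNeumann Ω ρ b).graph = Wentzell.weakNeumannGraph Ω ρ b ∧
      (Wentzell.veryWeakNeumann Ω ρ b).graph = Wentzell.veryWeakNeumannGraph Ω ρ b) ∧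
    -- generation, and unique solvability of the Cauchy problem
    (Wentzell.primaryForm Ω ρ b α β γ).IsGenerating ∧
    (Wentzell.primaryForm Ω ρ b α β γ).IsSymmetric ∧
    IsSelfAdjoint (Wentzell.primaryOp Ω ρ b α β γ) ∧
    (∃ T : ℝ → Wentzell.ProdSpace Ω β →L[ℂ] Wentzell.ProdSpace Ω β,
      Wentzell.IsAnalyticSemigroup T ∧
      Wentzell.IsGeneratorOf (-Wentzell.primaryOp Ω ρ b α β γ) T ∧
      (∀ u₀ : Wentzell.ProdSpace Ω β,
        Wentzell.IsWentzellSolution Ω ρ b α β γ (Wentzell.veryWeakNeumann Ω ρ b) u₀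
          (fun t => T t u₀) ∧
        ∀ u : ℝ → Wentzell.ProdSpace Ω β,
          Wentzell.IsWentzellSolution Ω ρ b α β γ (Wentzell.veryWeakNeumann Ω ρ b) u₀ u →
          ∀ t ≥ 0, u t = T t u₀) ∧
      ((∀ g : Wentzell.L2Bdry Ω, ∃ u, Wentzell.weakNeumann Ω ρ b u = g) →
        ∀ u₀ : Wentzell.ProdSpace Ω β,
          Wentzell.IsWentzellSolution Ω ρ b α β γ (Wentzell.weakNeumann Ω ρ b) u₀
            (fun t => T t u₀) ∧
          ∀ u : ℝ → Wentzell.ProdSpace Ω β,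
            Wentzell.IsWentzellSolution Ω ρ b α β γ (Wentzell.weakNeumann Ω ρ b) u₀ u →
            ∀ t ≥ 0, u t = T t u₀)) ∧
    -- the operator matrix and its domain
    (((Wentzell.primaryOp Ω ρ b α β γ).domain : Set (Wentzell.ProdSpace Ω β)) =
        Wentzell.wentzellDomain Ω ρ b α β (Wentzell.veryWeakNeumann Ω ρ b) ∧
      ∀ u : (Wentzell.primaryOp Ω ρ b α β γ).domain,
        Wentzell.IsWentzellValue Ω ρ b α β γ (Wentzell.veryWeakNeumann Ω ρ b) u
          (Wentzell.primaryOp Ω ρ b α β γ u)) ∧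
    -- the same with the weak Neumann trace, if that trace is surjective
    ((∀ g : Wentzell.L2Bdry Ω, ∃ u, Wentzell.weakNeumann Ω ρ b u = g) →
      ((Wentzell.primaryOp Ω ρ b α β γ).domain : Set (Wentzell.ProdSpace Ω β)) =
          Wentzell.wentzellDomain Ω ρ b α β (Wentzell.weakNeumann Ω ρ b) ∧
        ∀ u : (Wentzell.primaryOp Ω ρ b α β γ).domain,
          Wentzell.IsWentzellValue Ω ρ b α β γ (Wentzell.weakNeumann Ω ρ b) u
            (Wentzell.primaryOp Ω ρ b α β γ u)) := by
  have h := hb.isTraceSetting hd hΩ hρ₀ hdense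
  have := hΩ.isFiniteMeasure_surfaceMeasure hd
  have hs : 1 / 2 < 1 / 2 + ρ := by linarith
  have hgen := h.primaryForm_isGenerating (γ := γ) hη hα hβ
  have hsym := Wentzell.primaryForm_isSymmetric (ρ := ρ) (b := b) (α := α) (β := β) (γ := γ)
  obtain ⟨R, hR⟩ := Wentzell.SesqForm.exists_isShiftedInverse hgen hsym
  obtain ⟨T, hT, hTgen, hTsol⟩ := hR.exists_analyticSemigroup
  have hop : ((Wentzell.primaryOp Ω ρ b α β γ).domain : Set (Wentzell.ProdSpace Ω β)) =
        Wentzell.wentzellDomain Ω ρ b α β (Wentzell.veryWeakNeumann Ω ρ b) ∧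
      ∀ u : (Wentzell.primaryOp Ω ρ b α β γ).domain,
        Wentzell.IsWentzellValue Ω ρ b α β γ (Wentzell.veryWeakNeumann Ω ρ b) u
          (Wentzell.primaryOp Ω ρ b α β γ u) :=
    ⟨h.primaryOp_domain_eq hη hβ, fun u =>
      ((h.mem_primaryOp_graph_iff hη hβ).1 (LinearPMap.mem_graph _ u)).2⟩
  have hcauchy : ∀ u₀ : Wentzell.ProdSpace Ω β,
      Wentzell.IsWentzellSolution Ω ρ b α β γ (Wentzell.veryWeakNeumann Ω ρ b) u₀
        (fun t => T t u₀) ∧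
      ∀ u : ℝ → Wentzell.ProdSpace Ω β,
        Wentzell.IsWentzellSolution Ω ρ b α β γ (Wentzell.veryWeakNeumann Ω ρ b) u₀ u →
        ∀ t ≥ 0, u t = T t u₀ := fun u₀ => by
    obtain ⟨h1, h2, h3⟩ := hTsol u₀
    have h0 : T 0 u₀ = u₀ := by rw [hT.c0.zero]; rfl
    have hdiff : ∀ v : ℝ → Wentzell.ProdSpace Ω β, ContDiffOn ℝ 1 v (Ioi 0) →
        ∀ t > 0, DifferentiableAt ℝ v t := fun v hv t ht =>
      (hv.differentiableOn one_ne_zero).differentiableAt (Ioi_mem_nhds ht)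
    refine ⟨(h.isWentzellSolution_iff hη hβ).2 ⟨h1, h0, h2, h3⟩, fun u hu => ?_⟩
    obtain ⟨h1', h0', h2', h3'⟩ := (h.isWentzellSolution_iff hη hβ).1 hu
    exact hR.eq_of_deriv_mem_graph h1' h1 (hdiff _ h2') (hdiff _ h2) h3' h3 (h0'.trans h0.symm)
  refine ⟨⟨hΩ.trace_graph hd hs, hΩ.mem_trace_domain_iff hd hs, h.weakNeumann_graph,
    h.veryWeakNeumann_graph⟩, hgen, hsym, hR.isSelfAdjoint,
    ⟨T, hT, hTgen, hcauchy, fun hN => ?_⟩, hop, fun hN => ?_⟩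
  · rw [h.weakNeumann_eq hN]
    exact hcauchy
  · rw [h.weakNeumann_eq hN]
    exact hop
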